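/- Let $q\ge 7$ be an odd prime power and let $\Sigma_\infty$ be a hyperplane (the hyperplane at infinity) of $\mathrm{PG}(4,q)$. Points of $\mathrm{PG}(4,q)$ not in $\Sigma_\infty$, and planes not contained in $\Sigma_\infty$, are called affine. A ($k$-)arc is a set of ($k$) points with no three on a line. A spread of $\Sigma_\infty$ is a set of lines of $\Sigma_\infty$ such that every point of $\Sigma_\infty$ lies on exactly one of them. For a spread $\mathcal S$ of $\Sigma_\infty$, the Bruck–Bose plane $\mathcal P(\mathcal S)$ is the projective plane whose points are the affine points and the elements of $\mathcal S$, and whose lines are the affine planes that meet $\Sigma_\infty$ in a line of $\mathcal S$, together with the line at infinity $\ell_\infty=\mathcal S$; incidence is inclusion. Let $\mathcal C$ be a set of $q^2$ affine points, and suppose that there is a set of affine planes, called $\mathcal C$-planes, such that: (A1) each $\mathcal C$-plane meets $\mathcal C$ in a $q$-arc, and every plane meeting $\mathcal C$ in more than four points is a $\mathcal C$-plane; (A2) every two distinct points of $\mathcal C$ lie in exactly one $\mathcal C$-plane; (A3) every affine point is a point of $\mathcal C$, or lies on no $\mathcal C$-plane, or lies on exactly two $\mathcal C$-planes. For a $\mathcal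 C$-plane $\pi$, the $\infty$-point $\pi_\infty$ is the point for which $(\pi\cap\mathcal C)\cup\{\pi_\infty\}$ is a non-degenerate conic of $\pi$. A $0$-point is a point of $\Sigma_\infty$ on none of the lines $\pi\cap\Sigma_\infty$, $\pi$ a $\mathcal C$-plane. Let $t_\infty$ be the set of all $\infty$-points and $0$-points. For $A\in\mathcal C$, let $t_A$ be the set of the points in which $\Sigma_\infty$ meets the tangents at $A$ to the conics $(\pi\cap\mathcal C)\cup\{\pi_\infty\}$, where $\pi$ runs over the $\mathcal C$-planes through $A$. Put $\mathcal S=\{t_A : A\in\mathcal C\}\cup\{t_\infty\}$. Theorem. $\mathcal S$ is a spread of $\Sigma_\infty$. If $\mathcal S'$ is any spread of $\Sigma_\infty$ different from $\mathcal S$, then the points of $\mathcal C$ do not form an arc in the Bruck–Bose plane $\mathcal P(\mathcal S')$. Hence there is exactly one spread of $\Sigma_\infty$ in whose Bruck–Bose plane the points of $\mathcal C$ form a $q^2$-arc (namely $\mathcal S$). -/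

import Mathlib

open scoped LinearAlgebra.Projectivization

namespace BruckBose

variable {K V : Type*} [Field K] [AddCommGroup V] [Module K V]

/-- The set of points of the projective space `ℙ K V` lying on the flat given by the linear
subspace `W`. Lines, planes and hyperplanes are linear subspaces of vector-space dimension
2, 3 and one less than that of `V`. -/
def points (W : Submodule K V) : Set (ℙ K V) := {X | X.submodule ≤ W}

/-- `W` is a plane of the projective space not contained in the hyperplane `H` at infinity. -/
def IsAffinePlane (H W : Submodule K V) : Prop := Module.finrank K W = 3 ∧ ¬ W ≤ H

/-- A set of points of an incidence structure is an arc if no line contains three of them. -/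
def IsArc {P L : Type*} (inc : P → L → Prop) (s : Set P) : Prop :=
  ∀ a ∈ s, ∀ b ∈ s, ∀ c ∈ s, a ≠ b → a ≠ c → b ≠ c →
    ∀ l : L, ¬ (inc a l ∧ inc b l ∧ inc c l)

/-- A `k`-arc: an arc with exactly `k` points. -/
def IsKArc {P L : Type*} (inc : P → L → Prop) (k : ℕ) (s : Set P) : Prop :=
  s.ncard = k ∧ IsArc inc s

/-- Incidence of points and lines of the projective space `ℙ K V`. -/
def pgIncident (X : ℙ K V) (l : {l : Submodule K V // Module.finrank K l = 2}) : Prop :=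
  X ∈ points l.1

/-- `D` is a non-degenerate conic of the plane `W` (in odd characteristic): the set of zeros in
`W` of a quadratic form on `W` with non-degenerate polar form. -/
def IsConic (W : Submodule K V) (D : Set (ℙ K V)) : Prop :=
  ∃ Q : QuadraticForm K W, (QuadraticMap.polarBilin Q).Nondegenerate ∧
    D = {X | ∃ (v : W) (hv : (v : V) ≠ 0), X = Projectivization.mk K (v : V) hv ∧ Q v = 0}

/-- The line `l` of the plane `W` is the tangent at `A` to the conic `D` of `W`:
it meets `D` in the point `A` only. -/
def IsTangentAt (W : Submodule K V) (D : Set (ℙ K V)) (A : ℙ K V) (l : Submodule K V) : Prop :=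
  Module.finrank K l = 2 ∧ l ≤ W ∧ D ∩ points l = {A}

/-- A spread of the projective 3-space `H`: a set of lines of `H` (given by their point sets)
such that every point of `H` lies on exactly one of them. -/
def IsSpread (H : Submodule K V) (S : Set (Set (ℙ K V))) : Prop :=
  (∀ s ∈ S, ∃ l : Submodule K V, Module.finrank K l = 2 ∧ l ≤ H ∧ s = points l) ∧
    ∀ X ∈ points H, ∃! s, s ∈ S ∧ X ∈ s

/-- The points of the Bruck-Bose plane `P(S)`: the affine points, and the elements of `S`. -/
inductive PlanePoint (H : Submodule K V) (S : Set (Set (ℙ K V))) : Type _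
  | affine (X : ℙ K V) (hX : X ∉ points H) : PlanePoint H S
  | infinite (s : Set (ℙ K V)) (hs : s ∈ S) : PlanePoint H S

/-- The lines of the Bruck-Bose plane `P(S)`: the affine planes meeting `H` in an element of `S`,
and the line at infinity. -/
inductive PlaneLine (H : Submodule K V) (S : Set (Set (ℙ K V))) : Type _
  | ofPlane (W : Submodule K V) (hW : IsAffinePlane H W) (hS : points (W ⊓ H) ∈ S) : PlaneLine H S
  | atInfinity : PlaneLine H S

/-- Incidence in the Bruck-Bose plane `P(S)`. -/
def planeIncident {H : Submodule K V} {S : Set (Set (ℙ K V))} :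
    PlanePoint H S → PlaneLine H S → Prop
  | .affine X _, .ofPlane W _ _ => X ∈ points W
  | .affine _ _, .atInfinity => False
  | .infinite s _, .ofPlane W _ _ => s ⊆ points W
  | .infinite _ _, .atInfinity => True

/-- The set of points of the Bruck-Bose plane `P(S)` corresponding to the affine points in `C`. -/
def planeSet (H : Submodule K V) (S : Set (Set (ℙ K V))) (C : Set (ℙ K V)) :
    Set (PlanePoint H S) :=
  {Y | ∃ (X : ℙ K V) (hX : X ∉ points H), X ∈ C ∧ Y = PlanePoint.affine X hX}

/-- A set `C` of `q ^ 2` affine points of a 4-dimensional projective space of order `q` with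
hyperplane `H` at infinity, and a set `Pl` of affine planes (the `C`-planes), such that every
`C`-plane meets `C` in a `q`-arc, every plane with more than four points of `C` is a `C`-plane,
two points of `C` lie in exactly one `C`-plane, and every affine point lies in `C`, on no
`C`-plane or on exactly two `C`-planes. -/
structure IsConfiguration (q : ℕ) (H : Submodule K V) (C : Set (ℙ K V))
    (Pl : Set (Submodule K V)) : Prop where
  card_points : C.ncard = q ^ 2
  affine_points : ∀ X ∈ C, X ∉ points H
  affine_planes : ∀ W ∈ Pl, IsAffinePlane H W
  plane_arc : ∀ W ∈ Pl, IsKArc pgIncident q (C ∩ points W)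
  plane_of_four_lt : ∀ W : Submodule K V, Module.finrank K W = 3 →
    4 < (C ∩ points W).ncard → W ∈ Pl
  pair_plane : ∀ X ∈ C, ∀ Y ∈ C, X ≠ Y → ∃! W, W ∈ Pl ∧ X ∈ points W ∧ Y ∈ points W
  three_types : ∀ X : ℙ K V, X ∉ points H →
    X ∈ C ∨ (∀ W ∈ Pl, X ∉ points W) ∨ {W | W ∈ Pl ∧ X ∈ points W}.ncard = 2

/-- `X` is the `∞`-point of the `C`-plane `W`: the point completing `C ∩ W` to a conic of `W`. -/
def IsInftyPoint (C : Set (ℙ K V)) (W : Submodule K V) (X : ℙ K V) : Prop :=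
  IsConic W ((C ∩ points W) ∪ {X})

/-- A `0`-point: a point of `H` on no `C`-line, the `C`-lines being the lines `W ∩ H` with `W`
a `C`-plane. -/
def IsZeroPoint (H : Submodule K V) (Pl : Set (Submodule K V)) (X : ℙ K V) : Prop :=
  X ∈ points H ∧ ∀ W ∈ Pl, X ∉ points (W ⊓ H)

/-- `t_∞`: the set of `∞`-points and `0`-points. -/
def tInfty (H : Submodule K V) (C : Set (ℙ K V)) (Pl : Set (Submodule K V)) : Set (ℙ K V) :=
  {X | (∃ W ∈ Pl, IsInftyPoint C W X) ∨ IsZeroPoint H Pl X}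

/-- `t_A`: the set of points in which `H` meets the tangents at `A` of the completed conics of the
`C`-planes through `A`. -/
def tPoint (H : Submodule K V) (C : Set (ℙ K V)) (Pl : Set (Submodule K V)) (A : ℙ K V) :
    Set (ℙ K V) :=
  {X | X ∈ points H ∧ ∃ W ∈ Pl, A ∈ points W ∧ ∃ Y, IsInftyPoint C W Y ∧
    ∃ l, IsTangentAt W ((C ∩ points W) ∪ {Y}) A l ∧ X ∈ points l}

/-- The set `{t_A | A ∈ C} ∪ {t_∞}`. -/
def tSpread (H : Submodule K V) (C : Set (ℙ K V)) (Pl : Set (Submodule K V)) :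
    Set (Set (ℙ K V)) :=
  {s | ∃ A ∈ C, s = tPoint H C Pl A} ∪ {tInfty H C Pl}

end BruckBose

open BruckBose

/-!
The set `C` has a normal form. Take the vectors representing the points of `C` on an affine chart
`φ = 1`, where the hyperplane at infinity is the kernel of `φ`. Then these vectors are the points
`o + Λ u + B u u` of the graph of a quadratic map on a two-dimensional space, and the symmetric
bilinear map `B` has no zero divisors: it is a commutative division algebra of dimension two. The
configuration is thus the one obtained from a parabola by field reduction.

The normal form is found as follows. Call two planes of the configuration partners if they share an
affine line. Three planes of the configuration do not meet pairwise in distinct parallel lines of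
which one contains a point of `C` (`VectorConfig.not_triangle`). With this, a double count of the
affine points of a plane outside `C`, each of which is on one further plane, shows that every plane
has exactly `q` partners, and that the planes come in grids: two families of `q` planes, every plane
of one meeting every plane of the other in a line, all these lines being parallel
(`VectorConfig.exists_isGrid`). Each family is cut out by parallel hyperplanes, which gives two linear
coordinates on `C` (`VectorConfig.exists_coordinates`). A plane of the configuration contains a
direction on which both coordinates vanish, as otherwise its `q`-arc would be the graph of a
permutation of a field of odd order, which Wilson's theorem excludes. So its `q` points form the graph
of a function, and by Segre's lemma of tangents this function is quadratic. A map of two variables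
which is quadratic along all lines is quadratic (`VectorConfig.exists_isQuadraticGraph`), and the
condition on affine points outside `C` excludes zero divisors of `B`
(`IsQuadraticGraph.bilin_eq_zero`).

In the normal form the planes of the configuration carry the parabolas over the lines of the parameter
space. The tangents in the point with parameter `a` meet the hyperplane at infinity in the line
`{Λ u + 2 B a u}`, and the `∞`-points and `0`-points form the axis line, which contains the values of
`B`. As `B` has no zero divisors these lines are a spread (`IsQuadraticGraph.isSpread`), and its
Bruck-Bose plane has `C` as an arc (`IsQuadraticGraph.isArc`).

For the converse let `C` be an arc in the Bruck-Bose plane of some spread; that is, two chords of `C`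
with a common end never have their directions on one spread line. A spread line disjoint from the axis
line is then a tangent line (`IsQuadraticGraph.eq_tangentLine_of_arc`): it meets the tangent lines in
points over all directions `u`, and comparing the parameters of these tangent lines for four
directions leads to a contradiction unless they are all equal. A count of points on a tangent line
outside the spread shows that the axis line itself is in the spread
(`IsQuadraticGraph.eq_of_partition`), and so the spread is the given one.
-/

/-! ### Arcs of graphs over finite fields -/

section FiniteFieldFunctions

variable {K : Type*} [Field K]

/-- The slope of the chord of the graph of `g` between the abscissae `s` and `t`. -/
def chordSlope (g : K → K) (s t : K) : K := (g t - g s) / (t - s)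

theorem chordSlope_comm (g : K → K) (s t : K) : chordSlope g s t = chordSlope g t s := by
  unfold chordSlope
  rw [← neg_sub (g s), ← neg_sub s, neg_div_neg_eq]

variable [Fintype K] [DecidableEq K]

theorem FiniteField.prod_erase_zero : ∏ x ∈ Finset.univ.erase (0 : K), x = -1 := by
  have h := congrArg (Units.val) (FiniteField.prod_univ_units_id_eq_neg_one (K := K))
  rw [Units.coe_prod, Units.val_neg, Units.val_one] at h
  rw [← h]
  refine (Finset.prod_bij (fun (u : Kˣ) _ => (u : K)) ?_ ?_ ?_ ?_).symm
  · intro u _; simp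
  · intro u _ v _ h; exact Units.ext h
  · intro b hb
    exact ⟨Units.mk0 b (Finset.ne_of_mem_erase hb), Finset.mem_univ _, rfl⟩
  · intro u _; rfl

theorem FiniteField.prod_erase_sub (a : K) : ∏ x ∈ Finset.univ.erase a, (x - a) = -1 := by
  rw [← FiniteField.prod_erase_zero (K := K)]
  refine Finset.prod_bij (fun x _ => x - a) ?_ ?_ ?_ ?_
  · intro x hx
    simpa [sub_eq_zero] using hx
  · intro x _ y _ h; exact sub_left_injective h
  · intro b hb
    refine ⟨b + a, ?_, by simp⟩
    simpa using hb
  · intro x _; rfl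

/-- If the graph of `g` is an arc then exactly one slope at each of its points is not the slope
of a chord. -/
theorem exists_image_chordSlope_eq_erase {g : K → K} {s : K}
    (h : Set.InjOn (chordSlope g s) {s}ᶜ) :
    ∃ m, (Finset.univ.erase s).image (chordSlope g s) = Finset.univ.erase m := by
  have hc : ((Finset.univ.erase s).image (chordSlope g s)).card = Fintype.card K - 1 := by
    rw [Finset.card_image_of_injOn, Finset.card_erase_of_mem (Finset.mem_univ _),
      Finset.card_univ]
    intro x hx y hy
    exact h (by simpa using hx) (by simpa using hy)
  have hpos : 0 < Fintype.card K := Fintype.card_pos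
  have h1 : ((Finset.univ.erase s).image (chordSlope g s))ᶜ.card = 1 := by
    rw [Finset.card_compl, hc]; omega
  obtain ⟨m, hm⟩ := Finset.card_eq_one.mp h1
  refine ⟨m, ?_⟩
  rw [← compl_compl (Finset.image _ _), hm]
  ext x; simp

/-- A permutation of a finite field of odd characteristic has a graph with three collinear
points. Wilson's theorem gives the product of the chord slopes at a point in two ways. -/
theorem not_injective_of_injOn_chordSlope (h2 : (2 : K) ≠ 0) {g : K → K}
    (hg : Function.Injective g) (h : Set.InjOn (chordSlope g 0) {0}ᶜ) : False := by
  have hne : ∀ t ∈ Finset.univ.erase (0 : K), chordSlope g 0 t ≠ 0 := by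
    intro t ht
    have ht' := Finset.ne_of_mem_erase ht
    unfold chordSlope
    exact div_ne_zero (sub_ne_zero.mpr (hg.ne ht')) (by simpa using ht')
  have h1 : ∏ t ∈ Finset.univ.erase (0 : K), chordSlope g 0 t = -1 := by
    obtain ⟨m, hm⟩ := exists_image_chordSlope_eq_erase h
    have hm0 : m = 0 := by
      by_contra hm0
      have : (0 : K) ∈ Finset.univ.erase m := by simpa using Ne.symm hm0
      rw [← hm] at this
      obtain ⟨t, ht, ht0⟩ := Finset.mem_image.mp this
      exact hne t ht ht0
    have himg : ∏ x ∈ (Finset.univ.erase (0 : K)).image (chordSlope g 0), x =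
        ∏ t ∈ Finset.univ.erase (0 : K), chordSlope g 0 t := by
      refine Finset.prod_image ?_
      intro x hx y hy
      exact h (by simpa using hx) (by simpa using hy)
    rw [← himg, hm, hm0, FiniteField.prod_erase_zero]
  have h3 : ∏ t ∈ Finset.univ.erase (0 : K), (g t - g 0) = -1 := by
    rw [← FiniteField.prod_erase_sub (g 0)]
    refine Finset.prod_bij (fun x _ => g x) ?_ ?_ ?_ ?_
    · intro x hx
      simpa [hg.eq_iff] using hx
    · intro x _ y _ h; exact hg h
    · intro b hb
      obtain ⟨x, rfl⟩ := (Finite.injective_iff_surjective.mp hg) b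
      exact ⟨x, by simpa [hg.eq_iff] using hb, rfl⟩
    · intro x _; rfl
  unfold chordSlope at h1
  rw [Finset.prod_div_distrib, h3, FiniteField.prod_erase_sub, div_self (by simp)] at h1
  exact h2 (by linear_combination h1)

/-- Segre's lemma of tangents for an arc consisting of the graph of `g` and the common point at
infinity of the vertical lines: the slopes `m s` and `m t` of the tangents are symmetric about
the slope of the chord. -/
theorem tangentSlope_add {g : K → K} (h : ∀ s, Set.InjOn (chordSlope g s) {s}ᶜ) {m : K → K}
    (hm : ∀ s, (Finset.univ.erase s).image (chordSlope g s) = Finset.univ.erase (m s))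
    {s t : K} (hst : s ≠ t) : m s + m t = 2 * chordSlope g s t := by
  have key : ∀ a b : K, a ≠ b →
      (m a - chordSlope g a b) *
        ∏ u ∈ (Finset.univ.erase a).erase b, (chordSlope g a u - chordSlope g a b) = -1 := by
    intro a b hab
    have hinj : Set.InjOn (chordSlope g a) ((Finset.univ.erase a : Finset K) : Set K) := by
      intro x hx y hy
      exact h a (by simpa using hx) (by simpa using hy)
    have hbm : chordSlope g a b ≠ m a := by
      have : chordSlope g a b ∈ Finset.univ.erase (m a) := by
        rw [← hm]
        exact Finset.mem_image_of_mem _ (by simpa using hab.symm)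
      simpa using this
    have him : ((Finset.univ.erase a).erase b).image (chordSlope g a) =
        (Finset.univ.erase (chordSlope g a b)).erase (m a) := by
      ext x
      constructor
      · intro hx
        obtain ⟨u, hu, rfl⟩ := Finset.mem_image.mp hx
        have hu1 := Finset.ne_of_mem_erase hu
        have hu2 := Finset.mem_of_mem_erase hu
        have h1 := Finset.mem_image_of_mem (chordSlope g a) hu2
        rw [hm] at h1
        refine Finset.mem_erase.mpr ⟨Finset.ne_of_mem_erase h1, ?_⟩
        refine Finset.mem_erase.mpr ⟨?_, Finset.mem_univ _⟩
        intro he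
        exact hu1 (hinj (by simpa using hu2) (by simpa using hab.symm) he)
      · intro hx
        have h1 : x ∈ Finset.univ.erase (m a) := by
          simpa using Finset.ne_of_mem_erase hx
        rw [← hm] at h1
        obtain ⟨u, hu, rfl⟩ := Finset.mem_image.mp h1
        refine Finset.mem_image_of_mem _ (Finset.mem_erase.mpr ⟨?_, hu⟩)
        rintro rfl
        simp at hx
    have hp : ∏ u ∈ (Finset.univ.erase a).erase b, (chordSlope g a u - chordSlope g a b) =
        ∏ x ∈ (Finset.univ.erase (chordSlope g a b)).erase (m a), (x - chordSlope g a b) := by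
      rw [← him, Finset.prod_image]
      intro x hx y hy
      exact hinj (Finset.erase_subset _ _ hx) (Finset.erase_subset _ _ hy)
    rw [hp, Finset.mul_prod_erase (Finset.univ.erase (chordSlope g a b))
      (fun x => x - chordSlope g a b) (by simpa using hbm.symm), FiniteField.prod_erase_sub]
  have h1 := key s t hst
  have h2 := key t s hst.symm
  rw [chordSlope_comm g t s, Finset.erase_right_comm] at h2
  set σ := chordSlope g s t with hσ
  have hE : ∀ a b : K, a ≠ b → ∏ u ∈ (Finset.univ.erase a).erase b, (u - a) = -1 / (b - a) := by
    intro a b hab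
    rw [eq_div_iff (sub_ne_zero.mpr hab.symm), mul_comm,
      Finset.mul_prod_erase (Finset.univ.erase a) (fun x => x - a) (by simpa using hab.symm),
      FiniteField.prod_erase_sub]
  have hprod : (∏ u ∈ (Finset.univ.erase s).erase t, (chordSlope g s u - σ)) *
      ∏ u ∈ (Finset.univ.erase s).erase t, (u - s) =
      (∏ u ∈ (Finset.univ.erase s).erase t, (chordSlope g t u - σ)) *
      ∏ u ∈ (Finset.univ.erase s).erase t, (u - t) := by
    rw [← Finset.prod_mul_distrib, ← Finset.prod_mul_distrib]
    refine Finset.prod_congr rfl fun u hu => ?_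
    have hut : u - t ≠ 0 := sub_ne_zero.mpr (Finset.ne_of_mem_erase hu)
    have hus : u - s ≠ 0 :=
      sub_ne_zero.mpr (Finset.ne_of_mem_erase (Finset.mem_of_mem_erase hu))
    have hts : t - s ≠ 0 := sub_ne_zero.mpr hst.symm
    rw [hσ]
    unfold chordSlope
    field_simp
    ring
  rw [hE s t hst, Finset.erase_right_comm, hE t s hst.symm, ← neg_sub t s] at hprod
  rw [Finset.erase_right_comm] at h1 h2
  have hts : t - s ≠ 0 := sub_ne_zero.mpr hst.symm
  set A := ∏ u ∈ (Finset.univ.erase t).erase s, (chordSlope g s u - σ)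
  set B := ∏ u ∈ (Finset.univ.erase t).erase s, (chordSlope g t u - σ)
  have hAB : A = -B := by
    field_simp at hprod
    linear_combination -hprod
  have hB : B ≠ 0 := by
    intro h0
    rw [h0, mul_zero] at h2
    simp at h2
  have : (m s + m t - 2 * σ) * B = 0 := by
    rw [hAB] at h1
    linear_combination h2 - h1
  rcases mul_eq_zero.mp this with h | h
  · linear_combination h
  · exact absurd h hB

/-- Segre's theorem for an arc of `q + 1` points consisting of the graph of `g` and the common
point at infinity of the vertical lines: it is a parabola. -/
theorem exists_quadratic_of_injOn_chordSlope (h2 : (2 : K) ≠ 0) {g : K → K}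
    (h : ∀ s, Set.InjOn (chordSlope g s) {s}ᶜ) :
    ∃ α β : K, ∀ t, g t = g 0 + β * t + α * t ^ 2 := by
  choose m hm using fun s => exists_image_chordSlope_eq_erase (h s)
  have h1 : ∀ s t : K, (t - s) * (m s + m t) = 2 * (g t - g s) := by
    intro s t
    by_cases hst : s = t
    · simp [hst]
    · rw [tangentSlope_add h hm hst]
      unfold chordSlope
      have := sub_ne_zero.mpr (Ne.symm hst)
      field_simp
  have hlin : ∀ t, m t = m 0 + (m 1 - m 0) * t := by
    intro t
    linear_combination h1 0 t - h1 0 1 - h1 1 t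
  refine ⟨(m 1 - m 0) / 2, m 0, fun t => ?_⟩
  have h3 := h1 0 t
  rw [hlin t] at h3
  field_simp
  linear_combination -h3

end FiniteFieldFunctions

/-- A polynomial map of degree at most four with values in a vector space vanishes only if its
coefficients do, provided that the field has more than four elements. -/
theorem coeff_eq_zero_of_forall_quartic {K V : Type*} [Field K] [Finite K] [AddCommGroup V]
    [Module K V] (hK : 4 < Nat.card K) {v₀ v₁ v₂ v₃ v₄ : V}
    (h : ∀ t : K, v₀ + t • v₁ + t ^ 2 • v₂ + t ^ 3 • v₃ + t ^ 4 • v₄ = 0) :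
    v₀ = 0 ∧ v₁ = 0 ∧ v₂ = 0 ∧ v₃ = 0 ∧ v₄ = 0 := by
  have := Fintype.ofFinite K
  have key : ∀ f : V →ₗ[K] K, f v₀ = 0 ∧ f v₁ = 0 ∧ f v₂ = 0 ∧ f v₃ = 0 ∧ f v₄ = 0 := by
    intro f
    let p : Polynomial K := Polynomial.C (f v₀) + Polynomial.C (f v₁) * Polynomial.X +
      Polynomial.C (f v₂) * Polynomial.X ^ 2 + Polynomial.C (f v₃) * Polynomial.X ^ 3 +
      Polynomial.C (f v₄) * Polynomial.X ^ 4
    have hp : p = 0 := by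
      refine Polynomial.eq_zero_of_natDegree_lt_card_of_eval_eq_zero p
        (f := (id : K → K)) Function.injective_id (fun t => ?_) ?_
      · have := congrArg f (h t)
        simp only [map_add, map_smul, smul_eq_mul, map_zero] at this
        simp only [p, id, Polynomial.eval_add, Polynomial.eval_mul, Polynomial.eval_C,
          Polynomial.eval_X, Polynomial.eval_pow]
        linear_combination this
      · rw [← Nat.card_eq_fintype_card]
        refine lt_of_le_of_lt ?_ hK
        simp only [p]
        compute_degree
    have hc : ∀ n, p.coeff n = 0 := fun n => by rw [hp, Polynomial.coeff_zero]
    have h0 := hc 0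
    have h1 := hc 1
    have h2 := hc 2
    have h3 := hc 3
    have h4 := hc 4
    simp [p, Polynomial.coeff_X, Polynomial.coeff_C, Polynomial.coeff_X_pow] at h0 h1 h2 h3 h4
    exact ⟨h0, h1, h2, h3, h4⟩
  have z : ∀ v : V, (∀ f : V →ₗ[K] K, f v = 0) → v = 0 := fun v hv =>
    (Module.forall_dual_apply_eq_zero_iff K v).mp hv
  exact ⟨z _ fun f => (key f).1, z _ fun f => (key f).2.1, z _ fun f => (key f).2.2.1,
    z _ fun f => (key f).2.2.2.1, z _ fun f => (key f).2.2.2.2⟩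

/-! ### Configurations of vectors -/

section VectorModel

variable {K V : Type*} [Field K] [AddCommGroup V] [Module K V]

theorem exists_eq_add_smul_of_finrank_two {l : Submodule K V} (hl : Module.finrank K l = 2)
    {u v : V} (hu : u ∈ l) (hv : v ∈ l) (hu0 : u ≠ 0) (huv : ∀ k : K, v ≠ k • u) :
    ∀ w ∈ l, ∃ a b : K, w = a • u + b • v := by
  have hfin : Module.Finite K l := Module.finite_of_finrank_pos (by omega)
  have hli : LinearIndependent K ![u, v] :=
    (LinearIndependent.pair_iff' hu0).mpr fun a h => huv a h.symm
  have hr : Set.range ![u, v] = {u, v} := by simp [Set.pair_comm]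
  have hle : Submodule.span K {u, v} ≤ l := by
    rw [Submodule.span_le]
    rintro x (rfl | rfl) <;> assumption
  have hrank : Module.finrank K (Submodule.span K {u, v}) = 2 := by
    have := finrank_span_eq_card hli
    rw [hr] at this
    simpa using this
  have := Submodule.eq_of_le_of_finrank_eq hle (hrank.trans hl.symm)
  intro w hw
  rw [← this] at hw
  obtain ⟨a, b, h⟩ := Submodule.mem_span_pair.mp hw
  exact ⟨a, b, h.symm⟩

theorem finrank_span_pair_eq_two {u v : V} (hu0 : u ≠ 0) (huv : ∀ k : K, v ≠ k • u) :
    Module.finrank K (Submodule.span K {u, v}) = 2 := by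
  have hli : LinearIndependent K ![u, v] :=
    (LinearIndependent.pair_iff' hu0).mpr fun a h => huv a h.symm
  have hr : Set.range ![u, v] = {u, v} := by simp [Set.pair_comm]
  have := finrank_span_eq_card hli
  rw [hr] at this
  simpa using this

theorem finrank_span_triple_eq_three {φ : V →ₗ[K] K} {o u v : V} (ho : φ o = 1) (hu : φ u = 0)
    (hv : φ v = 0) (hu0 : u ≠ 0) (huv : ∀ k : K, v ≠ k • u) :
    Module.finrank K (Submodule.span K {o, u, v}) = 3 := by
  have hli : LinearIndependent K ![o, u, v] := by
    have h2 : LinearIndependent K ![u, v] :=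
      (LinearIndependent.pair_iff' hu0).mpr fun a h => huv a h.symm
    refine linearIndependent_finCons.mpr ⟨h2, fun h => ?_⟩
    have hr : Set.range ![u, v] = {u, v} := by simp [Set.pair_comm]
    rw [hr] at h
    obtain ⟨a, b, h⟩ := Submodule.mem_span_pair.mp h
    have := congrArg φ h
    simp [ho, hu, hv] at this
  have hr : Set.range ![o, u, v] = {o, u, v} := by
    ext x; simp only [Matrix.range_cons, Matrix.range_empty, Set.mem_union, Set.mem_singleton_iff,
      Set.mem_insert_iff, Set.mem_empty_iff_false, or_false]
  have := finrank_span_eq_card hli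
  rw [hr] at this
  simpa using this

theorem exists_eq_add_smul_of_finrank_three {φ : V →ₗ[K] K} {W : Submodule K V}
    (hW : Module.finrank K W = 3) {o u v : V} (hoW : o ∈ W) (huW : u ∈ W) (hvW : v ∈ W)
    (ho : φ o = 1) (hu : φ u = 0) (hv : φ v = 0) (hu0 : u ≠ 0) (huv : ∀ k : K, v ≠ k • u) :
    ∀ w ∈ W, ∃ a b : K, w = φ w • o + a • u + b • v := by
  have hfin : Module.Finite K W := Module.finite_of_finrank_pos (by omega)
  have hle : Submodule.span K {o, u, v} ≤ W := by
    rw [Submodule.span_le]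
    rintro x (rfl | rfl | rfl) <;> assumption
  have := Submodule.eq_of_le_of_finrank_eq hle
    ((finrank_span_triple_eq_three ho hu hv hu0 huv).trans hW.symm)
  intro w hw
  have hw' := hw
  rw [← this] at hw'
  obtain ⟨a, b, d, h⟩ := Submodule.mem_span_triple.mp hw'
  have ha : φ w = a := by rw [← h]; simp [ho, hu, hv]
  exact ⟨b, d, by rw [ha, ← h]⟩

theorem finrank_inf_ker_add_one [Module.Finite K V] {φ : V →ₗ[K] K} {W : Submodule K V} {o : V}
    (ho : o ∈ W) (ho1 : φ o = 1) :
    Module.finrank K ↥(W ⊓ LinearMap.ker φ) + 1 = Module.finrank K W := by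
  have h2 := LinearMap.finrank_range_add_finrank_ker (φ.domRestrict W)
  have hr2 : LinearMap.range (φ.domRestrict W) = ⊤ := LinearMap.range_eq_top.mpr fun k =>
    ⟨⟨k • o, W.smul_mem k ho⟩, by simp [ho1]⟩
  rw [hr2, finrank_top, Module.finrank_self, LinearMap.ker_domRestrict] at h2
  have h4 : (LinearMap.ker φ).comap W.subtype = (W ⊓ LinearMap.ker φ).comap W.subtype := by
    simp [Submodule.comap_inf]
  rw [h4, (Submodule.comapSubtypeEquivOfLe (inf_le_left : W ⊓ LinearMap.ker φ ≤ W)).finrank_eq]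
    at h2
  omega

/-- The vector form of a configuration. The hyperplane at infinity is the kernel of `φ`, an affine
point is represented by its vector on which `φ` takes the value `1`, and `c` is the set of vectors
representing the points of the configuration. -/
structure VectorConfig (φ : V →ₗ[K] K) (c : Set V) (Pl : Set (Submodule K V)) : Prop where
  finite : Finite K
  finrank_eq : Module.finrank K V = 5
  odd : Odd (Nat.card K)
  seven_le : 7 ≤ Nat.card K
  affine : ∀ v ∈ c, φ v = 1
  ncard_eq : c.ncard = Nat.card K ^ 2
  finrank_plane : ∀ W ∈ Pl, Module.finrank K W = 3
  exists_affine : ∀ W ∈ Pl, ∃ v ∈ W, φ v = 1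
  ncard_plane : ∀ W ∈ Pl, (c ∩ W).ncard = Nat.card K
  arc : ∀ a ∈ c, ∀ b ∈ c, ∀ d ∈ c, a ≠ b → ∀ k : K, d - a = k • (b - a) → d = a ∨ d = b
  mem_of_four_lt : ∀ W : Submodule K V, Module.finrank K W = 3 → 4 < (c ∩ W).ncard → W ∈ Pl
  exists_plane : ∀ a ∈ c, ∀ b ∈ c, a ≠ b → ∃ W ∈ Pl, a ∈ W ∧ b ∈ W
  plane_unique : ∀ a ∈ c, ∀ b ∈ c, a ≠ b → ∀ W ∈ Pl, ∀ W' ∈ Pl,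
    a ∈ W → b ∈ W → a ∈ W' → b ∈ W' → W = W'
  two_planes : ∀ v, φ v = 1 → v ∉ c → ∀ W ∈ Pl, v ∈ W →
    ∃ W' ∈ Pl, W' ≠ W ∧ v ∈ W' ∧ ∀ W'' ∈ Pl, v ∈ W'' → W'' = W ∨ W'' = W'

namespace VectorConfig

variable {φ : V →ₗ[K] K} {c : Set V} {Pl : Set (Submodule K V)}

theorem finiteV (h : VectorConfig φ c Pl) : Finite V := by
  have := h.finite
  have : Module.Finite K V := Module.finite_of_finrank_pos (by rw [h.finrank_eq]; norm_num)
  exact Module.finite_of_finite K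

theorem moduleFinite (h : VectorConfig φ c Pl) : Module.Finite K V :=
  Module.finite_of_finrank_pos (by rw [h.finrank_eq]; norm_num)

theorem eq_of_mem (h : VectorConfig φ c Pl) {W W' : Submodule K V} (hW : W ∈ Pl) (hW' : W' ∈ Pl)
    (hne : W ≠ W') {a b : V} (ha : a ∈ c) (hb : b ∈ c) (haW : a ∈ W) (haW' : a ∈ W')
    (hbW : b ∈ W) (hbW' : b ∈ W') : a = b := by
  by_contra hab
  exact hne (h.plane_unique a ha b hb hab W hW W' hW' haW hbW haW' hbW')

/-- An affine point outside `c` does not lie in three planes of the configuration. -/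
theorem mem_of_three (h : VectorConfig φ c Pl) {W₁ W₂ W₃ : Submodule K V} (h₁ : W₁ ∈ Pl)
    (h₂ : W₂ ∈ Pl) (h₃ : W₃ ∈ Pl) (h₁₂ : W₁ ≠ W₂) (h₁₃ : W₁ ≠ W₃) (h₂₃ : W₂ ≠ W₃) {v : V}
    (hv : φ v = 1) (hv₁ : v ∈ W₁) (hv₂ : v ∈ W₂) (hv₃ : v ∈ W₃) : v ∈ c := by
  by_contra hvc
  obtain ⟨W', -, -, -, hu⟩ := h.two_planes v hv hvc W₁ h₁ hv₁
  rcases hu W₂ h₂ hv₂ with h' | h'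
  · exact h₁₂ h'.symm
  rcases hu W₃ h₃ hv₃ with h'' | h''
  · exact h₁₃ h''.symm
  exact h₂₃ (h'.trans h''.symm)

theorem finrank_inf_ker (h : VectorConfig φ c Pl) {W : Submodule K V} (hW : W ∈ Pl) :
    Module.finrank K ↥(W ⊓ LinearMap.ker φ) = 2 := by
  have := h.moduleFinite
  obtain ⟨o, ho, ho1⟩ := h.exists_affine W hW
  have h1 := finrank_inf_ker_add_one ho ho1
  rw [h.finrank_plane W hW] at h1
  omega

/-- Two planes of the configuration that share the affine point `o` and the direction `z` have nothing
else than the span of `o` and `z` in common. -/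
theorem mem_common_line (h : VectorConfig φ c Pl) {W W' : Submodule K V} (hW : W ∈ Pl)
    (hW' : W' ∈ Pl) (hne : W ≠ W') {o z : V} (hoW : o ∈ W) (hoW' : o ∈ W') (ho : φ o = 1)
    (hzW : z ∈ W) (hzW' : z ∈ W') (hz : φ z = 0) (hz0 : z ≠ 0) {v : V} (hv : v ∈ W)
    (hv' : v ∈ W') : ∃ k : K, v = φ v • o + k • z := by
  by_contra hcon
  push Not at hcon
  have hu : ∀ k : K, v - φ v • o ≠ k • z := fun k hk => hcon k (by rw [← hk]; abel)
  have huφ : φ (v - φ v • o) = 0 := by simp [ho]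
  have h3 := finrank_span_triple_eq_three ho hz huφ hz0 hu
  have hle : ∀ X ∈ Pl, o ∈ X → z ∈ X → v ∈ X →
      Submodule.span K {o, z, v - φ v • o} = X := by
    intro X hX h1 h2 h4
    have := h.moduleFinite
    refine Submodule.eq_of_le_of_finrank_eq ?_ (h3.trans (h.finrank_plane X hX).symm)
    rw [Submodule.span_le]
    rintro x (rfl | rfl | rfl)
    · exact h1
    · exact h2
    · exact X.sub_mem h4 (X.smul_mem _ h1)
  exact hne ((hle W hW hoW hzW hv).symm.trans (hle W' hW' hoW' hzW' hv'))

/-- The number of tangents at a point of a `q`-arc is at most two: three pairwise independent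
directions in a plane `W` cannot all be tangent to `c ∩ W` at a point `P`, since the other `q - 1`
points of the arc lie in distinct directions from `P`. -/
theorem not_three_tangents (h : VectorConfig φ c Pl) {W : Submodule K V} (hW : W ∈ Pl)
    {P : V} (hP : P ∈ c) (hPW : P ∈ W) {u v w : V} (hu : u ∈ W) (hv : v ∈ W) (hw : w ∈ W)
    (huφ : φ u = 0) (hvφ : φ v = 0) (hwφ : φ w = 0) (hu0 : u ≠ 0)
    (huv : ∀ k : K, v ≠ k • u) (huw : ∀ k : K, w ≠ k • u) (hvw : ∀ k : K, w ≠ k • v)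
    (hut : ∀ k : K, k ≠ 0 → P + k • u ∉ c) (hvt : ∀ k : K, k ≠ 0 → P + k • v ∉ c)
    (hwt : ∀ k : K, k ≠ 0 → P + k • w ∉ c) : False := by
  classical
  have := h.finite
  have := h.finiteV
  have hcoord : ∀ B ∈ c, B ∈ W → B ≠ P →
      ∃ a b : K, B = P + (a • u + b • v) ∧ a ≠ 0 ∧ b ≠ 0 := by
    intro B hB hBW hBP
    obtain ⟨a, b, hab⟩ := exists_eq_add_smul_of_finrank_three (h.finrank_plane W hW) hPW hu hv
      (h.affine P hP) huφ hvφ hu0 huv B hBW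
    rw [h.affine B hB, one_smul, add_assoc] at hab
    refine ⟨a, b, hab, ?_, ?_⟩
    · rintro rfl
      by_cases hb : b = 0
      · exact hBP (by rw [hab, hb]; simp)
      · exact hvt b hb (by rw [zero_smul, zero_add] at hab; rwa [← hab])
    · rintro rfl
      by_cases ha : a = 0
      · exact hBP (by rw [hab, ha]; simp)
      · exact hut a ha (by rw [zero_smul, add_zero] at hab; rwa [← hab])
  obtain ⟨α, β, hαβ⟩ := exists_eq_add_smul_of_finrank_three (h.finrank_plane W hW) hPW hu hv
      (h.affine P hP) huφ hvφ hu0 huv w hw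
  rw [hwφ, zero_smul, zero_add] at hαβ
  have hα : α ≠ 0 := by
    rintro rfl
    exact hvw β (by rw [hαβ]; simp)
  have hβ : β ≠ 0 := by
    rintro rfl
    exact huw α (by rw [hαβ]; simp)
  choose! a b hab ha hb using hcoord
  -- The slope map sends the remaining points of the arc injectively to `K \ {0, β / α}`.
  have hle : ((c ∩ W) \ {P}).ncard ≤ (({0, β / α} : Set K)ᶜ).ncard := by
    refine Set.ncard_le_ncard_of_injOn (fun B => b B / a B) ?_ ?_ (Set.toFinite _)
    · rintro B ⟨⟨hB, hBW⟩, hBP⟩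
      have hBP' : B ≠ P := hBP
      have h1 := ha B hB hBW hBP'
      have h2 := hb B hB hBW hBP'
      rintro (h0 | h0)
      · exact (div_ne_zero h2 h1) h0
      · have h0' : b B / a B = β / α := h0
        rw [div_eq_div_iff h1 hα] at h0'
        refine hwt (a B / α) (div_ne_zero h1 hα) ?_
        have : P + (a B / α) • w = B := by
          have e : a B / α * β = b B := by
            field_simp
            linear_combination -h0'
          rw [hαβ, smul_add, smul_smul, smul_smul, div_mul_cancel₀ _ hα, e]
          exact (hab B hB hBW hBP').symm
        rwa [this]
    · rintro B ⟨⟨hB, hBW⟩, hBP⟩ B' ⟨⟨hB', hBW'⟩, hBP'⟩ heq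
      have hBP1 : B ≠ P := hBP
      have hBP1' : B' ≠ P := hBP'
      have h1 := ha B hB hBW hBP1
      have h1' := ha B' hB' hBW' hBP1'
      have heq' : b B / a B = b B' / a B' := heq
      rw [div_eq_div_iff h1 h1'] at heq'
      have hk : B' - P = (a B' / a B) • (B - P) := by
        have e : a B' / a B * b B = b B' := by
          field_simp
          linear_combination heq'
        have e1 := sub_eq_of_eq_add' (hab B hB hBW hBP1)
        have e2 := sub_eq_of_eq_add' (hab B' hB' hBW' hBP1')
        rw [e1, e2, smul_add, smul_smul, smul_smul, div_mul_cancel₀ _ h1, e]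
      rcases h.arc P hP B hB B' hB' (Ne.symm hBP1) _ hk with h' | h'
      · exact absurd h' hBP1'
      · exact h'.symm
  have h1 : ((c ∩ W) \ {P}).ncard = Nat.card K - 1 := by
    rw [Set.ncard_sdiff_singleton_of_mem (show P ∈ c ∩ W from ⟨hP, hPW⟩), h.ncard_plane W hW]
  have h2 : (({0, β / α} : Set K)ᶜ).ncard = Nat.card K - 2 := by
    rw [Set.ncard_compl, Set.ncard_pair (div_ne_zero hβ hα).symm]
  have := h.seven_le
  omega

end VectorConfig
end VectorModel

/-! ### Triangles of planes -/

section VectorModel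

variable {K V : Type*} [Field K] [AddCommGroup V] [Module K V]

namespace VectorConfig

variable {φ : V →ₗ[K] K} {c : Set V} {Pl : Set (Submodule K V)}

/-- Let the planes `π` and `ρ` meet in the affine line through `o` in direction `z`, and let that
direction be tangent to `c ∩ ρ` at a point `P` outside `π`. At most one line through a point `p` of
`c ∩ π` spans together with `P` a plane whose intersection with `ρ` is tangent to `c ∩ ρ` at `P`. -/
theorem tangent_chord_unique (h : VectorConfig φ c Pl) {π ρ : Submodule K V} (hπ : π ∈ Pl)
    (hρ : ρ ∈ Pl) {z o P p : V} (hz : φ z = 0) (hz0 : z ≠ 0)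
    (hzπ : z ∈ π) (hzρ : z ∈ ρ) (ho : φ o = 1) (hoπ : o ∈ π) (hoρ : o ∈ ρ) (hP : P ∈ c)
    (hPρ : P ∈ ρ) (hPπ : P ∉ π) (hPz : ∀ k : K, k ≠ 0 → P + k • z ∉ c) (hp : p ∈ c) (hpπ : p ∈ π)
    (hpρ : p ∉ ρ) {r s : V} (hr : r ∈ c) (hrπ : r ∈ π) (hrp : r ≠ p)
    (hrz : ∀ k : K, r - p ≠ k • z) (hs : s ∈ c) (hsπ : s ∈ π) (hsp : s ≠ p)
    (hsz : ∀ k : K, s - p ≠ k • z)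
    (hrt : ∀ t ∈ c, t ∈ ρ → t ≠ P → t ∉ Submodule.span K {P, p, r})
    (hst : ∀ t ∈ c, t ∈ ρ → t ≠ P → t ∉ Submodule.span K {P, p, s}) : r = s := by
  -- The line joining `p` and `r` meets `ρ` in the affine point `o + l • z`.
  have meet : ∀ r ∈ c, r ∈ π → (∀ k : K, r - p ≠ k • z) →
      ∃ l m : K, m ≠ 0 ∧ o + l • z = p - m • (r - p) := by
    intro r hr hrπ hrz
    obtain ⟨l, m, hlm⟩ := exists_eq_add_smul_of_finrank_three (h.finrank_plane π hπ) hoπ hzπ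
      (π.sub_mem hrπ hpπ) ho hz (by rw [map_sub, h.affine r hr, h.affine p hp, sub_self]) hz0 hrz
      p hpπ
    rw [h.affine p hp, one_smul] at hlm
    refine ⟨l, m, ?_, eq_sub_of_add_eq hlm.symm⟩
    rintro rfl
    apply hpρ
    rw [hlm, zero_smul, add_zero]
    exact ρ.add_mem hoρ (ρ.smul_mem _ hzρ)
  have tangent : ∀ r : V, (∀ t ∈ c, t ∈ ρ → t ≠ P → t ∉ Submodule.span K {P, p, r}) →
      ∀ l m : K, o + l • z = p - m • (r - p) → ∀ k : K, k ≠ 0 → P + k • (o + l • z - P) ∉ c := by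
    intro r hrt l m hlm k hk hmem
    have hZρ : o + l • z ∈ ρ := ρ.add_mem hoρ (ρ.smul_mem _ hzρ)
    have hZπ : o + l • z ∈ π := π.add_mem hoπ (π.smul_mem _ hzπ)
    refine hrt _ hmem (ρ.add_mem hPρ (ρ.smul_mem _ (ρ.sub_mem hZρ hPρ))) ?_ ?_
    · intro he
      rw [add_eq_left, smul_eq_zero] at he
      rcases he with he | he
      · exact hk he
      · exact hPπ (by rw [← sub_eq_zero.mp he]; exact hZπ)
    · have h1 : P ∈ Submodule.span K {P, p, r} := Submodule.subset_span (by simp)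
      have h2 : p ∈ Submodule.span K {P, p, r} := Submodule.subset_span (by simp)
      have h3 : r ∈ Submodule.span K {P, p, r} := Submodule.subset_span (by simp)
      rw [hlm]
      exact Submodule.add_mem _ h1 (Submodule.smul_mem _ _ (Submodule.sub_mem _
        (Submodule.sub_mem _ h2 (Submodule.smul_mem _ _ (Submodule.sub_mem _ h3 h2))) h1))
  obtain ⟨l, m, hm, hlm⟩ := meet r hr hrπ hrz
  obtain ⟨l', m', hm', hlm'⟩ := meet s hs hsπ hsz
  have hZπ : ∀ l : K, o + l • z ∈ π := fun l => π.add_mem hoπ (π.smul_mem _ hzπ)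
  have hZρ : ∀ l : K, o + l • z ∈ ρ := fun l => ρ.add_mem hoρ (ρ.smul_mem _ hzρ)
  have hnz : ∀ l k : K, o + l • z - P ≠ k • z := by
    intro l k hk
    apply hPπ
    have : P = o + l • z - k • z := by rw [← hk]; abel
    rw [this]
    exact π.sub_mem (hZπ l) (π.smul_mem _ hzπ)
  have hφ : ∀ l : K, φ (o + l • z - P) = 0 := by
    intro l
    simp [ho, hz, h.affine P hP]
  by_cases hl : l = l'
  · subst hl
    have he : m • (r - p) = m' • (s - p) := by
      have := hlm.symm.trans hlm'
      exact sub_right_injective this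
    have hk : s - p = (m / m') • (r - p) := by
      rw [div_eq_inv_mul, mul_smul, he, smul_smul, inv_mul_cancel₀ hm', one_smul]
    rcases h.arc p hp r hr s hs hrp.symm _ hk with h' | h'
    · exact absurd h' hsp
    · exact h'.symm
  · exfalso
    refine h.not_three_tangents hρ hP hPρ hzρ (ρ.sub_mem (hZρ l) hPρ) (ρ.sub_mem (hZρ l') hPρ) hz
      (hφ l) (hφ l') hz0 (hnz l) (hnz l') ?_ hPz (tangent r hrt l m hlm) (tangent s hst l' m' hlm')
    intro k hk
    by_cases hk1 : k = 1
    · rw [hk1, one_smul, sub_left_inj, add_right_inj] at hk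
      exact hl (smul_left_injective K hz0 hk.symm)
    · apply hPπ
      have h1 : (1 - k) • P = o + l' • z - k • (o + l • z) := by
        linear_combination (norm := module) (-1 : K) • hk
      have h2 : (1 - k) • P ∈ π := by
        rw [h1]
        exact π.sub_mem (hZπ l') (π.smul_mem _ (hZπ l))
      exact (π.smul_mem_iff (sub_ne_zero.mpr (Ne.symm hk1))).mp h2

/-- Three planes of the configuration cannot meet pairwise in three distinct parallel affine lines
of which one contains a point `P` of `c`: otherwise suitable points `p` and `r` of `c` in
the plane opposite to `P` span together with `P` a plane which contains a further point of `c` in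
each of the other two planes, hence five points of `c`. -/
theorem not_triangle (h : VectorConfig φ c Pl) {π ρ σ : Submodule K V} (hπ : π ∈ Pl)
    (hρ : ρ ∈ Pl) (hσ : σ ∈ Pl) (hπρ : π ≠ ρ) (hπσ : π ≠ σ) (hρσ : ρ ≠ σ) {z o o' P : V}
    (hz : φ z = 0) (hz0 : z ≠ 0) (hzπ : z ∈ π) (hzρ : z ∈ ρ) (hzσ : z ∈ σ) (ho : φ o = 1)
    (hoπ : o ∈ π) (hoρ : o ∈ ρ) (ho' : φ o' = 1) (hoπ' : o' ∈ π) (hoσ : o' ∈ σ) (hP : P ∈ c)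
    (hPρ : P ∈ ρ) (hPσ : P ∈ σ) (hPπ : P ∉ π) : False := by
  classical
  have := h.finite
  have := h.finiteV
  have hPz : ∀ k : K, k ≠ 0 → P + k • z ∉ c := by
    intro k hk hmem
    have := h.eq_of_mem hρ hσ hρσ hP hmem hPρ hPσ (ρ.add_mem hPρ (ρ.smul_mem _ hzρ))
      (σ.add_mem hPσ (σ.smul_mem _ hzσ))
    rw [left_eq_add, smul_eq_zero] at this
    exact this.elim hk hz0
  have card_le : ∀ τ ∈ Pl, π ≠ τ → (c ∩ π ∩ τ).ncard ≤ 1 := by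
    intro τ hτ hne
    refine (Set.ncard_le_one (Set.toFinite _)).mpr ?_
    rintro a ⟨⟨ha, haπ⟩, haτ⟩ b ⟨⟨hb, hbπ⟩, hbτ⟩
    exact h.eq_of_mem hπ hτ hne ha hb haπ haτ hbπ hbτ
  have h7 := h.seven_le
  have hcπ := h.ncard_plane π hπ
  obtain ⟨p, ⟨⟨hp, hpπ⟩, hp'⟩⟩ : ((c ∩ π) \ ((c ∩ π ∩ ρ) ∪ (c ∩ π ∩ σ))).Nonempty := by
    refine (Set.ncard_pos (Set.toFinite _)).mp ?_
    have h1 := Set.le_ncard_sdiff ((c ∩ π ∩ ρ) ∪ (c ∩ π ∩ σ)) (c ∩ π) (Set.toFinite _)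
    have h2 := Set.ncard_union_le (c ∩ π ∩ ρ) (c ∩ π ∩ σ)
    have h3 := card_le ρ hρ hπρ
    have h4 := card_le σ hσ hπσ
    omega
  have hpρ : p ∉ ρ := fun hh => hp' (Or.inl ⟨⟨hp, hpπ⟩, hh⟩)
  have hpσ : p ∉ σ := fun hh => hp' (Or.inr ⟨⟨hp, hpπ⟩, hh⟩)
  let Z : Set V := {r | r ∈ c ∧ r ∈ π ∧ r ≠ p ∧ ∃ k : K, r - p = k • z}
  let B : Submodule K V → Set V := fun τ => {r | r ∈ c ∧ r ∈ π ∧ r ≠ p ∧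
    (∀ k : K, r - p ≠ k • z) ∧ ∀ t ∈ c, t ∈ τ → t ≠ P → t ∉ Submodule.span K {P, p, r}}
  have hZ : Z.ncard ≤ 1 := by
    refine (Set.ncard_le_one (Set.toFinite _)).mpr ?_
    rintro r ⟨hr, hrπ, hrp, k, hk⟩ s ⟨hs, hsπ, hsp, l, hl⟩
    have hk0 : k ≠ 0 := by
      rintro rfl
      exact hrp (by rwa [zero_smul, sub_eq_zero] at hk)
    have : s - p = (l / k) • (r - p) := by
      rw [hk, hl, smul_smul, div_mul_cancel₀ _ hk0]
    rcases h.arc p hp r hr s hs hrp.symm _ this with h' | h'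
    · exact absurd h' hsp
    · exact h'.symm
  have hB : ∀ τ ∈ Pl, p ∉ τ → P ∈ τ → z ∈ τ → (∃ o, φ o = 1 ∧ o ∈ π ∧ o ∈ τ) →
      (B τ).ncard ≤ 1 := by
    rintro τ hτ hpτ hPτ hzτ ⟨o, ho, hoπ, hoτ⟩
    refine (Set.ncard_le_one (Set.toFinite _)).mpr ?_
    rintro r ⟨hr, hrπ, hrp, hrz, hrt⟩ s ⟨hs, hsπ, hsp, hsz, hst⟩
    exact h.tangent_chord_unique hπ hτ hz hz0 hzπ hzτ ho hoπ hoτ hP hPτ hPπ hPz hp hpπ hpτ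
      hr hrπ hrp hrz hs hsπ hsp hsz hrt hst
  obtain ⟨r, ⟨⟨hr, hrπ⟩, hr'⟩⟩ : ((c ∩ π) \
      ({p} ∪ (c ∩ π ∩ ρ) ∪ (c ∩ π ∩ σ) ∪ Z ∪ B ρ ∪ B σ)).Nonempty := by
    refine (Set.ncard_pos (Set.toFinite _)).mp ?_
    have h1 := Set.le_ncard_sdiff ({p} ∪ (c ∩ π ∩ ρ) ∪ (c ∩ π ∩ σ) ∪ Z ∪ B ρ ∪ B σ) (c ∩ π)
      (Set.toFinite _)
    have h2 := Set.ncard_union_le ({p} ∪ (c ∩ π ∩ ρ) ∪ (c ∩ π ∩ σ) ∪ Z ∪ B ρ) (B σ)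
    have h3 := Set.ncard_union_le ({p} ∪ (c ∩ π ∩ ρ) ∪ (c ∩ π ∩ σ) ∪ Z) (B ρ)
    have h4 := Set.ncard_union_le ({p} ∪ (c ∩ π ∩ ρ) ∪ (c ∩ π ∩ σ)) Z
    have h5 := Set.ncard_union_le ({p} ∪ (c ∩ π ∩ ρ)) (c ∩ π ∩ σ)
    have h6 := Set.ncard_union_le {p} (c ∩ π ∩ ρ)
    have h8 := card_le ρ hρ hπρ
    have h9 := card_le σ hσ hπσ
    have h10 := hB ρ hρ hpρ hPρ hzρ ⟨o, ho, hoπ, hoρ⟩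
    have h11 := hB σ hσ hpσ hPσ hzσ ⟨o', ho', hoπ', hoσ⟩
    rw [Set.ncard_singleton] at h6
    omega
  simp only [Set.mem_union, not_or, Set.mem_singleton_iff] at hr'
  obtain ⟨⟨⟨⟨⟨hrp, hrρ⟩, hrσ⟩, hrZ⟩, hrBρ⟩, hrBσ⟩ := hr'
  have hrρ' : r ∉ ρ := fun hh => hrρ ⟨⟨hr, hrπ⟩, hh⟩
  have hrσ' : r ∉ σ := fun hh => hrσ ⟨⟨hr, hrπ⟩, hh⟩
  have hrz : ∀ k : K, r - p ≠ k • z := fun k hk => hrZ ⟨hr, hrπ, hrp, k, hk⟩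
  obtain ⟨s, hs, hsρ, hsP, hsspan⟩ : ∃ t ∈ c, t ∈ ρ ∧ t ≠ P ∧ t ∈ Submodule.span K {P, p, r} := by
    by_contra hcon
    push Not at hcon
    exact hrBρ ⟨hr, hrπ, hrp, hrz, hcon⟩
  obtain ⟨t, ht, htσ, htP, htspan⟩ : ∃ t ∈ c, t ∈ σ ∧ t ≠ P ∧ t ∈ Submodule.span K {P, p, r} := by
    by_contra hcon
    push Not at hcon
    exact hrBσ ⟨hr, hrπ, hrp, hrz, hcon⟩
  have hst : s ≠ t := by
    rintro rfl
    exact hsP (h.eq_of_mem hρ hσ hρσ hs hP hsρ htσ hPρ hPσ)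
  have hsubs : ({P, p, r, s, t} : Set V) ⊆ c ∩ Submodule.span K {P, p, r} := by
    rintro x (rfl | rfl | rfl | rfl | rfl)
    · exact ⟨hP, Submodule.subset_span (by simp)⟩
    · exact ⟨hp, Submodule.subset_span (by simp)⟩
    · exact ⟨hr, Submodule.subset_span (by simp)⟩
    · exact ⟨hs, hsspan⟩
    · exact ⟨ht, htspan⟩
  have h5 : ({P, p, r, s, t} : Set V).ncard = 5 := by
    rw [Set.ncard_insert_of_notMem, Set.ncard_insert_of_notMem, Set.ncard_insert_of_notMem,
      Set.ncard_pair hst]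
    · rintro (rfl | rfl)
      · exact hrρ' hsρ
      · exact hrσ' htσ
    · rintro (rfl | rfl | rfl)
      · exact hrp rfl
      · exact hpρ hsρ
      · exact hpσ htσ
    · rintro (rfl | rfl | rfl | rfl)
      · exact hPπ hpπ
      · exact hPπ hrπ
      · exact hsP rfl
      · exact htP rfl
  have hrank : Module.finrank K (Submodule.span K {P, p, r}) = 3 := by
    have he : Submodule.span K {P, p, r} = Submodule.span K {P, p - P, r - P} := by
      apply le_antisymm <;> rw [Submodule.span_le]
      · have h1 : P ∈ Submodule.span K {P, p - P, r - P} := Submodule.subset_span (by simp)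
        have h2 : p - P ∈ Submodule.span K {P, p - P, r - P} := Submodule.subset_span (by simp)
        have h3 : r - P ∈ Submodule.span K {P, p - P, r - P} := Submodule.subset_span (by simp)
        rintro x (rfl | rfl | rfl)
        · exact h1
        · simpa using Submodule.add_mem _ h2 h1
        · simpa using Submodule.add_mem _ h3 h1
      · have h1 : P ∈ Submodule.span K {P, p, r} := Submodule.subset_span (by simp)
        rintro x (rfl | rfl | rfl)
        · exact h1
        · exact Submodule.sub_mem _ (Submodule.subset_span (by simp)) h1
        · exact Submodule.sub_mem _ (Submodule.subset_span (by simp)) h1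
    rw [he]
    have hpP : p ≠ P := by rintro rfl; exact hPπ hpπ
    refine finrank_span_triple_eq_three (h.affine P hP) ?_ ?_ (sub_ne_zero.mpr hpP) ?_
    · rw [map_sub, h.affine P hP, h.affine p hp, sub_self]
    · rw [map_sub, h.affine P hP, h.affine r hr, sub_self]
    · intro k hk
      rcases h.arc P hP p hp r hr hpP.symm k hk with h' | h'
      · exact hPπ (h' ▸ hrπ)
      · exact hrp h'
  have hmem := h.mem_of_four_lt _ hrank (by
    have := Set.ncard_le_ncard hsubs (Set.toFinite _)
    omega)
  have := h.plane_unique p hp r hr (Ne.symm hrp) _ hmem π hπ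
    (Submodule.subset_span (by simp)) (Submodule.subset_span (by simp)) hpπ hrπ
  exact hPπ (this ▸ Submodule.subset_span (by simp))

end VectorConfig
end VectorModel

/-! ### Counting planes through a point and planes meeting a plane -/

theorem Set.ncard_mul_le_of_pairwiseDisjoint {ι α : Type*} [Finite ι] [Finite α] {T : Set ι}
    {D : Set α} {f : ι → Set α} {m : ℕ} (hD : ∀ i ∈ T, f i ⊆ D) (hm : ∀ i ∈ T, (f i).ncard = m)
    (hdisj : T.PairwiseDisjoint f) : T.ncard * m ≤ D.ncard := by
  classical
  have := Fintype.ofFinite ι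
  have := Fintype.ofFinite α
  have h1 : (T.toFinset.biUnion fun i => (f i).toFinset).card = T.ncard * m := by
    rw [Finset.card_biUnion, Finset.sum_congr rfl (g := fun _ => m), Finset.sum_const,
      Set.ncard_eq_toFinset_card', smul_eq_mul]
    · intro i hi
      rw [← Set.ncard_eq_toFinset_card', hm i (Set.mem_toFinset.mp hi)]
    · intro i hi j hj hij
      simp only [Function.onFun]
      rw [Set.disjoint_toFinset]
      exact hdisj (Set.mem_toFinset.mp hi) (Set.mem_toFinset.mp hj) hij
  rw [← h1, Set.ncard_eq_toFinset_card']
  refine Finset.card_le_card fun x hx => ?_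
  obtain ⟨i, hi, hx⟩ := Finset.mem_biUnion.mp hx
  exact Set.mem_toFinset.mpr (hD i (Set.mem_toFinset.mp hi) (Set.mem_toFinset.mp hx))

section VectorModel

variable {K V : Type*} [Field K] [AddCommGroup V] [Module K V]

/-- The planes `π` and `ρ` of the configuration are partners if they are distinct and have an affine
line in common. -/
def IsPartner (φ : V →ₗ[K] K) (Pl : Set (Submodule K V)) (π ρ : Submodule K V) : Prop :=
  ρ ∈ Pl ∧ ρ ≠ π ∧ ∃ o z : V, φ o = 1 ∧ o ∈ π ∧ o ∈ ρ ∧ φ z = 0 ∧ z ≠ 0 ∧ z ∈ π ∧ z ∈ ρ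

/-- Two planes are `c`-disjoint if they have no point of `c` in common. -/
def CDisjoint (c : Set V) (π ρ : Submodule K V) : Prop := ∀ a ∈ c, a ∈ π → a ∉ ρ

theorem CDisjoint.symm {c : Set V} {π ρ : Submodule K V} (h : CDisjoint c π ρ) :
    CDisjoint c ρ π := fun a ha h1 h2 => h a ha h2 h1

theorem IsPartner.symm {φ : V →ₗ[K] K} {Pl : Set (Submodule K V)} {π ρ : Submodule K V}
    (hπ : π ∈ Pl) (h : IsPartner φ Pl π ρ) : IsPartner φ Pl ρ π := by
  obtain ⟨-, hne, o, z, h1, h2, h3, h4, h5, h6, h7⟩ := h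
  exact ⟨hπ, hne.symm, o, z, h1, h3, h2, h4, h5, h7, h6⟩

namespace VectorConfig

variable {φ : V →ₗ[K] K} {c : Set V} {Pl : Set (Submodule K V)}

theorem finiteSubmodule (h : VectorConfig φ c Pl) : Finite (Submodule K V) := by
  have := h.finiteV
  exact Finite.of_injective (fun W : Submodule K V => (W : Set V)) SetLike.coe_injective

/-- At most `q + 1` planes of the configuration pass through a point of `c`: they partition the other
`q ^ 2 - 1` points into sets of `q - 1`. -/
theorem ncard_pencil_le (h : VectorConfig φ c Pl) {R : V} (hR : R ∈ c) {T : Set (Submodule K V)}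
    (hT : ∀ W ∈ T, W ∈ Pl ∧ R ∈ W) : T.ncard ≤ Nat.card K + 1 := by
  have := h.finiteV
  have := h.finiteSubmodule
  have h1 := Set.ncard_mul_le_of_pairwiseDisjoint (T := T) (D := c \ {R})
    (f := fun W => (c ∩ W) \ {R}) (m := Nat.card K - 1) ?_ ?_ ?_
  · rw [Set.ncard_sdiff_singleton_of_mem hR, h.ncard_eq] at h1
    have h7 := h.seven_le
    obtain ⟨n, hn⟩ : ∃ n, Nat.card K = n + 1 := ⟨Nat.card K - 1, by omega⟩
    rw [hn] at h1 ⊢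
    simp only [Nat.add_sub_cancel] at h1
    have : (n + 1) ^ 2 - 1 = (n + 2) * n := by
      rw [show (n + 1) ^ 2 = (n + 2) * n + 1 by ring]; simp
    rw [this] at h1
    exact Nat.le_of_mul_le_mul_right h1 (by omega)
  · rintro W hW x ⟨⟨hx, -⟩, hxR⟩
    exact ⟨hx, hxR⟩
  · intro W hW
    rw [Set.ncard_sdiff_singleton_of_mem (show R ∈ c ∩ W from ⟨hR, (hT W hW).2⟩),
      h.ncard_plane W (hT W hW).1]
  · intro W hW W' hW' hne
    refine Set.disjoint_left.mpr ?_
    rintro x ⟨⟨hx, hxW⟩, hxR⟩ ⟨⟨-, hxW'⟩, -⟩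
    exact hxR (h.eq_of_mem (hT W hW).1 (hT W' hW').1 hne hx hR hxW hxW' (hT W hW).2 (hT W' hW').2)

theorem ncard_cDisjoint_mul_le (h : VectorConfig φ c Pl) {T : Set (Submodule K V)} {D : Set V}
    (hT : ∀ W ∈ T, W ∈ Pl) (hD : ∀ W ∈ T, c ∩ W ⊆ D) (hdisj : T.Pairwise (CDisjoint c)) :
    T.ncard * Nat.card K ≤ D.ncard := by
  have := h.finiteV
  have := h.finiteSubmodule
  refine Set.ncard_mul_le_of_pairwiseDisjoint (f := fun W : Submodule K V => c ∩ W) hD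
    (fun W hW => h.ncard_plane W (hT W hW)) ?_
  intro W hW W' hW' hne
  refine Set.disjoint_left.mpr ?_
  rintro x ⟨hx, hxW⟩ ⟨-, hxW'⟩
  exact hdisj hW hW' hne x hx hxW hxW'

theorem exists_mem_of_ncard_eq (h : VectorConfig φ c Pl) {T : Set (Submodule K V)}
    (hT : ∀ W ∈ T, W ∈ Pl) (hdisj : T.Pairwise (CDisjoint c)) (hcard : T.ncard = Nat.card K)
    {a : V} (ha : a ∈ c) : ∃ W ∈ T, a ∈ W := by
  by_contra hcon
  push Not at hcon
  have := h.finiteV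
  have h1 := h.ncard_cDisjoint_mul_le (D := c \ {a}) hT (by
    rintro W hW x ⟨hx, hxW⟩
    refine ⟨hx, ?_⟩
    rintro rfl
    exact hcon W hW hxW) hdisj
  rw [Set.ncard_sdiff_singleton_of_mem ha, h.ncard_eq, hcard] at h1
  have h7 := h.seven_le
  have : 0 < Nat.card K ^ 2 := by positivity
  rw [← pow_two] at h1
  omega

/-- The planes of the configuration are the lines of an affine plane: a plane `c`-disjoint from
`π` through a given point `R` is unique, since `q` of the at most `q + 1` planes through `R` join `R`
to the points of `c ∩ π`. -/
theorem parallel_unique (h : VectorConfig φ c Pl) {π ρ ρ' : Submodule K V} (hπ : π ∈ Pl)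
    (hρ : ρ ∈ Pl) (hρ' : ρ' ∈ Pl) {R : V} (hR : R ∈ c) (hRρ : R ∈ ρ) (hRρ' : R ∈ ρ')
    (hRπ : R ∉ π) (hd : CDisjoint c π ρ) (hd' : CDisjoint c π ρ') : ρ = ρ' := by
  by_contra hne
  have := h.finiteV
  have := h.finiteSubmodule
  have hj : ∀ A ∈ c ∩ π, ∃ W ∈ Pl, R ∈ W ∧ A ∈ W := by
    rintro A ⟨hA, hAπ⟩
    exact h.exists_plane R hR A hA (by rintro rfl; exact hRπ hAπ)
  choose! J hJ hJR hJA using hj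
  have hinj : Set.InjOn J (c ∩ π) := by
    rintro A hA B hB hAB
    by_contra hne'
    have h1 : J A = π := h.plane_unique A hA.1 B hB.1 hne' _ (hJ A hA) _ hπ (hJA A hA)
      (by rw [hAB]; exact hJA B hB) hA.2 hB.2
    exact hRπ (h1 ▸ hJR A hA)
  have h1 := h.ncard_pencil_le hR (T := {ρ, ρ'} ∪ J '' (c ∩ π)) (by
    rintro W ((rfl | rfl) | ⟨A, hA, rfl⟩)
    · exact ⟨hρ, hRρ⟩
    · exact ⟨hρ', hRρ'⟩
    · exact ⟨hJ A hA, hJR A hA⟩)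
  rw [Set.ncard_union_eq, Set.ncard_pair hne, hinj.ncard_image,
    h.ncard_plane π hπ] at h1
  · omega
  · refine Set.disjoint_left.mpr ?_
    rintro W (rfl | rfl) ⟨A, hA, rfl⟩
    · exact hd A hA.1 hA.2 (hJA A hA)
    · exact hd' A hA.1 hA.2 (hJA A hA)

/-- The planes `c`-disjoint from `π` form together with `π` a family of pairwise `c`-disjoint planes,
which has at most `q` members. -/
theorem ncard_parallel_lt (h : VectorConfig φ c Pl) {π : Submodule K V} (hπ : π ∈ Pl) :
    {ρ | ρ ∈ Pl ∧ CDisjoint c π ρ}.ncard < Nat.card K := by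
  have := h.finiteV
  have := h.finiteSubmodule
  have h7 := h.seven_le
  have hnot : π ∉ {ρ | ρ ∈ Pl ∧ CDisjoint c π ρ} := by
    rintro ⟨-, hd⟩
    obtain ⟨a, ha, haπ⟩ : (c ∩ π).Nonempty := by
      refine (Set.ncard_pos (Set.toFinite _)).mp ?_
      rw [h.ncard_plane π hπ]; omega
    exact hd a ha haπ haπ
  have h1 := h.ncard_cDisjoint_mul_le (D := c) (T := insert π {ρ | ρ ∈ Pl ∧ CDisjoint c π ρ})
    (by rintro W (rfl | hW); exacts [hπ, hW.1]) (fun W _ => Set.inter_subset_left) (by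
      rintro W (rfl | hW) W' (rfl | hW') hne
      · exact absurd rfl hne
      · exact hW'.2
      · exact hW.2.symm
      · intro a ha haW haW'
        exact hne (h.parallel_unique hπ hW.1 hW'.1 ha haW haW' (fun haπ => hW.2 a ha haπ haW)
          hW.2 hW'.2))
  rw [Set.ncard_insert_of_notMem hnot, h.ncard_eq, pow_two] at h1
  exact Nat.lt_of_succ_le (Nat.le_of_mul_le_mul_right h1 (by omega))

theorem ncard_affine (h : VectorConfig φ c Pl) {W : Submodule K V} (hW : W ∈ Pl) :
    {v | v ∈ W ∧ φ v = 1}.ncard = Nat.card K ^ 2 := by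
  have := h.finite
  have := h.moduleFinite
  obtain ⟨o, ho, ho1⟩ := h.exists_affine W hW
  have h1 : {v | v ∈ W ∧ φ v = 1} = (fun u => o + u) '' (W ⊓ LinearMap.ker φ : Submodule K V) := by
    ext v
    constructor
    · rintro ⟨hv, hv1⟩
      exact ⟨v - o, ⟨W.sub_mem hv ho, by simp [hv1, ho1]⟩, by simp⟩
    · rintro ⟨u, ⟨hu, hu0⟩, rfl⟩
      have hu0' : φ u = 0 := hu0
      exact ⟨W.add_mem ho hu, by simp [ho1, hu0']⟩
  rw [h1, Set.ncard_image_of_injective _ (add_right_injective o), ← Nat.card_coe_set_eq,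
    ← h.finrank_inf_ker hW]
  exact Module.natCard_eq_pow_finrank (K := K) (V := ↥(W ⊓ LinearMap.ker φ))

open Classical in
/-- For a plane `ρ ≠ π` the number of common affine points outside `c` is `q - 1` or `q` for a
partner of `π`, and `0` or `1` otherwise. -/
theorem ncard_common_affine (h : VectorConfig φ c Pl) {π ρ : Submodule K V} (hπ : π ∈ Pl)
    (hρ : ρ ∈ Pl) (hne : ρ ≠ π) :
    {v | v ∈ π ∧ φ v = 1 ∧ v ∉ c ∧ v ∈ ρ}.ncard =
      (if IsPartner φ Pl π ρ then Nat.card K - 1 else 0) +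
      (if CDisjoint c π ρ ∧ ∃ o, φ o = 1 ∧ o ∈ π ∧ o ∈ ρ then 1 else 0) := by
  have := h.finite
  have := h.finiteV
  have h7 := h.seven_le
  by_cases hp : IsPartner φ Pl π ρ
  · rw [if_pos hp]
    obtain ⟨-, -, o, z, ho, hoπ, hoρ, hz, hz0, hzπ, hzρ⟩ := hp
    have hall : {v | v ∈ π ∧ φ v = 1 ∧ v ∈ ρ} = Set.range fun k : K => o + k • z := by
      ext v
      constructor
      · rintro ⟨h1, h2, h3⟩
        obtain ⟨k, hk⟩ := h.mem_common_line hπ hρ hne.symm hoπ hoρ ho hzπ hzρ hz hz0 h1 h3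
        exact ⟨k, by rw [hk, h2, one_smul]⟩
      · rintro ⟨k, rfl⟩
        exact ⟨π.add_mem hoπ (π.smul_mem _ hzπ), by simp [ho, hz],
          ρ.add_mem hoρ (ρ.smul_mem _ hzρ)⟩
    have hcard : {v | v ∈ π ∧ φ v = 1 ∧ v ∈ ρ}.ncard = Nat.card K := by
      rw [hall, ← Set.image_univ, Set.ncard_image_of_injective, Set.ncard_univ]
      exact (add_right_injective o).comp (smul_left_injective K hz0)
    by_cases hd : CDisjoint c π ρ
    · rw [if_pos ⟨hd, o, ho, hoπ, hoρ⟩]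
      have : {v | v ∈ π ∧ φ v = 1 ∧ v ∉ c ∧ v ∈ ρ} = {v | v ∈ π ∧ φ v = 1 ∧ v ∈ ρ} := by
        ext v
        constructor
        · rintro ⟨h1, h2, -, h3⟩; exact ⟨h1, h2, h3⟩
        · rintro ⟨h1, h2, h3⟩; exact ⟨h1, h2, fun hc => hd v hc h1 h3, h3⟩
      rw [this, hcard]; omega
    · rw [if_neg (fun hh => hd hh.1), add_zero]
      unfold CDisjoint at hd
      push Not at hd
      obtain ⟨a, ha, haπ, haρ⟩ := hd
      have : {v | v ∈ π ∧ φ v = 1 ∧ v ∉ c ∧ v ∈ ρ} = {v | v ∈ π ∧ φ v = 1 ∧ v ∈ ρ} \ {a} := by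
        ext v
        constructor
        · rintro ⟨h1, h2, h4, h3⟩
          refine ⟨⟨h1, h2, h3⟩, ?_⟩
          rintro rfl
          exact h4 ha
        · rintro ⟨⟨h1, h2, h3⟩, h4⟩
          exact ⟨h1, h2, fun hc => h4 (h.eq_of_mem hπ hρ hne.symm hc ha h1 h3 haπ haρ), h3⟩
      rw [this, Set.ncard_sdiff_singleton_of_mem
        (show a ∈ {v | v ∈ π ∧ φ v = 1 ∧ v ∈ ρ} from ⟨haπ, h.affine a ha, haρ⟩), hcard]
  · rw [if_neg hp, zero_add]
    have huniq : ∀ v w : V, v ∈ π → v ∈ ρ → φ v = 1 → w ∈ π → w ∈ ρ → φ w = 1 → v = w := by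
      intro v w h1 h2 h3 h4 h5 h6
      by_contra hvw
      exact hp ⟨hρ, hne, v, w - v, h3, h1, h2, by simp [h3, h6], sub_ne_zero.mpr (Ne.symm hvw),
        π.sub_mem h4 h1, ρ.sub_mem h5 h2⟩
    split_ifs with hM
    · obtain ⟨hd, o, ho, hoπ, hoρ⟩ := hM
      rw [Set.ncard_eq_one]
      refine ⟨o, ?_⟩
      ext v
      constructor
      · rintro ⟨h1, h2, -, h3⟩; exact huniq v o h1 h3 h2 hoπ hoρ ho
      · rintro rfl
        exact ⟨hoπ, ho, fun hc => hd v hc hoπ hoρ, hoρ⟩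
    · rw [Set.ncard_eq_zero (Set.toFinite _)]
      ext v
      simp only [Set.mem_ofPred_eq, Set.mem_empty_iff_false, iff_false]
      rintro ⟨h1, h2, h3, h4⟩
      refine hM ⟨?_, v, h2, h1, h4⟩
      intro a ha haπ haρ
      exact h3 (huniq a v haπ haρ (h.affine a ha) h1 h4 h2 ▸ ha)

open Classical in
/-- Counting the affine points of `π` outside `c` by the second plane of the configuration on
them. -/
theorem sum_common_affine (h : VectorConfig φ c Pl) {π : Submodule K V} (hπ : π ∈ Pl) :
    Nat.card K * (Nat.card K - 1) =
      (Nat.card K - 1) * {ρ | IsPartner φ Pl π ρ}.ncard +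
      {ρ | ρ ∈ Pl ∧ CDisjoint c π ρ ∧ ∃ o, φ o = 1 ∧ o ∈ π ∧ o ∈ ρ}.ncard := by
  have := h.finite
  have := h.finiteV
  have := h.finiteSubmodule
  have := Fintype.ofFinite V
  have := Fintype.ofFinite (Submodule K V)
  have h7 := h.seven_le
  let S : Finset V := Finset.univ.filter fun v => v ∈ π ∧ φ v = 1 ∧ v ∉ c
  let T : Finset (Submodule K V) := Finset.univ.filter fun ρ => ρ ∈ Pl ∧ ρ ≠ π
  have hdc := Finset.sum_card_bipartiteAbove_eq_sum_card_bipartiteBelow (s := S) (t := T)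
    (fun v ρ => v ∈ ρ)
  have hS1 : ∀ v ∈ S, (T.bipartiteAbove (fun v ρ => v ∈ ρ) v).card = 1 := by
    intro v hv
    obtain ⟨h1, h2, h3⟩ := (Finset.mem_filter.mp hv).2
    obtain ⟨W, hW, hne, hvW, hu⟩ := h.two_planes v h2 h3 π hπ h1
    rw [Finset.card_eq_one]
    refine ⟨W, ?_⟩
    ext ρ
    simp only [Finset.bipartiteAbove, T, Finset.mem_filter, Finset.mem_univ, true_and,
      Finset.mem_singleton]
    constructor
    · rintro ⟨⟨h4, h5⟩, h6⟩
      exact (hu ρ h4 h6).resolve_left h5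
    · rintro rfl
      exact ⟨⟨hW, hne⟩, hvW⟩
  rw [Finset.sum_congr rfl hS1, Finset.sum_const, smul_eq_mul, mul_one] at hdc
  have hScard : S.card = Nat.card K * (Nat.card K - 1) := by
    have h1 : (S : Set V) = {v | v ∈ π ∧ φ v = 1} \ (c ∩ π) := by
      ext v
      simp only [S, Finset.coe_filter, Finset.mem_univ, true_and, Set.mem_ofPred_eq, Set.mem_sdiff,
        Set.mem_inter_iff, SetLike.mem_coe]
      tauto
    rw [← Set.ncard_coe_finset, h1, Set.ncard_sdiff (by
      rintro v ⟨hv, hvπ⟩; exact ⟨hvπ, h.affine v hv⟩), h.ncard_affine hπ, h.ncard_plane π hπ,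
      pow_two, Nat.mul_sub, mul_one]
  have hT : ∀ ρ ∈ T, (S.bipartiteBelow (fun v ρ => v ∈ ρ) ρ).card =
      (if IsPartner φ Pl π ρ then Nat.card K - 1 else 0) +
      (if CDisjoint c π ρ ∧ ∃ o, φ o = 1 ∧ o ∈ π ∧ o ∈ ρ then 1 else 0) := by
    intro ρ hρ
    obtain ⟨h1, h2⟩ := (Finset.mem_filter.mp hρ).2
    have h3 := h.ncard_common_affine hπ h1 h2
    have h4 : ((S.bipartiteBelow (fun v ρ => v ∈ ρ) ρ : Finset V) : Set V) =
        {v | v ∈ π ∧ φ v = 1 ∧ v ∉ c ∧ v ∈ ρ} := by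
      ext v
      simp [Finset.bipartiteBelow, S, and_assoc]
    rw [← Set.ncard_coe_finset, h4, h3]
    congr
  rw [Finset.sum_congr rfl hT, hScard, Finset.sum_add_distrib, Finset.sum_ite, Finset.sum_ite,
    Finset.sum_const, Finset.sum_const_zero, Finset.sum_const, Finset.sum_const_zero, add_zero,
    add_zero, smul_eq_mul, smul_eq_mul, mul_one] at hdc
  have hL : {ρ | IsPartner φ Pl π ρ}.ncard = (T.filter fun ρ => IsPartner φ Pl π ρ).card := by
    rw [← Set.ncard_coe_finset]
    congr 1
    ext ρ
    simp only [T, Finset.coe_filter, Finset.mem_filter, Finset.mem_univ, true_and,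
      Set.mem_ofPred_eq]
    exact ⟨fun hp => ⟨⟨hp.1, hp.2.1⟩, hp⟩, fun hp => hp.2⟩
  have hM : {ρ | ρ ∈ Pl ∧ CDisjoint c π ρ ∧ ∃ o, φ o = 1 ∧ o ∈ π ∧ o ∈ ρ}.ncard =
      (T.filter fun ρ => CDisjoint c π ρ ∧ ∃ o, φ o = 1 ∧ o ∈ π ∧ o ∈ ρ).card := by
    rw [← Set.ncard_coe_finset]
    congr 1
    ext ρ
    simp only [T, Finset.coe_filter, Finset.mem_filter, Finset.mem_univ, true_and,
      Set.mem_ofPred_eq]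
    constructor
    · rintro ⟨h1, h2, h3⟩
      refine ⟨⟨h1, ?_⟩, h2, h3⟩
      rintro rfl
      obtain ⟨a, ha, haπ⟩ : (c ∩ ρ).Nonempty := by
        refine (Set.ncard_pos (Set.toFinite _)).mp ?_
        rw [h.ncard_plane ρ hπ]; omega
      exact h2 a ha haπ haπ
    · rintro ⟨⟨h1, -⟩, h2, h3⟩
      exact ⟨h1, h2, h3⟩
  rw [hL, hM, hdc, mul_comm]

end VectorConfig
end VectorModel

/-! ### Partners and grids -/

section VectorModel

variable {K V : Type*} [Field K] [AddCommGroup V] [Module K V]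

/-- `z` is a direction at infinity of the plane `π` common to all affine lines in which `π` meets
its partners. -/
def IsPartnerDirection (φ : V →ₗ[K] K) (Pl : Set (Submodule K V)) (π : Submodule K V) (z : V) :
    Prop :=
  z ≠ 0 ∧ φ z = 0 ∧ z ∈ π ∧ ∀ ρ, IsPartner φ Pl π ρ → z ∈ ρ

namespace VectorConfig

variable {φ : V →ₗ[K] K} {c : Set V} {Pl : Set (Submodule K V)}

/-- A plane has at least `q - 1` partners, by `sum_common_affine` and `ncard_parallel_lt`. -/
theorem pred_le_ncard_partner (h : VectorConfig φ c Pl) {π : Submodule K V} (hπ : π ∈ Pl) :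
    Nat.card K - 1 ≤ {ρ | IsPartner φ Pl π ρ}.ncard := by
  have := h.finiteSubmodule
  have h1 := h.sum_common_affine hπ
  have h2 := h.ncard_parallel_lt hπ
  have h3 : {ρ | ρ ∈ Pl ∧ CDisjoint c π ρ ∧ ∃ o, φ o = 1 ∧ o ∈ π ∧ o ∈ ρ}.ncard ≤
      {ρ | ρ ∈ Pl ∧ CDisjoint c π ρ}.ncard :=
    Set.ncard_le_ncard (fun ρ hρ => ⟨hρ.1, hρ.2.1⟩) (Set.toFinite _)
  have h7 := h.seven_le
  obtain ⟨n, hn⟩ : ∃ n, Nat.card K = n + 1 := ⟨Nat.card K - 1, by omega⟩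
  rw [hn] at h1 h2 ⊢
  simp only [Nat.add_sub_cancel] at h1 ⊢
  by_contra hlt
  push Not at hlt
  have h4 := Nat.mul_le_mul_left n (Nat.succ_le_of_lt hlt)
  rw [Nat.mul_succ] at h4
  nlinarith

/-- If `ρ` and `σ` meet `π` in affine lines that are not parallel, then the common point of these
lines is on three planes of the configuration, hence in `c`. -/
theorem exists_mem_of_partners (h : VectorConfig φ c Pl) {π ρ σ : Submodule K V} (hπ : π ∈ Pl)
    (hρ : ρ ∈ Pl) (hσ : σ ∈ Pl) (hρπ : ρ ≠ π) (hσπ : σ ≠ π) {o z o' z' : V} (ho : φ o = 1)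
    (hoπ : o ∈ π) (hoρ : o ∈ ρ) (hz : φ z = 0) (hz0 : z ≠ 0) (hzπ : z ∈ π) (hzρ : z ∈ ρ)
    (ho' : φ o' = 1) (hoπ' : o' ∈ π) (hoσ : o' ∈ σ) (hz' : φ z' = 0) (hzπ' : z' ∈ π)
    (hzσ : z' ∈ σ) (hzz : ∀ k : K, z' ≠ k • z) : ∃ P ∈ c, P ∈ π ∧ P ∈ ρ ∧ P ∈ σ := by
  obtain ⟨a, b, hab⟩ := exists_eq_add_smul_of_finrank_three (h.finrank_plane π hπ) hoπ hzπ hzπ'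
    ho hz hz' hz0 hzz o' hoπ'
  rw [ho', one_smul] at hab
  have h1 : o + a • z ∈ σ := by
    have : o + a • z = o' - b • z' := by rw [hab]; abel
    rw [this]
    exact σ.sub_mem hoσ (σ.smul_mem _ hzσ)
  have h2 : o + a • z ∈ π := π.add_mem hoπ (π.smul_mem _ hzπ)
  have h3 : o + a • z ∈ ρ := ρ.add_mem hoρ (ρ.smul_mem _ hzρ)
  refine ⟨o + a • z, ?_, h2, h3, h1⟩
  refine h.mem_of_three hπ hρ hσ hρπ.symm hσπ.symm ?_ (by simp [ho, hz]) h2 h3 h1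
  rintro rfl
  obtain ⟨k, hk⟩ := h.mem_common_line hπ hρ hρπ.symm hoπ hoρ ho hzπ hzρ hz hz0 hzπ' hzσ
  exact hzz k (by rw [hk, hz']; simp)

/-- The affine lines in which a plane of the configuration meets its partners are parallel: two of
them meet in a point of `c` or at infinity, so otherwise all pass through one point of `c`, which
would be on three tangents. -/
theorem exists_partnerDirection (h : VectorConfig φ c Pl) {π : Submodule K V} (hπ : π ∈ Pl) :
    ∃ z, IsPartnerDirection φ Pl π z := by
  have := h.finiteSubmodule
  have h7 := h.seven_le
  have hcard := h.pred_le_ncard_partner hπ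
  obtain ⟨ρ₀, hρ₀⟩ : {ρ | IsPartner φ Pl π ρ}.Nonempty :=
    (Set.ncard_pos (Set.toFinite _)).mp (by omega)
  obtain ⟨z₀, hz₀⟩ : ∃ z, z ≠ 0 ∧ φ z = 0 ∧ z ∈ π ∧ z ∈ ρ₀ := by
    obtain ⟨-, -, o, z, -, -, -, h1, h2, h3, h4⟩ := hρ₀
    exact ⟨z, h2, h1, h3, h4⟩
  by_contra hcon
  push Not at hcon
  -- Two partner lines in different directions meet in a point `P` of `c`.
  obtain ⟨ρ₁, ρ₂, hp₁, hp₂, o₁, z₁, o₂, z₂, ho₁, hoπ₁, hoρ₁, hz₁, hz01, hzπ₁, hzρ₁, ho₂, hoπ₂, hoρ₂,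
    hz₂, hz02, hzπ₂, hzρ₂, hzz⟩ : ∃ ρ₁ ρ₂, IsPartner φ Pl π ρ₁ ∧ IsPartner φ Pl π ρ₂ ∧
      ∃ o₁ z₁ o₂ z₂ : V, φ o₁ = 1 ∧ o₁ ∈ π ∧ o₁ ∈ ρ₁ ∧ φ z₁ = 0 ∧ z₁ ≠ 0 ∧ z₁ ∈ π ∧ z₁ ∈ ρ₁ ∧
        φ o₂ = 1 ∧ o₂ ∈ π ∧ o₂ ∈ ρ₂ ∧ φ z₂ = 0 ∧ z₂ ≠ 0 ∧ z₂ ∈ π ∧ z₂ ∈ ρ₂ ∧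
        ∀ k : K, z₂ ≠ k • z₁ := by
    by_contra hno
    push Not at hno
    refine hcon z₀ ⟨hz₀.1, hz₀.2.1, hz₀.2.2.1, fun ρ hρ => ?_⟩
    obtain ⟨-, -, o, z, g1, g2, g3, g4, g5, g6, g7⟩ := id hρ
    obtain ⟨-, -, o', z', f1, f2, f3, f4, f5, f6, f7⟩ := id hρ₀
    obtain ⟨k, hk⟩ := h.mem_common_line hπ hρ₀.1 hρ₀.2.1.symm f2 f3 f1 f6 f7 f4 f5 hz₀.2.2.1
      hz₀.2.2.2
    obtain ⟨l, hl⟩ := hno ρ ρ₀ hρ hρ₀ o z o' z' g1 g2 g3 g4 g5 g6 g7 f1 f2 f3 f4 f5 f6 f7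
    rw [hk, hz₀.2.1, zero_smul, zero_add, hl]
    exact ρ.smul_mem _ (ρ.smul_mem _ g7)
  obtain ⟨P, hP, hPπ, hP₁, hP₂⟩ := h.exists_mem_of_partners hπ hp₁.1 hp₂.1 hp₁.2.1 hp₂.2.1 ho₁ hoπ₁
    hoρ₁ hz₁ hz01 hzπ₁ hzρ₁ ho₂ hoπ₂ hoρ₂ hz₂ hzπ₂ hzρ₂ hzz
  have hzz' : ∀ k : K, z₁ ≠ k • z₂ := by
    intro k hk
    have hk0 : k ≠ 0 := by rintro rfl; exact hz01 (by rw [hk, zero_smul])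
    exact hzz k⁻¹ (by rw [hk, smul_smul, inv_mul_cancel₀ hk0, one_smul])
  have htan : ∀ ρ, IsPartner φ Pl π ρ → P ∈ ρ → ∀ z ∈ ρ, z ∈ π → z ≠ 0 → ∀ k : K, k ≠ 0 →
      P + k • z ∉ c := by
    intro ρ hρ hPρ z hzρ hzπ hz0 k hk hmem
    have := h.eq_of_mem hπ hρ.1 hρ.2.1.symm hP hmem hPπ hPρ (π.add_mem hPπ (π.smul_mem _ hzπ))
      (ρ.add_mem hPρ (ρ.smul_mem _ hzρ))
    rw [left_eq_add, smul_eq_zero] at this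
    exact this.elim hk hz0
  obtain ⟨ρ₃, hp₃, h3n⟩ : ({ρ | IsPartner φ Pl π ρ} \ {ρ₁, ρ₂}).Nonempty := by
    refine (Set.ncard_pos (Set.toFinite _)).mp ?_
    have h1 := Set.le_ncard_sdiff {ρ₁, ρ₂} {ρ | IsPartner φ Pl π ρ} (Set.toFinite _)
    have h2 := Set.ncard_insert_le ρ₁ {ρ₂}
    rw [Set.ncard_singleton] at h2
    omega
  have h31 : ρ₁ ≠ ρ₃ := by rintro rfl; exact h3n (by simp)
  have h32 : ρ₂ ≠ ρ₃ := by rintro rfl; exact h3n (by simp)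
  obtain ⟨-, -, o₃, z₃, ho₃, hoπ₃, hoρ₃, hz₃, hz03, hzπ₃, hzρ₃⟩ := id hp₃
  have hne : ∀ ρ z, IsPartner φ Pl π ρ → ρ ≠ ρ₃ → P ∈ ρ → P ∈ ρ₃ → φ z = 0 → z ∈ π → z ∈ ρ →
      z ≠ 0 → ∀ k : K, z₃ ≠ k • z := by
    intro ρ z hρ hn hPρ hP₃ hz hzπ hzρ hz0 k hk
    have hk0 : k ≠ 0 := by rintro rfl; exact hz03 (by rw [hk, zero_smul])
    have hz' : z ∈ ρ₃ := by
      have : z = k⁻¹ • z₃ := by rw [hk, smul_smul, inv_mul_cancel₀ hk0, one_smul]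
      rw [this]
      exact ρ₃.smul_mem _ hzρ₃
    have := h.mem_of_three hπ hρ.1 hp₃.1 hρ.2.1.symm hp₃.2.1.symm hn (v := P + (1 : K) • z)
      (by simp [h.affine P hP, hz]) (π.add_mem hPπ (π.smul_mem _ hzπ))
      (ρ.add_mem hPρ (ρ.smul_mem _ hzρ)) (ρ₃.add_mem hP₃ (ρ₃.smul_mem _ hz'))
    exact htan ρ hρ hPρ z hzρ hzπ hz0 1 one_ne_zero this
  have hP₃ : P ∈ ρ₃ := by
    by_cases hk : ∀ k : K, z₃ ≠ k • z₁
    · obtain ⟨Q, hQ, hQπ, hQ₁, hQ₃⟩ := h.exists_mem_of_partners hπ hp₁.1 hp₃.1 hp₁.2.1 hp₃.2.1 ho₁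
        hoπ₁ hoρ₁ hz₁ hz01 hzπ₁ hzρ₁ ho₃ hoπ₃ hoρ₃ hz₃ hzπ₃ hzρ₃ hk
      rwa [h.eq_of_mem hπ hp₁.1 hp₁.2.1.symm hP hQ hPπ hP₁ hQπ hQ₁]
    · push Not at hk
      obtain ⟨k, hk⟩ := hk
      have hk0 : k ≠ 0 := by rintro rfl; exact hz03 (by rw [hk, zero_smul])
      obtain ⟨Q, hQ, hQπ, hQ₂, hQ₃⟩ := h.exists_mem_of_partners hπ hp₂.1 hp₃.1 hp₂.2.1 hp₃.2.1 ho₂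
        hoπ₂ hoρ₂ hz₂ hz02 hzπ₂ hzρ₂ ho₃ hoπ₃ hoρ₃ hz₃ hzπ₃ hzρ₃ (by
          intro l hl
          refine hzz' (k⁻¹ * l) ?_
          rw [mul_smul, ← hl, hk, smul_smul, inv_mul_cancel₀ hk0, one_smul])
      rwa [h.eq_of_mem hπ hp₂.1 hp₂.2.1.symm hP hQ hPπ hP₂ hQπ hQ₂]
  exact h.not_three_tangents hπ hP hPπ hzπ₁ hzπ₂ hzπ₃ hz₁ hz₂ hz₃ hz01 hzz
    (hne ρ₁ z₁ hp₁ h31 hP₁ hP₃ hz₁ hzπ₁ hzρ₁ hz01)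
    (hne ρ₂ z₂ hp₂ h32 hP₂ hP₃ hz₂ hzπ₂ hzρ₂ hz02)
    (htan ρ₁ hp₁ hP₁ z₁ hzρ₁ hzπ₁ hz01) (htan ρ₂ hp₂ hP₂ z₂ hzρ₂ hzπ₂ hz02)
    (htan ρ₃ hp₃ hP₃ z₃ hzρ₃ hzπ₃ hz03)

theorem partnerDirection_of_partner (h : VectorConfig φ c Pl) {π ρ : Submodule K V} (hπ : π ∈ Pl)
    {z : V} (hz : IsPartnerDirection φ Pl π z) (hρ : IsPartner φ Pl π ρ) :
    IsPartnerDirection φ Pl ρ z := by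
  refine ⟨hz.1, hz.2.1, hz.2.2.2 ρ hρ, fun σ hσ => ?_⟩
  obtain ⟨w, hw0, hw, hwρ, hwp⟩ := h.exists_partnerDirection hρ.1
  have hwπ := hwp π (hρ.symm hπ)
  obtain ⟨o, -, ho, hoπ, hoρ, -⟩ := hρ.2.2
  obtain ⟨k, hk⟩ := h.mem_common_line hπ hρ.1 hρ.2.1.symm hoπ hoρ ho hwπ hwρ hw hw0 hz.2.2.1
    (hz.2.2.2 ρ hρ)
  rw [hk, hz.2.1, zero_smul, zero_add]
  exact σ.smul_mem _ (hwp σ hσ)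

theorem partners_cDisjoint (h : VectorConfig φ c Pl) {π ρ σ : Submodule K V} (hπ : π ∈ Pl)
    (hρ : IsPartner φ Pl π ρ) (hσ : IsPartner φ Pl π σ) (hne : ρ ≠ σ) : CDisjoint c ρ σ := by
  intro R hR hRρ hRσ
  obtain ⟨z, hz0, hz, hzπ, hzp⟩ := h.exists_partnerDirection hπ
  have hzρ := hzp ρ hρ
  have hzσ := hzp σ hσ
  by_cases hRπ : R ∈ π
  · have h1 : R + z ∈ c := h.mem_of_three hπ hρ.1 hσ.1 hρ.2.1.symm hσ.2.1.symm hne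
      (by simp [h.affine R hR, hz]) (π.add_mem hRπ hzπ) (ρ.add_mem hRρ hzρ) (σ.add_mem hRσ hzσ)
    have := h.eq_of_mem hπ hρ.1 hρ.2.1.symm hR h1 hRπ hRρ (π.add_mem hRπ hzπ)
      (ρ.add_mem hRρ hzρ)
    exact hz0 (by simpa using this)
  · obtain ⟨o, -, ho, hoπ, hoρ, -⟩ := hρ.2.2
    obtain ⟨o', -, ho', hoπ', hoσ, -⟩ := hσ.2.2
    exact h.not_triangle hπ hρ.1 hσ.1 hρ.2.1.symm hσ.2.1.symm hne hz hz0 hzπ hzρ hzσ ho hoπ hoρ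
      ho' hoπ' hoσ hR hRρ hRσ hRπ

/-- A plane and its partner have a point of `c` in common. Otherwise no partner of `π` meets
`c ∩ π`, and the lines through two points of `c ∩ π` in the common direction of the partner lines
are both different from the at least `q - 1` partner lines. -/
theorem partner_meets (h : VectorConfig φ c Pl) {π ρ : Submodule K V} (hπ : π ∈ Pl)
    (hρ : IsPartner φ Pl π ρ) : ∃ a ∈ c, a ∈ π ∧ a ∈ ρ := by
  have := h.finite
  have := h.finiteV
  have := h.finiteSubmodule
  by_contra hcon
  push Not at hcon
  have hd : CDisjoint c π ρ := hcon
  have hall : ∀ σ, IsPartner φ Pl π σ → CDisjoint c π σ := by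
    intro σ hσ a ha haπ haσ
    have hσρ : ρ ≠ σ := by rintro rfl; exact hd a ha haπ haσ
    exact hσ.2.1 (h.parallel_unique hρ.1 hσ.1 hπ ha haσ haπ (hd a ha haπ)
      (h.partners_cDisjoint hπ hρ hσ hσρ) hd.symm)
  obtain ⟨z, hz0, hz, hzπ, hzp⟩ := h.exists_partnerDirection hπ
  have h7 := h.seven_le
  have hcπ := h.ncard_plane π hπ
  obtain ⟨A, hA, hAπ⟩ : (c ∩ π).Nonempty := (Set.ncard_pos (Set.toFinite _)).mp (by omega)
  obtain ⟨B, hB, hBπ, hBz⟩ : ∃ B ∈ c, B ∈ π ∧ ∀ k : K, B - A ≠ k • z := by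
    by_contra hno
    push Not at hno
    obtain ⟨B, ⟨hB, hBπ⟩, hBA⟩ : ((c ∩ π) \ {A}).Nonempty := by
      refine (Set.ncard_pos (Set.toFinite _)).mp ?_
      rw [Set.ncard_sdiff_singleton_of_mem (show A ∈ c ∩ π from ⟨hA, hAπ⟩)]
      omega
    obtain ⟨D, ⟨hD, hDπ⟩, hDn⟩ : ((c ∩ π) \ {A, B}).Nonempty := by
      refine (Set.ncard_pos (Set.toFinite _)).mp ?_
      have h1 := Set.le_ncard_sdiff {A, B} (c ∩ π) (Set.toFinite _)
      have h2 := Set.ncard_insert_le A {B}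
      rw [Set.ncard_singleton] at h2
      omega
    obtain ⟨k, hk⟩ := hno B hB hBπ
    obtain ⟨l, hl⟩ := hno D hD hDπ
    have hBA' : B ≠ A := hBA
    have hk0 : k ≠ 0 := by
      rintro rfl
      exact hBA' (by rwa [zero_smul, sub_eq_zero] at hk)
    rcases h.arc A hA B hB D hD hBA'.symm (l / k)
      (by rw [hk, hl, smul_smul, div_mul_cancel₀ _ hk0]) with rfl | rfl
    · exact hDn (by simp)
    · exact hDn (by simp)
  have hBA : φ (B - A) = 0 := by rw [map_sub, h.affine A hA, h.affine B hB, sub_self]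
  -- The line in which `σ` meets `π` crosses the line `A B` in the point with parameter `s`; different
  -- partners give different values of `s`, none of which is `0` or `1`.
  have hcoord : ∀ σ, IsPartner φ Pl π σ → ∃ s t : K, A + t • z + s • (B - A) ∈ π ∧
      A + t • z + s • (B - A) ∈ σ := by
    intro σ hσ
    obtain ⟨o, -, ho, hoπ, hoσ, -⟩ := hσ.2.2
    obtain ⟨t, s, hts⟩ := exists_eq_add_smul_of_finrank_three (h.finrank_plane π hπ) hAπ hzπ
      (π.sub_mem hBπ hAπ) (h.affine A hA) hz hBA hz0 hBz o hoπ
    rw [ho, one_smul] at hts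
    exact ⟨s, t, hts ▸ hoπ, hts ▸ hoσ⟩
  choose! s t hsπ hsσ using hcoord
  have hle : {σ | IsPartner φ Pl π σ}.ncard ≤ (({0, 1} : Set K)ᶜ).ncard := by
    refine Set.ncard_le_ncard_of_injOn s ?_ ?_ (Set.toFinite _)
    · rintro σ hσ (h0 | h1)
      · have := hsσ σ hσ
        rw [h0, zero_smul, add_zero] at this
        refine hall σ hσ A hA hAπ ?_
        have h2 := σ.sub_mem this (σ.smul_mem (t σ) (hzp σ hσ))
        rwa [add_sub_cancel_right] at h2
      · have h1' : s σ = 1 := h1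
        have := hsσ σ hσ
        rw [h1', one_smul] at this
        refine hall σ hσ B hB hBπ ?_
        have h2 := σ.sub_mem this (σ.smul_mem (t σ) (hzp σ hσ))
        have h3 : A + t σ • z + (B - A) - t σ • z = B := by abel
        rwa [h3] at h2
    · intro σ hσ τ hτ hst
      by_contra hne
      have h1 : A + t σ • z + s σ • (B - A) ∈ τ := by
        have h2 := τ.add_mem (hsσ τ hτ) (τ.smul_mem (t σ - t τ) (hzp τ hτ))
        have h3 : A + t τ • z + s τ • (B - A) + (t σ - t τ) • z =
            A + t σ • z + s σ • (B - A) := by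
          rw [hst]; module
        rwa [h3] at h2
      exact hall σ hσ _ (h.mem_of_three hπ hσ.1 hτ.1 hσ.2.1.symm hτ.2.1.symm hne
        (by simp [h.affine A hA, h.affine B hB, hz]) (hsπ σ hσ) (hsσ σ hσ) h1) (hsπ σ hσ) (hsσ σ hσ)
  rw [Set.ncard_compl, Set.ncard_pair zero_ne_one] at hle
  have := h.pred_le_ncard_partner hπ
  omega

/-- Every plane of the configuration has exactly `q` partners, and it has no affine point in common
with the planes that are `c`-disjoint from it. A further partner `τ` of a partner of `π` is
`c`-disjoint from `π` without meeting it in an affine point, so that the bound used in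
`pred_le_ncard_partner` is not attained. -/
theorem ncard_partner_eq_and (h : VectorConfig φ c Pl) {π : Submodule K V} (hπ : π ∈ Pl) :
    {ρ | IsPartner φ Pl π ρ}.ncard = Nat.card K ∧
      ∀ ρ ∈ Pl, CDisjoint c π ρ → ∀ o, φ o = 1 → o ∈ π → o ∉ ρ := by
  have := h.finiteSubmodule
  have h7 := h.seven_le
  obtain ⟨z, hz⟩ := h.exists_partnerDirection hπ
  obtain ⟨σ, hσ⟩ : {ρ | IsPartner φ Pl π ρ}.Nonempty :=
    (Set.ncard_pos (Set.toFinite _)).mp (by have := h.pred_le_ncard_partner hπ; omega)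
  have hπσ := hσ.symm hπ
  obtain ⟨τ, hτ, hτπ⟩ : ({ρ | IsPartner φ Pl σ ρ} \ {π}).Nonempty := by
    refine (Set.ncard_pos (Set.toFinite _)).mp ?_
    rw [Set.ncard_sdiff_singleton_of_mem (show π ∈ {ρ | IsPartner φ Pl σ ρ} from hπσ)]
    have := h.pred_le_ncard_partner hσ.1
    omega
  have hτπ' : τ ≠ π := hτπ
  have hd : CDisjoint c π τ := h.partners_cDisjoint hσ.1 hπσ hτ hτπ'.symm
  have hzτ : z ∈ τ := (h.partnerDirection_of_partner hπ hz hσ).2.2.2 τ hτ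
  have hno : ∀ o, φ o = 1 → o ∈ π → o ∉ τ := by
    intro o ho hoπ hoτ
    obtain ⟨a, ha, haπ, haτ⟩ := h.partner_meets hπ (ρ := τ)
      ⟨hτ.1, hτπ', o, z, ho, hoπ, hoτ, hz.2.1, hz.1, hz.2.2.1, hzτ⟩
    exact hd a ha haπ haτ
  have h1 := h.sum_common_affine hπ
  set M := {ρ | ρ ∈ Pl ∧ CDisjoint c π ρ ∧ ∃ o, φ o = 1 ∧ o ∈ π ∧ o ∈ ρ} with hM
  have h2 := h.ncard_parallel_lt hπ
  have h3 : M.ncard < {ρ | ρ ∈ Pl ∧ CDisjoint c π ρ}.ncard := by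
    refine Set.ncard_lt_ncard ?_ (Set.toFinite _)
    refine ⟨fun ρ hρ => ⟨hρ.1, hρ.2.1⟩, fun hsub => ?_⟩
    obtain ⟨-, -, o, ho, hoπ, hoτ⟩ := hsub (show τ ∈ {ρ | ρ ∈ Pl ∧ CDisjoint c π ρ} from ⟨hτ.1, hd⟩)
    exact hno o ho hoπ hoτ
  have h4 := h.pred_le_ncard_partner hπ
  obtain ⟨n, hn⟩ : ∃ n, Nat.card K = n + 1 := ⟨Nat.card K - 1, by omega⟩
  rw [hn] at h1 h2 h4 ⊢
  simp only [Nat.add_sub_cancel] at h1 h4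
  have h5 : {ρ | IsPartner φ Pl π ρ}.ncard = n + 1 := by
    have h6 : {ρ | IsPartner φ Pl π ρ}.ncard ≠ n := by
      intro h6
      rw [h6] at h1
      nlinarith
    have h8 : ¬ n + 2 ≤ {ρ | IsPartner φ Pl π ρ}.ncard := by
      intro h8
      have := Nat.mul_le_mul_left n h8
      nlinarith
    omega
  refine ⟨h5, fun ρ hρ hdρ o ho hoπ hoρ => ?_⟩
  rw [h5] at h1
  have h6 : M.ncard = 0 := by
    rw [mul_comm] at h1; omega
  rw [Set.ncard_eq_zero (Set.toFinite _)] at h6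
  have : ρ ∈ M := ⟨hρ, hdρ, o, ho, hoπ, hoρ⟩
  rw [h6] at this
  exact this

end VectorConfig

/-- Two families `P` and `S` of planes of the configuration such that the partners of each plane of
one family are the planes of the other; all these planes contain the point `z` at infinity. They
are two parallel classes of the affine plane formed by the configuration. -/
structure IsGrid (φ : V →ₗ[K] K) (Pl P S : Set (Submodule K V)) (z : V) : Prop where
  ne_zero : z ≠ 0
  map_eq_zero : φ z = 0
  left_subset : P ⊆ Pl
  right_subset : S ⊆ Pl
  left_mem : ∀ π ∈ P, z ∈ π
  right_mem : ∀ σ ∈ S, z ∈ σ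
  left_partner : ∀ π ∈ P, ∀ ρ, IsPartner φ Pl π ρ ↔ ρ ∈ S
  right_partner : ∀ σ ∈ S, ∀ ρ, IsPartner φ Pl σ ρ ↔ ρ ∈ P
  left_ncard : P.ncard = Nat.card K
  right_ncard : S.ncard = Nat.card K

theorem IsGrid.swap {φ : V →ₗ[K] K} {Pl P S : Set (Submodule K V)} {z : V}
    (g : IsGrid φ Pl P S z) : IsGrid φ Pl S P z :=
  ⟨g.1, g.2, g.4, g.3, g.6, g.5, g.8, g.7, g.10, g.9⟩

namespace VectorConfig

variable {φ : V →ₗ[K] K} {c : Set V} {Pl : Set (Submodule K V)}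

/-- A plane `π₀`, its partner `σ₀`, the partners of `σ₀` and the partners of `π₀` form a grid: a partner
of `σ₀` and a partner of `π₀` contain the same point at infinity, and have a point of `c` in common
since the planes of the configuration are the lines of an affine plane. -/
theorem exists_isGrid (h : VectorConfig φ c Pl) : ∃ P S z, IsGrid φ Pl P S z := by
  have := h.finiteV
  have := h.finiteSubmodule
  have h7 := h.seven_le
  obtain ⟨π₀, hπ₀⟩ : ∃ π, π ∈ Pl := by
    have h1 : 1 < c.ncard := by rw [h.ncard_eq]; nlinarith
    obtain ⟨a, b, ha, hb, hab⟩ := (Set.one_lt_ncard_iff (Set.toFinite _)).mp h1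
    obtain ⟨W, hW, -⟩ := h.exists_plane a ha b hb hab
    exact ⟨W, hW⟩
  obtain ⟨z, hz⟩ := h.exists_partnerDirection hπ₀
  obtain ⟨σ₀, hσ₀⟩ : {ρ | IsPartner φ Pl π₀ ρ}.Nonempty :=
    (Set.ncard_pos (Set.toFinite _)).mp (by rw [(h.ncard_partner_eq_and hπ₀).1]; omega)
  have hσ₀' := hσ₀.symm hπ₀
  have hzσ := h.partnerDirection_of_partner hπ₀ hz hσ₀
  have key : ∀ π σ, IsPartner φ Pl σ₀ π → IsPartner φ Pl π₀ σ → IsPartner φ Pl π σ := by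
    intro π σ hπ hσ
    by_cases h1 : σ = σ₀
    · subst h1; exact hπ.symm hσ₀.1
    have hdσ : CDisjoint c σ₀ σ := h.partners_cDisjoint hπ₀ hσ₀ hσ (Ne.symm h1)
    obtain ⟨P, hP, hP₀, hPπ⟩ := h.partner_meets hσ₀.1 hπ
    have hPσ : P ∉ σ := hdσ P hP hP₀
    have hne : σ ≠ π := by rintro rfl; exact hPσ hPπ
    have hnd : ¬ CDisjoint c σ π := fun hd =>
      hπ.2.1 (h.parallel_unique hσ.1 hπ.1 hσ₀.1 hP hPπ hP₀ hPσ hd hdσ.symm)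
    unfold CDisjoint at hnd
    push Not at hnd
    obtain ⟨a, ha, haσ, haπ⟩ := hnd
    exact ⟨hσ.1, hne, a, z, h.affine a ha, haπ, haσ, hz.2.1, hz.1, hzσ.2.2.2 π hπ, hz.2.2.2 σ hσ⟩
  refine ⟨{π | IsPartner φ Pl σ₀ π}, {σ | IsPartner φ Pl π₀ σ}, z, hz.1, hz.2.1, fun π hπ => hπ.1,
    fun σ hσ => hσ.1, fun π hπ => hzσ.2.2.2 π hπ, fun σ hσ => hz.2.2.2 σ hσ, ?_, ?_,
    (h.ncard_partner_eq_and hσ₀.1).1, (h.ncard_partner_eq_and hπ₀).1⟩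
  · intro π hπ ρ
    have : {σ | IsPartner φ Pl π₀ σ} = {σ | IsPartner φ Pl π σ} :=
      Set.eq_of_subset_of_ncard_le (fun σ hσ => key π σ hπ hσ)
        (by rw [(h.ncard_partner_eq_and hπ₀).1, (h.ncard_partner_eq_and hπ.1).1])
    rw [this]; rfl
  · intro σ hσ ρ
    have : {π | IsPartner φ Pl σ₀ π} = {π | IsPartner φ Pl σ π} :=
      Set.eq_of_subset_of_ncard_le (fun π hπ => (key π σ hπ hσ).symm hπ.1)
        (by rw [(h.ncard_partner_eq_and hσ₀.1).1, (h.ncard_partner_eq_and hσ.1).1])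
    rw [this]; rfl

variable {P S : Set (Submodule K V)} {z : V}

theorem grid_meets (h : VectorConfig φ c Pl) (g : IsGrid φ Pl P S z) {π σ : Submodule K V}
    (hπ : π ∈ P) (hσ : σ ∈ S) : ∃ a ∈ c, a ∈ π ∧ a ∈ σ :=
  h.partner_meets (g.left_subset hπ) ((g.left_partner π hπ σ).mpr hσ)

theorem grid_cDisjoint (h : VectorConfig φ c Pl) (g : IsGrid φ Pl P S z) :
    P.Pairwise (CDisjoint c) := by
  have := h.finiteSubmodule
  have h7 := h.seven_le
  intro π hπ π' hπ' hne
  obtain ⟨σ, hσ⟩ : S.Nonempty :=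
    (Set.ncard_pos (Set.toFinite _)).mp (by rw [g.right_ncard]; omega)
  exact h.partners_cDisjoint (g.right_subset hσ) ((g.right_partner σ hσ π).mpr hπ)
    ((g.right_partner σ hσ π').mpr hπ') hne

theorem grid_exists_mem (h : VectorConfig φ c Pl) (g : IsGrid φ Pl P S z) {a : V} (ha : a ∈ c) :
    ∃ π ∈ P, a ∈ π :=
  h.exists_mem_of_ncard_eq g.left_subset (h.grid_cDisjoint g) g.left_ncard ha

theorem grid_eq_of_mem (h : VectorConfig φ c Pl) (g : IsGrid φ Pl P S z) {π π' : Submodule K V}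
    (hπ : π ∈ P) (hπ' : π' ∈ P) {v : V} (hv : φ v = 1) (hvπ : v ∈ π) (hvπ' : v ∈ π') :
    π = π' := by
  by_contra hne
  exact (h.ncard_partner_eq_and (g.left_subset hπ)).2 π' (g.left_subset hπ')
    (h.grid_cDisjoint g hπ hπ' hne) v hv hvπ hvπ'

/-- The planes of one family of a grid cover all affine points of the planes of the other. -/
theorem grid_cover (h : VectorConfig φ c Pl) (g : IsGrid φ Pl P S z) {π : Submodule K V}
    (hπ : π ∈ P) {v : V} (hv : φ v = 1) (hvπ : v ∈ π) : ∃ σ ∈ S, v ∈ σ := by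
  by_cases hvc : v ∈ c
  · exact h.grid_exists_mem g.swap hvc
  obtain ⟨W, hW, hWπ, hvW, -⟩ := h.two_planes v hv hvc π (g.left_subset hπ) hvπ
  refine ⟨W, (g.left_partner π hπ W).mp ⟨hW, hWπ, ?_⟩, hvW⟩
  have hnd : ¬ CDisjoint c π W := fun hd =>
    (h.ncard_partner_eq_and (g.left_subset hπ)).2 W hW hd v hv hvπ hvW
  unfold CDisjoint at hnd
  push Not at hnd
  obtain ⟨a, ha, haπ, haW⟩ := hnd
  refine ⟨v, a - v, hv, hvπ, hvW, by simp [h.affine a ha, hv], ?_, π.sub_mem haπ hvπ,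
    W.sub_mem haW hvW⟩
  rw [sub_ne_zero]
  rintro rfl
  exact hvc ha

end VectorConfig
end VectorModel

/-! ### Coordinates from a grid -/

section VectorModel

variable {K V : Type*} [Field K] [AddCommGroup V] [Module K V]

namespace VectorConfig

variable {φ : V →ₗ[K] K} {c : Set V} {Pl : Set (Submodule K V)} {P S : Set (Submodule K V)} {z : V}

theorem two_ne_zero (h : VectorConfig φ c Pl) : (2 : K) ≠ 0 := by
  have := h.finite
  have := Fintype.ofFinite K
  intro h2
  have h3 : ringChar K = 2 := CharP.ringChar_of_prime_eq_zero Nat.prime_two (by exact_mod_cast h2)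
  have h4 := FiniteField.even_card_iff_char_two.mp h3
  have h5 := h.odd
  rw [Nat.card_eq_fintype_card] at h5
  exact (Nat.not_odd_iff.mpr h4) h5

/-- If two planes of one family of a grid lay in a hyperplane, then so would all of `c`, and any
further plane of the configuration would meet them in lines. -/
theorem grid_not_le_ker (h : VectorConfig φ c Pl) (g : IsGrid φ Pl P S z) {π₁ π₂ : Submodule K V}
    (h₁ : π₁ ∈ P) (h₂ : π₂ ∈ P) (hne : π₁ ≠ π₂) {f : V →ₗ[K] K} (hf : f ≠ 0)
    (hf₁ : π₁ ≤ LinearMap.ker f) (hf₂ : π₂ ≤ LinearMap.ker f) : False := by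
  have := h.finiteV
  have := h.moduleFinite
  have h7 := h.seven_le
  have hc : ∀ a ∈ c, f a = 0 := by
    intro a ha
    obtain ⟨σ, hσ, haσ⟩ := h.grid_exists_mem g.swap ha
    obtain ⟨a₁, ha₁, ha₁π, ha₁σ⟩ := h.grid_meets g h₁ hσ
    obtain ⟨a₂, ha₂, ha₂π, ha₂σ⟩ := h.grid_meets g h₂ hσ
    obtain ⟨k, l, hkl⟩ := exists_eq_add_smul_of_finrank_three
      (h.finrank_plane σ (g.right_subset hσ)) ha₁σ (g.right_mem σ hσ) (σ.sub_mem ha₂σ ha₁σ)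
      (h.affine a₁ ha₁) g.map_eq_zero
      (by rw [map_sub, h.affine a₁ ha₁, h.affine a₂ ha₂, sub_self]) g.ne_zero (by
        intro k hk
        refine hne (h.grid_eq_of_mem g h₁ h₂ (h.affine a₂ ha₂) ?_ ha₂π)
        rw [← sub_add_cancel a₂ a₁, hk]
        exact π₁.add_mem (π₁.smul_mem _ (g.left_mem π₁ h₁)) ha₁π) a haσ
    have e1 : f a₁ = 0 := hf₁ ha₁π
    have e2 : f a₂ = 0 := hf₂ ha₂π
    have e3 : f z = 0 := hf₁ (g.left_mem π₁ h₁)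
    rw [hkl]
    simp [e1, e2, e3]
  obtain ⟨A, hA, hAπ⟩ : (c ∩ π₁).Nonempty := by
    refine (Set.ncard_pos (Set.toFinite _)).mp ?_
    rw [h.ncard_plane π₁ (g.left_subset h₁)]; omega
  obtain ⟨σ, hσ, hAσ⟩ := h.grid_exists_mem g.swap hA
  obtain ⟨B, hB, hBn⟩ : (c \ ((c ∩ π₁) ∪ (c ∩ σ))).Nonempty := by
    refine (Set.ncard_pos (Set.toFinite _)).mp ?_
    have e1 := Set.le_ncard_sdiff ((c ∩ π₁) ∪ (c ∩ σ)) c (Set.toFinite _)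
    have e2 := Set.ncard_union_le (c ∩ π₁) (c ∩ σ)
    rw [h.ncard_plane π₁ (g.left_subset h₁), h.ncard_plane σ (g.right_subset hσ)] at e2
    rw [h.ncard_eq] at e1
    have e3 : Nat.card K + Nat.card K < Nat.card K ^ 2 := by nlinarith
    omega
  have hBπ : B ∉ π₁ := fun hh => hBn (Or.inl ⟨hB, hh⟩)
  have hBσ : B ∉ σ := fun hh => hBn (Or.inr ⟨hB, hh⟩)
  have hAB : A ≠ B := by rintro rfl; exact hBπ hAπ
  obtain ⟨τ, hτ, hAτ, hBτ⟩ := h.exists_plane A hA B hB hAB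
  obtain ⟨D, ⟨hD, hDτ⟩, hDn⟩ : ((c ∩ τ) \ {A, B}).Nonempty := by
    refine (Set.ncard_pos (Set.toFinite _)).mp ?_
    have e1 := Set.le_ncard_sdiff {A, B} (c ∩ τ) (Set.toFinite _)
    have e2 := Set.ncard_insert_le A {B}
    rw [Set.ncard_singleton] at e2
    rw [h.ncard_plane τ hτ] at e1
    omega
  have hτf : τ ≤ LinearMap.ker f := by
    intro w hw
    obtain ⟨k, l, hkl⟩ := exists_eq_add_smul_of_finrank_three
      (h.finrank_plane τ hτ) hAτ (τ.sub_mem hBτ hAτ) (τ.sub_mem hDτ hAτ)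
      (h.affine A hA) (by rw [map_sub, h.affine A hA, h.affine B hB, sub_self])
      (by rw [map_sub, h.affine A hA, h.affine D hD, sub_self]) (sub_ne_zero.mpr hAB.symm) (by
        intro k hk
        rcases h.arc A hA B hB D hD hAB k hk with rfl | rfl <;> exact hDn (by simp)) w hw
    rw [LinearMap.mem_ker, hkl]
    simp [hc A hA, hc B hB, hc D hD]
  have hinf : 2 ≤ Module.finrank K ↥(τ ⊓ π₁) := by
    have e1 := Submodule.finrank_sup_add_finrank_inf_eq τ π₁
    rw [h.finrank_plane τ hτ, h.finrank_plane π₁ (g.left_subset h₁)] at e1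
    have e2 := Submodule.finrank_mono (sup_le hτf hf₁)
    have e3 : Module.finrank K (LinearMap.ker f) < Module.finrank K V := by
      refine Submodule.finrank_lt ?_
      intro htop
      exact hf (LinearMap.ker_eq_top.mp htop)
    rw [h.finrank_eq] at e3
    omega
  obtain ⟨w, hw, hwA⟩ : ∃ w ∈ τ ⊓ π₁, ∀ k : K, w ≠ k • A := by
    by_contra hno
    push Not at hno
    have hle : τ ⊓ π₁ ≤ Submodule.span K {A} := by
      intro w hw
      obtain ⟨k, hk⟩ := hno w hw
      exact Submodule.mem_span_singleton.mpr ⟨k, hk.symm⟩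
    have e1 := Submodule.finrank_mono hle
    have e2 := finrank_span_le_card (R := K) ({A} : Set V)
    simp at e2
    omega
  have hτS : τ ∈ S := by
    rw [← g.left_partner π₁ h₁]
    refine ⟨hτ, by rintro rfl; exact hBπ hBτ, A, w - φ w • A, h.affine A hA, hAπ, hAτ, ?_, ?_,
      π₁.sub_mem hw.2 (π₁.smul_mem _ hAπ), τ.sub_mem hw.1 (τ.smul_mem _ hAτ)⟩
    · simp [h.affine A hA]
    · exact sub_ne_zero.mpr (hwA _)
  exact hBσ (h.grid_eq_of_mem g.swap hτS hσ (h.affine A hA) hAτ hAσ ▸ hBτ)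

/-- The planes of one family of a grid are the intersections of the planes' span with parallel
hyperplanes: some functional is constant on the affine points of each of them and separates
them. Modulo `z` the grid consists of the two families of lines of a hyperbolic paraboloid. -/
theorem exists_grid_functional (h : VectorConfig φ c Pl) (g : IsGrid φ Pl P S z) :
    ∃ x : V →ₗ[K] K, (∀ π ∈ P, ∀ u ∈ π, φ u = 0 → x u = 0) ∧
      ∀ π ∈ P, ∀ π' ∈ P, ∀ a ∈ π, ∀ a' ∈ π', φ a = 1 → φ a' = 1 → x a = x a' → π = π' := by
  have := h.moduleFinite
  have := h.finiteV
  have := h.finiteSubmodule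
  have h7 := h.seven_le
  obtain ⟨π₁, π₂, h₁, h₂, hne⟩ := (Set.one_lt_ncard_iff (Set.toFinite P)).mp
    (by rw [g.left_ncard]; omega)
  have hlt : π₁ ⊔ (π₂ ⊓ LinearMap.ker φ) < ⊤ := by
    rw [lt_top_iff_ne_top]
    intro htop
    have e1 := Submodule.finrank_sup_add_finrank_inf_eq π₁ (π₂ ⊓ LinearMap.ker φ)
    rw [htop, finrank_top, h.finrank_eq, h.finrank_plane π₁ (g.left_subset h₁),
      h.finrank_inf_ker (g.left_subset h₂)] at e1
    have e2 : π₁ ⊓ (π₂ ⊓ LinearMap.ker φ) = ⊥ := Submodule.finrank_eq_zero.mp (by omega)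
    have e3 : z ∈ π₁ ⊓ (π₂ ⊓ LinearMap.ker φ) :=
      ⟨g.left_mem π₁ h₁, g.left_mem π₂ h₂, g.map_eq_zero⟩
    rw [e2] at e3
    exact g.ne_zero e3
  obtain ⟨x, hx0, hx⟩ := Submodule.exists_le_ker_of_lt_top _ hlt
  have hx₁ : ∀ v ∈ π₁, x v = 0 := fun v hv => hx (Submodule.mem_sup_left hv)
  have hx₂ : ∀ v ∈ π₂, φ v = 0 → x v = 0 := fun v hv hv0 => hx (Submodule.mem_sup_right ⟨hv, hv0⟩)
  have hx₂' : ∀ v ∈ π₂, φ v = 1 → x v ≠ 0 := by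
    intro v hv hv1 hxv
    refine h.grid_not_le_ker g h₁ h₂ hne hx0 hx₁ fun w hw => ?_
    have h3 := hx₂ (w - φ w • v) (π₂.sub_mem hw (π₂.smul_mem _ hv)) (by simp [hv1])
    rwa [map_sub, map_smul, hxv, smul_zero, sub_zero] at h3
  have hxz : x z = 0 := hx₁ z (g.left_mem π₁ h₁)
  -- On a plane of the other family two affine points with the same value of `x` differ by a
  -- multiple of `z`.
  have hS : ∀ σ ∈ S, ∀ v ∈ σ, ∀ w ∈ σ, φ v = 1 → φ w = 1 → x v = x w → ∃ k : K, w = v + k • z := by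
    intro σ hσ v hv w hw hv1 hw1 hvw
    obtain ⟨a₁, ha₁, ha₁π, ha₁σ⟩ := h.grid_meets g h₁ hσ
    obtain ⟨a₂, ha₂, ha₂π, ha₂σ⟩ := h.grid_meets g h₂ hσ
    have hd : x (a₂ - a₁) ≠ 0 := by
      rw [map_sub, hx₁ a₁ ha₁π, sub_zero]
      exact hx₂' a₂ ha₂π (h.affine a₂ ha₂)
    obtain ⟨k, l, hkl⟩ := exists_eq_add_smul_of_finrank_three
      (h.finrank_plane σ (g.right_subset hσ)) hv (g.right_mem σ hσ) (σ.sub_mem ha₂σ ha₁σ)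
      hv1 g.map_eq_zero (by rw [map_sub, h.affine a₁ ha₁, h.affine a₂ ha₂, sub_self]) g.ne_zero (by
        intro k hk
        rw [hk, map_smul, hxz, smul_zero] at hd
        exact hd rfl) w hw
    rw [hw1, one_smul] at hkl
    have h3 := congrArg x hkl
    rw [map_add, map_add, map_smul, map_smul, hxz, hvw, smul_zero, add_zero, left_eq_add,
      smul_eq_mul, mul_eq_zero] at h3
    refine ⟨k, ?_⟩
    rw [hkl, h3.resolve_right hd, zero_smul, add_zero]
  have hconst : ∀ π ∈ P, ∀ u ∈ π, φ u = 0 → x u = 0 := by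
    intro π hπ u hu hu0
    by_contra hxu
    obtain ⟨o, ho, ho1⟩ := h.exists_affine π (g.left_subset hπ)
    have hv : o - (x o / x u) • u ∈ π := π.sub_mem ho (π.smul_mem _ hu)
    have hv1 : φ (o - (x o / x u) • u) = 1 := by simp [ho1, hu0]
    have hxv : x (o - (x o / x u) • u) = 0 := by
      rw [map_sub, map_smul, smul_eq_mul, div_mul_cancel₀ _ hxu, sub_self]
    obtain ⟨σ, hσ, hvσ⟩ := h.grid_cover g hπ hv1 hv
    obtain ⟨a₁, ha₁, ha₁π, ha₁σ⟩ := h.grid_meets g h₁ hσ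
    obtain ⟨k, hk⟩ := hS σ hσ a₁ ha₁σ _ hvσ (h.affine a₁ ha₁) hv1 (by rw [hxv, hx₁ a₁ ha₁π])
    have h3 : o - (x o / x u) • u ∈ π₁ := by
      rw [hk]
      exact π₁.add_mem ha₁π (π₁.smul_mem _ (g.left_mem π₁ h₁))
    have h4 := h.grid_eq_of_mem g hπ h₁ hv1 hv h3
    subst h4
    exact hxu (hx₁ u hu)
  refine ⟨x, hconst, ?_⟩
  intro π hπ π' hπ' a ha a' ha' ha1 ha1' haa
  obtain ⟨σ, hσ⟩ : S.Nonempty :=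
    (Set.ncard_pos (Set.toFinite _)).mp (by rw [g.right_ncard]; omega)
  obtain ⟨p, hp, hpπ, hpσ⟩ := h.grid_meets g hπ hσ
  obtain ⟨p', hp', hpπ', hpσ'⟩ := h.grid_meets g hπ' hσ
  have h1 := hconst π hπ (p - a) (π.sub_mem hpπ ha) (by rw [map_sub, h.affine p hp, ha1, sub_self])
  have h2 := hconst π' hπ' (p' - a') (π'.sub_mem hpπ' ha')
    (by rw [map_sub, h.affine p' hp', ha1', sub_self])
  rw [map_sub, sub_eq_zero] at h1 h2
  obtain ⟨k, hk⟩ := hS σ hσ p hpσ p' hpσ' (h.affine p hp) (h.affine p' hp') (by rw [h1, h2, haa])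
  refine h.grid_eq_of_mem g hπ hπ' (h.affine p' hp') ?_ hpπ'
  rw [hk]
  exact π.add_mem hpπ (π.smul_mem _ (g.left_mem π hπ))

/-- The functional of a family of a grid is injective on `c ∩ τ` for each plane `τ` of the
configuration outside the family. -/
theorem grid_functional_injOn (h : VectorConfig φ c Pl) (g : IsGrid φ Pl P S z) {x : V →ₗ[K] K}
    (hx : ∀ π ∈ P, ∀ π' ∈ P, ∀ a ∈ π, ∀ a' ∈ π', φ a = 1 → φ a' = 1 → x a = x a' → π = π')
    {τ : Submodule K V} (hτ : τ ∈ Pl) (hτP : τ ∉ P) : Set.InjOn x (c ∩ τ) := by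
  rintro a ⟨ha, haτ⟩ b ⟨hb, hbτ⟩ hab
  obtain ⟨π, hπ, haπ⟩ := h.grid_exists_mem g ha
  obtain ⟨π', hπ', hbπ⟩ := h.grid_exists_mem g hb
  have h1 := hx π hπ π' hπ' a haπ b hbπ (h.affine a ha) (h.affine b hb) hab
  subst h1
  exact h.eq_of_mem (g.left_subset hπ) hτ (by rintro rfl; exact hτP hπ) ha hb haπ haτ hbπ hbτ

/-- If two functionals are injective on `c ∩ τ` then they have a common zero among the directions
of the plane `τ`. Otherwise `c ∩ τ` would be the graph of a permutation in the coordinates that they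
define on `τ`. -/
theorem exists_common_zero (h : VectorConfig φ c Pl) {τ : Submodule K V} (hτ : τ ∈ Pl)
    {x y : V →ₗ[K] K} (hx : Set.InjOn x (c ∩ τ)) (hy : Set.InjOn y (c ∩ τ)) :
    ∃ w ∈ τ, w ≠ 0 ∧ φ w = 0 ∧ x w = 0 ∧ y w = 0 := by
  classical
  have := h.finite
  have := h.finiteV
  have := Fintype.ofFinite K
  by_contra hcon
  push Not at hcon
  have hzero : ∀ w ∈ τ, φ w = 0 → x w = 0 → y w = 0 → w = 0 := by
    intro w hw h1 h2 h3
    by_contra hw0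
    exact hcon w hw hw0 h1 h2 h3
  have himg : x '' (c ∩ τ) = Set.univ := by
    refine Set.eq_of_subset_of_ncard_le (Set.subset_univ _) ?_
    rw [hx.ncard_image, Set.ncard_univ, h.ncard_plane τ hτ]
  have hex : ∀ t : K, ∃ a ∈ c ∩ (τ : Set V), x a = t := by
    intro t
    have : t ∈ x '' (c ∩ τ) := by rw [himg]; trivial
    exact this
  choose p hp hpx using hex
  have hpinj : ∀ s t, p s = p t → s = t := fun s t hst => by rw [← hpx s, ← hpx t, hst]
  refine not_injective_of_injOn_chordSlope h.two_ne_zero (g := fun t => y (p t)) ?_ ?_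
  · intro s t hst
    exact hpinj s t (hy (hp s) (hp t) hst)
  · intro s hs t ht hst
    have hs0 : s ≠ 0 := hs
    have ht0 : t ≠ 0 := ht
    unfold chordSlope at hst
    rw [sub_zero, sub_zero, div_eq_div_iff hs0 ht0] at hst
    have hd : ∀ r, φ (p r - p 0) = 0 := fun r => by
      rw [map_sub, h.affine _ (hp r).1, h.affine _ (hp 0).1, sub_self]
    have hw := hzero (s • (p t - p 0) - t • (p s - p 0))
      (τ.sub_mem (τ.smul_mem _ (τ.sub_mem (hp t).2 (hp 0).2))
        (τ.smul_mem _ (τ.sub_mem (hp s).2 (hp 0).2)))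
      (by rw [map_sub, map_smul, map_smul, hd, hd, smul_zero, smul_zero, sub_zero])
      (by simp only [map_sub, map_smul, hpx, smul_eq_mul]; ring)
      (by simp only [map_sub, map_smul, smul_eq_mul]; linear_combination -hst)
    have hk : p t - p 0 = (t / s) • (p s - p 0) := by
      rw [div_eq_inv_mul, mul_smul, ← sub_eq_zero.mp hw, smul_smul, inv_mul_cancel₀ hs0, one_smul]
    rcases h.arc _ (hp 0).1 _ (hp s).1 _ (hp t).1 (fun h0 => hs0 (hpinj _ _ h0).symm) _ hk with
      h' | h'
    · exact absurd (hpinj _ _ h') ht0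
    · exact (hpinj _ _ h').symm

/-- There are two functionals `x` and `y` that separate the points of `c` and of which the common
zeros at infinity form a line meeting all planes of the configuration. -/
theorem exists_coordinates (h : VectorConfig φ c Pl) :
    ∃ x y : V →ₗ[K] K, (∀ a ∈ c, ∀ b ∈ c, x a = x b → y a = y b → a = b) ∧
      ∀ τ ∈ Pl, ∃ w ∈ τ, w ≠ 0 ∧ φ w = 0 ∧ x w = 0 ∧ y w = 0 := by
  have := h.finiteSubmodule
  have h7 := h.seven_le
  obtain ⟨P, S, z, g⟩ := h.exists_isGrid
  obtain ⟨x, hx, hx'⟩ := h.exists_grid_functional g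
  obtain ⟨y, hy, hy'⟩ := h.exists_grid_functional g.swap
  refine ⟨x, y, ?_, ?_⟩
  · intro a ha b hb hab hab'
    obtain ⟨π, hπ, haπ⟩ := h.grid_exists_mem g ha
    obtain ⟨π', hπ', hbπ⟩ := h.grid_exists_mem g hb
    obtain ⟨σ, hσ, haσ⟩ := h.grid_exists_mem g.swap ha
    obtain ⟨σ', hσ', hbσ⟩ := h.grid_exists_mem g.swap hb
    have h1 := hx' π hπ π' hπ' a haπ b hbπ (h.affine a ha) (h.affine b hb) hab
    have h2 := hy' σ hσ σ' hσ' a haσ b hbσ (h.affine a ha) (h.affine b hb) hab'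
    subst h1 h2
    exact h.eq_of_mem (g.left_subset hπ) (g.right_subset hσ)
      (((g.left_partner π hπ σ).mpr hσ).2.1.symm) ha hb haπ haσ hbπ hbσ
  · intro τ hτ
    obtain ⟨π, hπ⟩ : P.Nonempty :=
      (Set.ncard_pos (Set.toFinite _)).mp (by rw [g.left_ncard]; omega)
    obtain ⟨σ, hσ⟩ : S.Nonempty :=
      (Set.ncard_pos (Set.toFinite _)).mp (by rw [g.right_ncard]; omega)
    have hz := g.map_eq_zero
    have hxz := hx π hπ z (g.left_mem π hπ) hz
    have hyz := hy σ hσ z (g.right_mem σ hσ) hz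
    by_cases h1 : τ ∈ P
    · exact ⟨z, g.left_mem τ h1, g.ne_zero, hz, hxz, hyz⟩
    by_cases h2 : τ ∈ S
    · exact ⟨z, g.right_mem τ h2, g.ne_zero, hz, hxz, hyz⟩
    exact h.exists_common_zero hτ (h.grid_functional_injOn g hx' hτ h1)
      (h.grid_functional_injOn g.swap hy' hτ h2)

end VectorConfig
end VectorModel

/-! ### The configuration as a quadratic graph -/

section VectorModel

variable {K V : Type*} [Field K] [AddCommGroup V] [Module K V]

/-- The normal form of the configuration: after choosing an affine point `o` as origin, `c` is the
graph `{o + Λ u + B u u}` of a quadratic map, with `ξ` the projection to the parameter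
space `U`. The values of the symmetric bilinear map `B` lie in the intersection of the kernels of `φ`
and `ξ`. -/
structure IsQuadraticGraph {U : Type*} [AddCommGroup U] [Module K U] (φ : V →ₗ[K] K)
    (ξ : V →ₗ[K] U) (o : V) (Λ : U →ₗ[K] V) (B : U →ₗ[K] U →ₗ[K] V) (c : Set V) : Prop where
  finrank_eq : Module.finrank K U = 2
  map_origin : φ o = 1
  proj_origin : ξ o = 0
  map_section : ∀ u, φ (Λ u) = 0
  proj_section : ∀ u, ξ (Λ u) = u
  map_bilin : ∀ u v, φ (B u v) = 0
  proj_bilin : ∀ u v, ξ (B u v) = 0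
  bilin_comm : ∀ u v, B u v = B v u
  mem_iff : ∀ v, v ∈ c ↔ ∃ u, v = o + Λ u + B u u

namespace VectorConfig

variable {φ : V →ₗ[K] K} {c : Set V} {Pl : Set (Submodule K V)}

/-- Along an affine line of the parameter plane the point of `c` is a quadratic function of the
parameter: the points form an arc in a plane of the configuration, to which Segre's theorem
applies. -/
theorem exists_quadratic_on_line (h : VectorConfig φ c Pl) {x y : V →ₗ[K] K}
    (hτ : ∀ τ ∈ Pl, ∃ w ∈ τ, w ≠ 0 ∧ φ w = 0 ∧ x w = 0 ∧ y w = 0) {s : K → K → V}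
    (hs : ∀ a b, s a b ∈ c) (hsx : ∀ a b, x (s a b) = a) (hsy : ∀ a b, y (s a b) = b)
    (hs' : ∀ v ∈ c, s (x v) (y v) = v) (a₁ a₂ b₁ b₂ : K) (hb : b₁ ≠ 0 ∨ b₂ ≠ 0) :
    ∃ v w : V, ∀ t : K, s (a₁ + t * b₁) (a₂ + t * b₂) = s a₁ a₂ + t • v + t ^ 2 • w := by
  classical
  have := h.finite
  have := h.finiteV
  have := Fintype.ofFinite K
  have hinj : ∀ t t' : K, s (a₁ + t * b₁) (a₂ + t * b₂) = s (a₁ + t' * b₁) (a₂ + t' * b₂) →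
      t = t' := by
    intro t t' htt
    have h1 := congrArg x htt
    have h2 := congrArg y htt
    rw [hsx, hsx] at h1
    rw [hsy, hsy] at h2
    rcases hb with hb | hb
    · exact mul_right_cancel₀ hb (add_left_cancel h1)
    · exact mul_right_cancel₀ hb (add_left_cancel h2)
  have hne : s a₁ a₂ ≠ s (a₁ + b₁) (a₂ + b₂) := by
    intro he
    have := hinj 0 1 (by simpa using he)
    exact zero_ne_one this
  obtain ⟨τ, hτPl, h0τ, h1τ⟩ := h.exists_plane _ (hs a₁ a₂) _ (hs (a₁ + b₁) (a₂ + b₂)) hne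
  obtain ⟨w, hwτ, hw0, hwφ, hwx, hwy⟩ := hτ τ hτPl
  set d := s (a₁ + b₁) (a₂ + b₂) - s a₁ a₂ with hd
  have hdx : x d = b₁ := by rw [hd, map_sub, hsx, hsx]; ring
  have hdy : y d = b₂ := by rw [hd, map_sub, hsy, hsy]; ring
  have hdφ : φ d = 0 := by rw [hd, map_sub, h.affine _ (hs _ _), h.affine _ (hs _ _), sub_self]
  have hdτ : d ∈ τ := τ.sub_mem h1τ h0τ
  have hcoord : ∀ v ∈ c, v ∈ τ → ∃ t k : K, v = s a₁ a₂ + t • d + k • w ∧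
      v = s (a₁ + t * b₁) (a₂ + t * b₂) := by
    intro v hv hvτ
    obtain ⟨k, t, hkt⟩ := exists_eq_add_smul_of_finrank_three (h.finrank_plane τ hτPl) h0τ hwτ hdτ
      (h.affine _ (hs _ _)) hwφ hdφ hw0 (by
        intro k hk
        rcases hb with hb | hb
        · exact hb (by rw [← hdx, hk, map_smul, hwx, smul_zero])
        · exact hb (by rw [← hdy, hk, map_smul, hwy, smul_zero])) v hvτ
    rw [h.affine v hv, one_smul] at hkt
    refine ⟨t, k, by rw [hkt]; abel, ?_⟩
    have h1 : x v = a₁ + t * b₁ := by rw [hkt]; simp [hsx, hwx, hdx]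
    have h2 : y v = a₂ + t * b₂ := by rw [hkt]; simp [hsy, hwy, hdy]
    rw [← h1, ← h2, hs' v hv]
  choose! t k hk ht using hcoord
  -- As `τ` contains `q` points of `c`, all points over the line of the parameter plane lie in `τ`.
  have himg : t '' (c ∩ τ) = Set.univ := by
    refine Set.eq_of_subset_of_ncard_le (Set.subset_univ _) ?_
    rw [Set.InjOn.ncard_image, Set.ncard_univ, h.ncard_plane τ hτPl]
    rintro v ⟨hv, hvτ⟩ v' ⟨hv', hvτ'⟩ htt
    rw [ht v hv hvτ, ht v' hv' hvτ', htt]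
  have hall : ∀ r : K, ∃ k : K, s (a₁ + r * b₁) (a₂ + r * b₂) = s a₁ a₂ + r • d + k • w := by
    intro r
    have : r ∈ t '' (c ∩ τ) := by rw [himg]; trivial
    obtain ⟨v, ⟨hv, hvτ⟩, rfl⟩ := this
    exact ⟨k v, (ht v hv hvτ).symm.trans (hk v hv hvτ)⟩
  choose g hg using hall
  have harc : ∀ r, Set.InjOn (chordSlope g r) {r}ᶜ := by
    intro r r₁ h₁ r₂ h₂ heq
    have h₁' : r₁ - r ≠ 0 := sub_ne_zero.mpr h₁
    have h₂' : r₂ - r ≠ 0 := sub_ne_zero.mpr h₂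
    have e1 : g r₁ - g r = chordSlope g r r₁ * (r₁ - r) := (div_mul_cancel₀ _ h₁').symm
    have e2 : g r₂ - g r = chordSlope g r r₁ * (r₂ - r) := by
      rw [heq]; exact (div_mul_cancel₀ _ h₂').symm
    have e3 : ∀ i, g i - g r = chordSlope g r r₁ * (i - r) →
        s (a₁ + i * b₁) (a₂ + i * b₂) - s (a₁ + r * b₁) (a₂ + r * b₂) =
        (i - r) • (d + chordSlope g r r₁ • w) := by
      intro i hi
      rw [hg, hg, sub_eq_iff_eq_add.mp hi]
      module
    have e4 : s (a₁ + r₂ * b₁) (a₂ + r₂ * b₂) - s (a₁ + r * b₁) (a₂ + r * b₂) =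
        ((r₂ - r) / (r₁ - r)) •
          (s (a₁ + r₁ * b₁) (a₂ + r₁ * b₂) - s (a₁ + r * b₁) (a₂ + r * b₂)) := by
      rw [e3 r₁ e1, e3 r₂ e2, smul_smul, div_mul_cancel₀ _ h₁']
    rcases h.arc _ (hs _ _) _ (hs _ _) _ (hs _ _) (fun he => h₁ (hinj _ _ he).symm) _ e4 with h' | h'
    · exact absurd (hinj _ _ h') h₂
    · exact (hinj _ _ h').symm
  obtain ⟨α, β, hαβ⟩ := exists_quadratic_of_injOn_chordSlope h.two_ne_zero harc
  have hg0 : g 0 • w = 0 := by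
    have := hg 0
    simpa using this
  refine ⟨d + β • w, α • w, fun r => ?_⟩
  rw [hg r, hαβ r]
  linear_combination (norm := module) hg0

end VectorConfig

/-- A map of two variables that is quadratic along the lines `u = const` and `v = const` and along
the diagonals `u = ± v` is a quadratic polynomial map. -/
theorem exists_quadratic_polynomial [Finite K] (hK : 4 < Nat.card K) (h2 : (2 : K) ≠ 0)
    {s : K → K → V}
    (hs : ∀ a₁ a₂ b₁ b₂ : K, (b₁ ≠ 0 ∨ b₂ ≠ 0) →
      ∃ v w : V, ∀ t : K, s (a₁ + t * b₁) (a₂ + t * b₂) = s a₁ a₂ + t • v + t ^ 2 • w) :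
    ∃ n₀ n₁ n₂ n₁₁ n₁₂ n₂₂ : V, ∀ u v : K, s u v =
      n₀ + u • n₁ + v • n₂ + (u ^ 2) • n₁₁ + (u * v) • n₁₂ + (v ^ 2) • n₂₂ := by
  have hrow : ∀ v, ∃ p r : V, ∀ t : K, s t v = s 0 v + t • p + t ^ 2 • r := by
    intro v
    obtain ⟨p, r, hpr⟩ := hs 0 v 1 0 (Or.inl one_ne_zero)
    exact ⟨p, r, fun t => by simpa using hpr t⟩
  have hcol : ∀ u, ∃ p r : V, ∀ t : K, s u t = s u 0 + t • p + t ^ 2 • r := by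
    intro u
    obtain ⟨p, r, hpr⟩ := hs u 0 0 1 (Or.inr one_ne_zero)
    exact ⟨p, r, fun t => by simpa using hpr t⟩
  choose p r hpr using hrow
  obtain ⟨a₁, a₂, ha⟩ := hcol 0
  obtain ⟨b₁, b₂, hb⟩ := hcol 1
  obtain ⟨c₁, c₂, hc⟩ := hcol (-1)
  have hp : ∀ v, (2 : K) • p v = s 1 v - s (-1) v := by
    intro v
    rw [hpr v 1, hpr v (-1)]
    module
  have hr : ∀ v, (2 : K) • r v = s 1 v + s (-1) v - (2 : K) • s 0 v := by
    intro v
    rw [hpr v 1, hpr v (-1)]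
    module
  have hbi : ∀ u v : K, (2 : K) • s u v = (2 : K) • (s 0 0 + v • a₁ + v ^ 2 • a₂) +
      u • ((s 1 0 - s (-1) 0) + v • (b₁ - c₁) + v ^ 2 • (b₂ - c₂)) +
      u ^ 2 • ((s 1 0 + s (-1) 0 - (2 : K) • s 0 0) + v • (b₁ + c₁ - (2 : K) • a₁) +
        v ^ 2 • (b₂ + c₂ - (2 : K) • a₂)) := by
    intro u v
    have h1 : (2 : K) • s u v = (2 : K) • s 0 v + u • ((2 : K) • p v) + u ^ 2 • ((2 : K) • r v) := by
      rw [hpr v u]; module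
    rw [h1, hp, hr, ha v, hb v, hc v]
    module
  obtain ⟨d₁, d₂, hd⟩ := hs 0 0 1 1 (Or.inl one_ne_zero)
  obtain ⟨e₁, e₂, he⟩ := hs 0 0 1 (-1) (Or.inl one_ne_zero)
  -- The terms of degree three and four vanish on the diagonals.
  have hdiag := coeff_eq_zero_of_forall_quartic hK (v₀ := (0 : V))
    (v₁ := (2 : K) • a₁ + (s 1 0 - s (-1) 0) - (2 : K) • d₁)
    (v₂ := (2 : K) • a₂ + (b₁ - c₁) + (s 1 0 + s (-1) 0 - (2 : K) • s 0 0) - (2 : K) • d₂)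
    (v₃ := (b₂ - c₂) + (b₁ + c₁ - (2 : K) • a₁)) (v₄ := b₂ + c₂ - (2 : K) • a₂) (by
      intro t
      have h1 := hd t
      rw [mul_one, zero_add] at h1
      have h3 := hbi t t
      rw [h1] at h3
      linear_combination (norm := module) -h3)
  have hanti := coeff_eq_zero_of_forall_quartic hK (v₀ := (0 : V))
    (v₁ := (-2 : K) • a₁ + (s 1 0 - s (-1) 0) - (2 : K) • e₁)
    (v₂ := (2 : K) • a₂ - (b₁ - c₁) + (s 1 0 + s (-1) 0 - (2 : K) • s 0 0) - (2 : K) • e₂)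
    (v₃ := (b₂ - c₂) - (b₁ + c₁ - (2 : K) • a₁)) (v₄ := b₂ + c₂ - (2 : K) • a₂) (by
      intro t
      have h1 := he t
      rw [mul_one, zero_add, zero_add, mul_neg, mul_one] at h1
      have h3 := hbi t (-t)
      rw [h1] at h3
      linear_combination (norm := module) -h3)
  obtain ⟨-, -, -, h3, h4⟩ := hdiag
  obtain ⟨-, -, -, h3', -⟩ := hanti
  have hb3 : b₂ - c₂ = 0 := by
    have : (2 : K) • (b₂ - c₂) = 0 := by linear_combination (norm := module) h3 + h3'
    exact (smul_eq_zero.mp this).resolve_left h2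
  have hb4 : b₁ + c₁ - (2 : K) • a₁ = 0 := by rwa [hb3, zero_add] at h3
  have hhalf : ∀ v : V, (2 : K) • ((2 : K)⁻¹ • v) = v := fun v => by
    rw [smul_smul, mul_inv_cancel₀ h2, one_smul]
  refine ⟨s 0 0, (2 : K)⁻¹ • (s 1 0 - s (-1) 0), a₁,
    (2 : K)⁻¹ • (s 1 0 + s (-1) 0 - (2 : K) • s 0 0), (2 : K)⁻¹ • (b₁ - c₁), a₂, fun u v => ?_⟩
  have h5 := hbi u v
  rw [hb3, hb4, h4] at h5
  have hcancel : ∀ v w : V, (2 : K) • v = (2 : K) • w → v = w := fun v w hvw => by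
    have := congrArg (fun x => (2 : K)⁻¹ • x) hvw
    simpa only [smul_smul, inv_mul_cancel₀ h2, one_smul] using this
  apply hcancel
  rw [h5]
  have g1 := hhalf (s 1 0 - s (-1) 0)
  have g2 := hhalf (s 1 0 + s (-1) 0 - (2 : K) • s 0 0)
  have g3 := hhalf (b₁ - c₁)
  linear_combination (norm := module) -u • g1 - (u ^ 2) • g2 - (u * v) • g3

/-- The coefficients of the composition of a quadratic polynomial map with an affine functional. -/
theorem coeff_of_affine_functional [Finite K] (hK : 4 < Nat.card K)
    {n₀ n₁ n₂ n₁₁ n₁₂ n₂₂ : V} {f : V →ₗ[K] K} {α β γ : K}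
    (h : ∀ u v : K, f (n₀ + u • n₁ + v • n₂ + (u ^ 2) • n₁₁ + (u * v) • n₁₂ + (v ^ 2) • n₂₂) =
      α + u * β + v * γ) :
    f n₀ = α ∧ f n₁ = β ∧ f n₂ = γ ∧ f n₁₁ = 0 ∧ f n₁₂ = 0 ∧ f n₂₂ = 0 := by
  simp only [map_add, map_smul, smul_eq_mul] at h
  have h1 := coeff_eq_zero_of_forall_quartic hK (v₀ := f n₀ - α) (v₁ := f n₁ - β) (v₂ := f n₁₁)
    (v₃ := 0) (v₄ := 0) (by
      intro t
      have := h t 0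
      simp only [smul_eq_mul]
      linear_combination this)
  have h2 := coeff_eq_zero_of_forall_quartic hK (v₀ := f n₀ - α) (v₁ := f n₂ - γ) (v₂ := f n₂₂)
    (v₃ := 0) (v₄ := 0) (by
      intro t
      have := h 0 t
      simp only [smul_eq_mul]
      linear_combination this)
  obtain ⟨e1, e2, e3, -⟩ := h1
  obtain ⟨-, e4, e5, -⟩ := h2
  refine ⟨sub_eq_zero.mp e1, sub_eq_zero.mp e2, sub_eq_zero.mp e4, e3, ?_, e5⟩
  have := h 1 1
  linear_combination this - e1 - e2 - e3 - e4 - e5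

namespace VectorConfig

variable {φ : V →ₗ[K] K} {c : Set V} {Pl : Set (Submodule K V)}

/-- In the coordinates given by a grid the set `c` is the graph of a map on `K × K` which is quadratic
along every affine line, hence of a quadratic polynomial map. -/
theorem exists_isQuadraticGraph (h : VectorConfig φ c Pl) :
    ∃ (ξ : V →ₗ[K] K × K) (o : V) (Λ : K × K →ₗ[K] V) (B : K × K →ₗ[K] K × K →ₗ[K] V),
      IsQuadraticGraph φ ξ o Λ B c := by
  classical
  have := h.finite
  have := h.finiteV
  have h7 := h.seven_le
  have h2 := h.two_ne_zero
  obtain ⟨x, y, hxy, hτ⟩ := h.exists_coordinates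
  have himg : (fun v => (x v, y v)) '' c = Set.univ := by
    refine Set.eq_of_subset_of_ncard_le (Set.subset_univ _) ?_
    rw [Set.InjOn.ncard_image, Set.ncard_univ, h.ncard_eq, Nat.card_prod, pow_two]
    intro a ha b hb hab
    exact hxy a ha b hb (congrArg Prod.fst hab) (congrArg Prod.snd hab)
  have hex : ∀ a b : K, ∃ v ∈ c, x v = a ∧ y v = b := by
    intro a b
    have : (a, b) ∈ (fun v => (x v, y v)) '' c := by rw [himg]; trivial
    obtain ⟨v, hv, hvab⟩ := this
    exact ⟨v, hv, congrArg Prod.fst hvab, congrArg Prod.snd hvab⟩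
  choose s hs hsx hsy using hex
  have hs' : ∀ v ∈ c, s (x v) (y v) = v := fun v hv =>
    hxy _ (hs _ _) v hv (hsx _ _) (hsy _ _)
  have hK : 4 < Nat.card K := by omega
  obtain ⟨n₀, n₁, n₂, n₁₁, n₁₂, n₂₂, hn⟩ := exists_quadratic_polynomial hK h2
    (h.exists_quadratic_on_line hτ hs hsx hsy hs')
  obtain ⟨φ0, φ1, φ2, φ11, φ12, φ22⟩ := coeff_of_affine_functional hK (f := φ) (α := 1) (β := 0)
    (γ := 0) (fun u v => by rw [← hn, h.affine _ (hs u v)]; ring)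
  obtain ⟨x0, x1, x2, x11, x12, x22⟩ := coeff_of_affine_functional hK (f := x) (α := 0) (β := 1)
    (γ := 0) (fun u v => by rw [← hn, hsx]; ring)
  obtain ⟨y0, y1, y2, y11, y12, y22⟩ := coeff_of_affine_functional hK (f := y) (α := 0) (β := 0)
    (γ := 1) (fun u v => by rw [← hn, hsy]; ring)
  let Λ : K × K →ₗ[K] V := (LinearMap.fst K K K).smulRight n₁ + (LinearMap.snd K K K).smulRight n₂
  let B : K × K →ₗ[K] K × K →ₗ[K] V := LinearMap.mk₂ K
    (fun u v => (u.1 * v.1) • n₁₁ + ((u.1 * v.2 + u.2 * v.1) / 2) • n₁₂ + (u.2 * v.2) • n₂₂)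
    (fun u u' v => by simp only [Prod.fst_add, Prod.snd_add]; module)
    (fun k u v => by simp only [Prod.smul_fst, Prod.smul_snd, smul_eq_mul]; module)
    (fun u v v' => by simp only [Prod.fst_add, Prod.snd_add]; module)
    (fun k u v => by simp only [Prod.smul_fst, Prod.smul_snd, smul_eq_mul]; module)
  have hΛ : ∀ u, Λ u = u.1 • n₁ + u.2 • n₂ := fun u => rfl
  have hB : ∀ u v, B u v =
    (u.1 * v.1) • n₁₁ + ((u.1 * v.2 + u.2 * v.1) / 2) • n₁₂ + (u.2 * v.2) • n₂₂ := fun u v => rfl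
  have hF : ∀ u : K × K, n₀ + Λ u + B u u = s u.1 u.2 := by
    intro u
    have e : (u.1 * u.2 + u.2 * u.1) / 2 = u.1 * u.2 := by field_simp; ring
    rw [hn, hΛ, hB, e]
    module
  refine ⟨x.prod y, n₀, Λ, B, ?_, φ0, ?_, ?_, ?_, ?_, ?_, ?_, ?_⟩
  · simp
  · simp [x0, y0]
  · intro u; simp [hΛ, φ1, φ2]
  · intro u; simp [hΛ, x1, x2, y1, y2]
  · intro u v; simp [hB, φ11, φ12, φ22]
  · intro u v; simp [hB, x11, x12, x22, y11, y12, y22]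
  · intro u v; rw [hB, hB]; module
  · intro v
    constructor
    · intro hv
      exact ⟨(x v, y v), by rw [hF]; exact (hs' v hv).symm⟩
    · rintro ⟨u, rfl⟩
      rw [hF]
      exact hs _ _

end VectorConfig
end VectorModel

/-! ### The conics of a quadratic graph -/

section VectorModel

variable {K V U : Type*} [Field K] [AddCommGroup V] [Module K V] [AddCommGroup U] [Module K U]

namespace IsQuadraticGraph

variable {φ : V →ₗ[K] K} {ξ : V →ₗ[K] U} {o : V} {Λ : U →ₗ[K] V} {B : U →ₗ[K] U →ₗ[K] V}
  {c : Set V} {Pl : Set (Submodule K V)}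

/-- The point of `c` with parameter `a`. -/
def graphPoint (o : V) (Λ : U →ₗ[K] V) (B : U →ₗ[K] U →ₗ[K] V) (a : U) : V := o + Λ a + B a a

/-- The plane of the conic `t ↦ graphPoint (a + t • b)`; its three generators are a point of the
conic, the direction of the tangent in that point, and the point at infinity of the conic. -/
def conicPlane (o : V) (Λ : U →ₗ[K] V) (B : U →ₗ[K] U →ₗ[K] V) (a b : U) : Submodule K V :=
  Submodule.span K {graphPoint o Λ B a, Λ b + (2 : K) • B a b, B b b}

/-- The line at infinity consisting of the directions of the tangents in the point with
parameter `a`. -/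
def tangentLine (Λ : U →ₗ[K] V) (B : U →ₗ[K] U →ₗ[K] V) (a : U) : Submodule K V :=
  LinearMap.range (Λ + (2 : K) • B a)

theorem mem_tangentLine {a : U} {v : V} :
    v ∈ tangentLine Λ B a ↔ ∃ u, Λ u + (2 : K) • B a u = v := by
  simp [tangentLine]

theorem graphPoint_mem (g : IsQuadraticGraph φ ξ o Λ B c) (a : U) : graphPoint o Λ B a ∈ c :=
  (g.mem_iff _).mpr ⟨a, rfl⟩

theorem proj_graphPoint (g : IsQuadraticGraph φ ξ o Λ B c) (a : U) :
    ξ (graphPoint o Λ B a) = a := by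
  simp [graphPoint, g.proj_origin, g.proj_section, g.proj_bilin]

theorem map_graphPoint (g : IsQuadraticGraph φ ξ o Λ B c) (a : U) :
    φ (graphPoint o Λ B a) = 1 := by
  simp [graphPoint, g.map_origin, g.map_section, g.map_bilin]

theorem graphPoint_injective (g : IsQuadraticGraph φ ξ o Λ B c) :
    Function.Injective (graphPoint o Λ B) := fun a b hab => by
  rw [← g.proj_graphPoint a, ← g.proj_graphPoint b, hab]

theorem graphPoint_add_smul (g : IsQuadraticGraph φ ξ o Λ B c) (a b : U) (t : K) :
    graphPoint o Λ B (a + t • b) =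
      graphPoint o Λ B a + t • (Λ b + (2 : K) • B a b) + t ^ 2 • B b b := by
  simp only [graphPoint, map_add, map_smul, LinearMap.add_apply, LinearMap.smul_apply]
  rw [g.bilin_comm b a]
  module

theorem graphPoint_add_sub (g : IsQuadraticGraph φ ξ o Λ B c) (a b : U) :
    graphPoint o Λ B (a + b) - graphPoint o Λ B a = Λ b + (2 : K) • B a b + B b b := by
  have := g.graphPoint_add_smul a b 1
  rw [one_smul] at this
  rw [this]
  module

theorem bilin_self_ne_zero (g : IsQuadraticGraph φ ξ o Λ B c) (h : VectorConfig φ c Pl) {b : U}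
    (hb : b ≠ 0) : B b b ≠ 0 := by
  intro h0
  have hne : ∀ s t : K, s ≠ t → graphPoint o Λ B (s • b) ≠ graphPoint o Λ B (t • b) := by
    intro s t hst he
    exact hst (smul_left_injective K hb (g.graphPoint_injective he))
  have hpt : ∀ t : K, graphPoint o Λ B (t • b) = o + t • Λ b := by
    intro t
    simp [graphPoint, h0]
  have h1 : (-1 : K) ≠ 1 := by
    intro h1
    exact h.two_ne_zero (by linear_combination -h1)
  rcases h.arc _ (g.graphPoint_mem ((0 : K) • b)) _ (g.graphPoint_mem ((1 : K) • b)) _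
    (g.graphPoint_mem ((-1 : K) • b)) (hne _ _ zero_ne_one) (-1)
    (by rw [hpt, hpt, hpt]; module) with h' | h'
  · exact hne _ _ (by simp) h'
  · exact hne _ _ h1 h'

theorem tangent_ne_smul (g : IsQuadraticGraph φ ξ o Λ B c) {a b : U} (hb : b ≠ 0) (n : V)
    (hn : ξ n = 0) (k : K) : Λ b + (2 : K) • B a b ≠ k • n := by
  intro hk
  have := congrArg ξ hk
  simp [g.proj_section, g.proj_bilin, hn] at this
  exact hb this

theorem finrank_conicPlane (g : IsQuadraticGraph φ ξ o Λ B c) (h : VectorConfig φ c Pl) (a : U)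
    {b : U} (hb : b ≠ 0) : Module.finrank K (conicPlane o Λ B a b) = 3 := by
  have he : ({graphPoint o Λ B a, Λ b + (2 : K) • B a b, B b b} : Set V) =
      {graphPoint o Λ B a, B b b, Λ b + (2 : K) • B a b} := by
    rw [Set.pair_comm]
  rw [conicPlane, he]
  exact finrank_span_triple_eq_three (g.map_graphPoint a) (g.map_bilin _ _)
    (by simp [g.map_section, g.map_bilin]) (g.bilin_self_ne_zero h hb)
    (g.tangent_ne_smul hb _ (g.proj_bilin _ _))

theorem graphPoint_mem_conicPlane (a b : U) :
    graphPoint o Λ B a ∈ conicPlane o Λ B a b := Submodule.subset_span (by simp)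

theorem tangent_mem_conicPlane (a b : U) :
    Λ b + (2 : K) • B a b ∈ conicPlane o Λ B a b := Submodule.subset_span (by simp)

theorem bilin_mem_conicPlane (a b : U) : B b b ∈ conicPlane o Λ B a b :=
  Submodule.subset_span (by simp)

theorem graphPoint_add_smul_mem (g : IsQuadraticGraph φ ξ o Λ B c) (a b : U) (t : K) :
    graphPoint o Λ B (a + t • b) ∈ conicPlane o Λ B a b := by
  rw [g.graphPoint_add_smul]
  exact Submodule.add_mem _ (Submodule.add_mem _ (graphPoint_mem_conicPlane a b)
    (Submodule.smul_mem _ _ (tangent_mem_conicPlane a b)))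
    (Submodule.smul_mem _ _ (bilin_mem_conicPlane a b))

theorem mem_conicPlane (g : IsQuadraticGraph φ ξ o Λ B c) {a b : U} {v : V}
    (hv : v ∈ conicPlane o Λ B a b) :
    ∃ s t : K, v = φ v • graphPoint o Λ B a + s • (Λ b + (2 : K) • B a b) + t • B b b := by
  obtain ⟨r, s, t, h⟩ := Submodule.mem_span_triple.mp hv
  have : φ v = r := by
    rw [← h]; simp [g.map_graphPoint, g.map_section, g.map_bilin]
  exact ⟨s, t, by rw [this, h]⟩

theorem exists_of_mem_conicPlane (g : IsQuadraticGraph φ ξ o Λ B c) {a b a' : U}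
    (h : graphPoint o Λ B a' ∈ conicPlane o Λ B a b) : ∃ t : K, a' = a + t • b := by
  obtain ⟨s, t, hst⟩ := g.mem_conicPlane h
  refine ⟨s, ?_⟩
  have := congrArg ξ hst
  rw [g.map_graphPoint] at this
  simpa [g.proj_graphPoint, g.proj_section, g.proj_bilin] using this

theorem conicPlane_mem (g : IsQuadraticGraph φ ξ o Λ B c) (h : VectorConfig φ c Pl) (a : U) {b : U}
    (hb : b ≠ 0) : conicPlane o Λ B a b ∈ Pl := by
  have := h.finite
  have := h.finiteV
  refine h.mem_of_four_lt _ (g.finrank_conicPlane h a hb) ?_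
  have hinj : Function.Injective fun t : K => graphPoint o Λ B (a + t • b) :=
    g.graphPoint_injective.comp ((add_right_injective a).comp (smul_left_injective K hb))
  have h1 : (Set.range fun t : K => graphPoint o Λ B (a + t • b)).ncard = Nat.card K := by
    rw [← Set.image_univ, Set.ncard_image_of_injective _ hinj, Set.ncard_univ]
  have h2 : (Set.range fun t : K => graphPoint o Λ B (a + t • b)) ⊆
      c ∩ conicPlane o Λ B a b := by
    rintro v ⟨t, rfl⟩
    exact ⟨g.graphPoint_mem _, g.graphPoint_add_smul_mem a b t⟩
  have h3 := Set.ncard_le_ncard h2 (Set.toFinite _)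
  have := h.seven_le
  omega

theorem eq_conicPlane (g : IsQuadraticGraph φ ξ o Λ B c) (h : VectorConfig φ c Pl)
    {W : Submodule K V} (hW : W ∈ Pl) {a a' : U} (ha : graphPoint o Λ B a ∈ W)
    (ha' : graphPoint o Λ B a' ∈ W) (hne : a' - a ≠ 0) : W = conicPlane o Λ B a (a' - a) := by
  refine h.plane_unique _ (g.graphPoint_mem a) _ (g.graphPoint_mem a')
    (fun he => hne (by rw [g.graphPoint_injective he, sub_self])) W hW _
    (g.conicPlane_mem h a hne) ha ha' (graphPoint_mem_conicPlane _ _) ?_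
  have := g.graphPoint_add_smul_mem a (a' - a) 1
  rwa [one_smul, add_sub_cancel] at this

theorem exists_eq_conicPlane (g : IsQuadraticGraph φ ξ o Λ B c) (h : VectorConfig φ c Pl)
    {W : Submodule K V} (hW : W ∈ Pl) {a : U} (ha : graphPoint o Λ B a ∈ W) :
    ∃ b, b ≠ 0 ∧ W = conicPlane o Λ B a b := by
  have := h.finiteV
  have h7 := h.seven_le
  obtain ⟨v, ⟨hv, hvW⟩, hva⟩ : ((c ∩ W) \ {graphPoint o Λ B a}).Nonempty := by
    refine (Set.ncard_pos (Set.toFinite _)).mp ?_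
    rw [Set.ncard_sdiff_singleton_of_mem
      (show graphPoint o Λ B a ∈ c ∩ W from ⟨g.graphPoint_mem a, ha⟩), h.ncard_plane W hW]
    omega
  obtain ⟨a', rfl⟩ := (g.mem_iff v).mp hv
  have hne : a' - a ≠ 0 := by
    intro h0
    rw [sub_eq_zero.mp h0] at hva
    exact hva rfl
  exact ⟨a' - a, hne, g.eq_conicPlane h hW ha hvW hne⟩

theorem exists_graphPoint_mem (g : IsQuadraticGraph φ ξ o Λ B c) (h : VectorConfig φ c Pl)
    {W : Submodule K V} (hW : W ∈ Pl) : ∃ a, graphPoint o Λ B a ∈ W := by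
  have := h.finiteV
  have h7 := h.seven_le
  obtain ⟨v, hv, hvW⟩ : (c ∩ W).Nonempty := by
    refine (Set.ncard_pos (Set.toFinite _)).mp ?_
    rw [h.ncard_plane W hW]; omega
  obtain ⟨a, rfl⟩ := (g.mem_iff v).mp hv
  exact ⟨a, hvW⟩

theorem add_notMem (g : IsQuadraticGraph φ ξ o Λ B c) {n : V} (hn0 : n ≠ 0)
    (hn : ξ n = 0) (a : U) : graphPoint o Λ B a + n ∉ c := by
  intro hmem
  obtain ⟨u, hu⟩ := (g.mem_iff _).mp hmem
  have h1 : ξ (graphPoint o Λ B a + n) = ξ (graphPoint o Λ B u) := by rw [hu]; rfl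
  rw [map_add, hn, add_zero, g.proj_graphPoint, g.proj_graphPoint] at h1
  subst h1
  exact hn0 (by simpa [graphPoint] using hu)

/-- The planes of the configuration through the origin come in pairs with the same point at infinity:
the condition on affine points outside `c`, applied to a point of the axis of a conic. -/
theorem exists_partner_param (g : IsQuadraticGraph φ ξ o Λ B c) (h : VectorConfig φ c Pl) {b : U}
    (hb : b ≠ 0) : ∃ b', (∀ k : K, b' ≠ k • b) ∧ ∃ r : K, B b b = r • B b' b' := by
  have hQ := g.bilin_self_ne_zero h hb
  have hv : φ (graphPoint o Λ B 0 + B b b) = 1 := by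
    rw [map_add, g.map_graphPoint, g.map_bilin, add_zero]
  have hvE : graphPoint o Λ B 0 + B b b ∈ conicPlane o Λ B 0 b :=
    Submodule.add_mem _ (graphPoint_mem_conicPlane 0 b) (bilin_mem_conicPlane 0 b)
  obtain ⟨W, hW, hWne, hvW, -⟩ := h.two_planes _ hv (g.add_notMem hQ (g.proj_bilin _ _) 0) _
    (g.conicPlane_mem h 0 hb) hvE
  obtain ⟨a, ha⟩ := g.exists_graphPoint_mem h hW
  obtain ⟨b₁, hb₁, hWb⟩ := g.exists_eq_conicPlane h hW ha
  have h0W : graphPoint o Λ B 0 ∈ W := by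
    rw [hWb] at hvW ⊢
    obtain ⟨s, t, hst⟩ := g.mem_conicPlane hvW
    have h1 := congrArg ξ hst
    rw [hv] at h1
    simp only [map_add, map_smul, g.proj_graphPoint, g.proj_bilin, g.proj_section, smul_zero,
      add_zero, one_smul] at h1
    rw [h1]
    exact g.graphPoint_add_smul_mem a b₁ s
  obtain ⟨b', hb', rfl⟩ := g.exists_eq_conicPlane h hW h0W
  obtain ⟨s, t, hst⟩ := g.mem_conicPlane hvW
  rw [hv, one_smul, add_assoc, add_right_inj] at hst
  have h1 := congrArg ξ hst
  simp only [map_add, map_smul, g.proj_bilin, g.proj_section, smul_zero, add_zero] at h1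
  rw [eq_comm, smul_eq_zero] at h1
  rw [h1.resolve_right hb', zero_smul, zero_add] at hst
  refine ⟨b', ?_, t, hst⟩
  intro k hk
  apply hWne
  refine h.plane_unique _ (g.graphPoint_mem 0) _ (g.graphPoint_mem b')
    (fun he => hb' (g.graphPoint_injective he).symm) _ hW _ (g.conicPlane_mem h 0 hb)
    h0W ?_ (graphPoint_mem_conicPlane _ _) ?_
  · simpa using g.graphPoint_add_smul_mem 0 b' 1
  · simpa [hk] using g.graphPoint_add_smul_mem 0 b k

/-- The symmetric bilinear map `B` has no zero divisors, that is, `B` defines a commutative division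
algebra. If `B a b = 0` then either the planes in directions `a`, `b`, `a + b` have a common axis or
the plane in direction `b` has no partner. -/
theorem bilin_eq_zero (g : IsQuadraticGraph φ ξ o Λ B c) (h : VectorConfig φ c Pl) {a b : U}
    (hab : B a b = 0) : a = 0 ∨ b = 0 := by
  by_contra hcon
  push Not at hcon
  obtain ⟨ha, hb⟩ := hcon
  have hQb := g.bilin_self_ne_zero h hb
  have hQa := g.bilin_self_ne_zero h ha
  have hba : B b a = 0 := by rw [g.bilin_comm, hab]
  have hind : ∀ k : K, a ≠ k • b := by
    intro k hk
    rw [hk, map_smul, LinearMap.smul_apply, smul_eq_zero] at hab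
    rcases hab with hk0 | hab
    · exact ha (by rw [hk, hk0, zero_smul])
    · exact hQb hab
  obtain ⟨b', hb', r, hr⟩ := g.exists_partner_param h hb
  obtain ⟨β, α, hαβ⟩ := exists_eq_add_smul_of_finrank_two (l := (⊤ : Submodule K U))
    (by rw [finrank_top]; exact g.finrank_eq) (Submodule.mem_top (x := b))
    (Submodule.mem_top (x := a)) hb hind b' Submodule.mem_top
  have hα : α ≠ 0 := by
    rintro rfl
    exact hb' β (by rw [hαβ]; simp)
  have hr0 : r ≠ 0 := by
    rintro rfl
    exact hQb (by rw [hr, zero_smul])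
  have hQ : B b' b' = β ^ 2 • B b b + α ^ 2 • B a a := by
    rw [hαβ]
    simp only [map_add, map_smul, LinearMap.add_apply, LinearMap.smul_apply, hab, hba]
    module
  obtain ⟨k, hk⟩ : ∃ k : K, B a a = k • B b b := by
    refine ⟨(r * α ^ 2)⁻¹ * (1 - r * β ^ 2), ?_⟩
    have hne : r * α ^ 2 ≠ 0 := mul_ne_zero hr0 (pow_ne_zero 2 hα)
    have h1 : (r * α ^ 2) • B a a = (1 - r * β ^ 2) • B b b := by
      rw [hQ] at hr
      linear_combination (norm := module) -hr
    rw [mul_smul, ← h1, smul_smul, inv_mul_cancel₀ hne, one_smul]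
  have hk0 : k ≠ 0 := by
    rintro rfl
    exact hQa (by rw [hk, zero_smul])
  have hab0 : a + b ≠ 0 := by
    intro h0
    exact hind (-1) (by rw [neg_one_smul]; exact eq_neg_of_add_eq_zero_left h0)
  have hQab : B (a + b) (a + b) = (k + 1) • B b b := by
    simp only [map_add, LinearMap.add_apply, hab, hba, hk]
    module
  have hk1 : k + 1 ≠ 0 := by
    intro h0
    exact g.bilin_self_ne_zero h hab0 (by rw [hQab, h0, zero_smul])
  have hmem : ∀ u : U, ∀ s : K, s ≠ 0 → B u u = s • B b b →
      graphPoint o Λ B 0 + B b b ∈ conicPlane o Λ B 0 u := by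
    intro u s hs hu
    refine Submodule.add_mem _ (graphPoint_mem_conicPlane 0 u) ?_
    have : B b b = s⁻¹ • B u u := by rw [hu, smul_smul, inv_mul_cancel₀ hs, one_smul]
    rw [this]
    exact Submodule.smul_mem _ _ (bilin_mem_conicPlane 0 u)
  have hne : ∀ u v : U, (∀ t : K, v ≠ t • u) → conicPlane o Λ B 0 u ≠ conicPlane o Λ B 0 v := by
    intro u v huv he
    have h1 : graphPoint o Λ B v ∈ conicPlane o Λ B 0 u := by
      rw [he]
      simpa using g.graphPoint_add_smul_mem 0 v 1
    obtain ⟨t, ht⟩ := g.exists_of_mem_conicPlane h1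
    exact huv t (by rw [ht, zero_add])
  refine g.add_notMem hQb (g.proj_bilin _ _) 0 ?_
  refine h.mem_of_three (g.conicPlane_mem h 0 hb) (g.conicPlane_mem h 0 ha)
    (g.conicPlane_mem h 0 hab0) (hne b a hind) (hne b (a + b) ?_) (hne a (a + b) ?_)
    (by rw [map_add, g.map_graphPoint, g.map_bilin, add_zero])
    (hmem b 1 one_ne_zero (one_smul _ _).symm) (hmem a k hk0 hk) (hmem (a + b) (k + 1) hk1 hQab)
  · intro t ht
    exact hind (t - 1) (by rw [sub_smul, one_smul, ← ht, add_sub_cancel_right])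
  · intro t ht
    have h1 : b = (t - 1) • a := by rw [sub_smul, one_smul, ← ht, add_sub_cancel_left]
    have h2 : t - 1 ≠ 0 := by
      intro h0
      exact hb (by rw [h1, h0, zero_smul])
    exact hind (t - 1)⁻¹ (by rw [h1, smul_smul, inv_mul_cancel₀ h2, one_smul])

end IsQuadraticGraph
end VectorModel

/-! ### The tangent lines and the axis line -/

/-- An orientation of five of the six edges of the complete graph on four vertices has a vertex of
in-degree at least two. -/
theorem false_of_five_edges {α : Type*} {a b c d : α} (E : α → α → Prop)
    (hab : E a b ∨ E b a) (hac : E a c ∨ E c a) (had : E a d ∨ E d a) (hbc : E b c ∨ E c b)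
    (hcd : E c d ∨ E d c) (bca : E b a → ¬ E c a) (bda : E b a → ¬ E d a) (cda : E c a → ¬ E d a)
    (acb : E a b → ¬ E c b) (abc : E a c → ¬ E b c) (adc : E a c → ¬ E d c) (bdc : E b c → ¬ E d c)
    (acd : E a d → ¬ E c d) : False := by
  grind

section VectorModel

variable {K V U : Type*} [Field K] [AddCommGroup V] [Module K V] [AddCommGroup U] [Module K U]

namespace IsQuadraticGraph

variable {φ : V →ₗ[K] K} {ξ : V →ₗ[K] U} {o : V} {Λ : U →ₗ[K] V} {B : U →ₗ[K] U →ₗ[K] V}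
  {c : Set V} {Pl : Set (Submodule K V)}

/-- The line at infinity on which the values of `B` lie; its points will turn out to be the
`∞`-points and the `0`-points. -/
def axisLine (φ : V →ₗ[K] K) (ξ : V →ₗ[K] U) : Submodule K V := LinearMap.ker φ ⊓ LinearMap.ker ξ

theorem moduleFinite (g : IsQuadraticGraph φ ξ o Λ B c) : Module.Finite K U :=
  Module.finite_of_finrank_pos (by rw [g.finrank_eq]; norm_num)

theorem finrank_axisLine (g : IsQuadraticGraph φ ξ o Λ B c) (h : VectorConfig φ c Pl) :
    Module.finrank K (axisLine φ ξ) = 2 := by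
  have := h.moduleFinite
  have := g.moduleFinite
  have h1 := LinearMap.finrank_range_add_finrank_ker (φ.prod ξ)
  have h2 : LinearMap.range (φ.prod ξ) = ⊤ := LinearMap.range_eq_top.mpr fun x =>
    ⟨x.1 • o + Λ x.2, by
      simp [g.map_origin, g.map_section, g.proj_origin, g.proj_section]⟩
  rw [h2, finrank_top, Module.finrank_prod, Module.finrank_self, g.finrank_eq, h.finrank_eq,
    LinearMap.ker_prod] at h1
  have h3 : axisLine φ ξ = LinearMap.ker φ ⊓ LinearMap.ker ξ := rfl
  rw [h3]
  omega

theorem mem_axisLine {v : V} : v ∈ axisLine φ ξ ↔ φ v = 0 ∧ ξ v = 0 := Iff.rfl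

theorem bilin_mem_axisLine (g : IsQuadraticGraph φ ξ o Λ B c) (a b : U) :
    B a b ∈ axisLine φ ξ := ⟨g.map_bilin a b, g.proj_bilin a b⟩

/-- Multiplication by `b ≠ 0` in the division algebra `B` is a bijection onto the axis line. -/
theorem exists_bilin_eq (g : IsQuadraticGraph φ ξ o Λ B c) (h : VectorConfig φ c Pl) {b : U}
    (hb : b ≠ 0) {n : V} (hn : n ∈ axisLine φ ξ) : ∃ a, (2 : K) • B a b = n := by
  have := h.moduleFinite
  have := g.moduleFinite
  let f : U →ₗ[K] axisLine φ ξ :=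
    LinearMap.codRestrict (axisLine φ ξ) ((2 : K) • B.flip b) (fun a =>
      (axisLine φ ξ).smul_mem _ (g.bilin_mem_axisLine a b))
  have hinj : Function.Injective f := by
    rw [injective_iff_map_eq_zero]
    intro a ha
    have h1 : (2 : K) • B a b = 0 := congrArg Subtype.val ha
    exact (g.bilin_eq_zero h ((smul_eq_zero.mp h1).resolve_left h.two_ne_zero)).resolve_right hb
  have hsurj : Function.Surjective f := (LinearMap.injective_iff_surjective_of_finrank_eq_finrank
    (g.finrank_eq.trans (g.finrank_axisLine h).symm)).mp hinj
  obtain ⟨a, ha⟩ := hsurj ⟨n, hn⟩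
  exact ⟨a, congrArg Subtype.val ha⟩

theorem finrank_tangentLine (g : IsQuadraticGraph φ ξ o Λ B c) (a : U) :
    Module.finrank K (tangentLine Λ B a) = 2 := by
  rw [tangentLine, LinearMap.finrank_range_of_inj, g.finrank_eq]
  intro u v huv
  have := congrArg ξ huv
  simpa [g.proj_section, g.proj_bilin] using this

theorem tangentLine_le_ker (g : IsQuadraticGraph φ ξ o Λ B c) (a : U) :
    tangentLine Λ B a ≤ LinearMap.ker φ := by
  rintro v ⟨u, rfl⟩
  simp [g.map_section, g.map_bilin]

theorem eq_of_mem_tangentLine (g : IsQuadraticGraph φ ξ o Λ B c) (h : VectorConfig φ c Pl)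
    {a a' : U} {v : V} (hv0 : v ≠ 0) (hv : v ∈ tangentLine Λ B a) (hv' : v ∈ tangentLine Λ B a') :
    a = a' := by
  obtain ⟨u, rfl⟩ := mem_tangentLine.mp hv
  obtain ⟨u', hu'⟩ := mem_tangentLine.mp hv'
  have h1 := congrArg ξ hu'
  simp only [map_add, map_smul, g.proj_section, g.proj_bilin, smul_zero, add_zero] at h1
  subst h1
  have h2 : (2 : K) • B (a - a') u' = 0 := by
    rw [map_sub, LinearMap.sub_apply]
    linear_combination (norm := module) -hu'
  rcases g.bilin_eq_zero h ((smul_eq_zero.mp h2).resolve_left h.two_ne_zero) with h3 | h3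
  · exact sub_eq_zero.mp h3
  · exact absurd (by rw [h3]; simp) hv0

theorem eq_zero_of_mem_tangentLine (g : IsQuadraticGraph φ ξ o Λ B c) {a : U} {v : V}
    (hv : v ∈ tangentLine Λ B a) (hv' : ξ v = 0) : v = 0 := by
  obtain ⟨u, rfl⟩ := mem_tangentLine.mp hv
  simp only [map_add, map_smul, g.proj_section, g.proj_bilin, smul_zero, add_zero] at hv'
  rw [hv']; simp

/-- The point of a tangent line with a given nonzero projection. -/
theorem exists_mem_tangentLine (g : IsQuadraticGraph φ ξ o Λ B c) (h : VectorConfig φ c Pl) {v : V}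
    (hv : φ v = 0) (hξ : ξ v ≠ 0) : ∃ a, v ∈ tangentLine Λ B a := by
  obtain ⟨a, ha⟩ := g.exists_bilin_eq h hξ (n := v - Λ (ξ v))
    ⟨by simp [hv, g.map_section], by simp [g.proj_section]⟩
  exact ⟨a, mem_tangentLine.mpr ⟨ξ v, by rw [ha]; abel⟩⟩

/-- A tangent line does not contain the directions of two chords of `c` with a common end. -/
theorem tangentLine_arc (g : IsQuadraticGraph φ ξ o Λ B c) (h : VectorConfig φ c Pl) {a₀ : U}
    {v₁ v₂ v₃ : V} (h₁ : v₁ ∈ c) (h₂ : v₂ ∈ c) (h₃ : v₃ ∈ c) (h₁₂ : v₁ ≠ v₂) (h₁₃ : v₁ ≠ v₃)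
    (h₂₁ : v₂ - v₁ ∈ tangentLine Λ B a₀) (h₃₁ : v₃ - v₁ ∈ tangentLine Λ B a₀) : v₂ = v₃ := by
  obtain ⟨a, rfl⟩ := (g.mem_iff _).mp h₁
  have key : ∀ v ∈ c, o + Λ a + B a a ≠ v → v - (o + Λ a + B a a) ∈ tangentLine Λ B a₀ →
      v = graphPoint o Λ B (a + (2 : K) • (a₀ - a)) := by
    intro v hv hne hmem
    obtain ⟨a', rfl⟩ := (g.mem_iff _).mp hv
    obtain ⟨b, rfl⟩ : ∃ b, a' = a + b := ⟨a' - a, by abel⟩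
    have h1 := g.graphPoint_add_sub a b
    have h1' : o + Λ (a + b) + B (a + b) (a + b) - (o + Λ a + B a a) =
        Λ b + (2 : K) • B a b + B b b := h1
    rw [h1'] at hmem
    obtain ⟨u, hu⟩ := mem_tangentLine.mp hmem
    have h2 := congrArg ξ hu
    simp only [map_add, map_smul, g.proj_section, g.proj_bilin, smul_zero, add_zero] at h2
    subst h2
    have h3 : B ((2 : K) • (a₀ - a) - u) u = 0 := by
      simp only [map_sub, map_smul, LinearMap.sub_apply, LinearMap.smul_apply]
      linear_combination (norm := module) hu
    rcases g.bilin_eq_zero h h3 with h4 | h4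
    · rw [sub_eq_zero.mp h4]; rfl
    · exact absurd (by rw [h4, add_zero]) hne
  rw [key v₂ h₂ h₁₂ h₂₁, key v₃ h₃ h₁₃ h₃₁]

/-- The axis line does not contain the direction of a chord of `c`. -/
theorem axisLine_arc (g : IsQuadraticGraph φ ξ o Λ B c) {v₁ v₂ : V} (h₁ : v₁ ∈ c) (h₂ : v₂ ∈ c)
    (h₂₁ : v₂ - v₁ ∈ axisLine φ ξ) : v₁ = v₂ := by
  obtain ⟨a, rfl⟩ := (g.mem_iff _).mp h₁
  obtain ⟨b, rfl⟩ := (g.mem_iff _).mp h₂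
  have h1 := g.proj_graphPoint a
  have h2 := g.proj_graphPoint b
  have h3 := (mem_axisLine.mp h₂₁).2
  rw [map_sub, sub_eq_zero] at h3
  have : a = b := by
    rw [← h1, ← h2]; exact h3.symm
  rw [this]

/-- A line `l` at infinity disjoint from the axis line, whose cosets meet `c` in at most two
points, is a tangent line.

The line is the graph `{Λ u + L u}` of a linear map `L`; let `r u` be the parameter of the tangent
line meeting `l` in its point over `u ≠ 0`. For independent `u` and `v` the cosets of `l` through the
points of `c` yield that `r u - r v` is a multiple of `u` or of `v`. On the other hand, unless
`r` is constant, for a given `v` there is only one direction `u` such that `r u - r v` is a multiple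
of `v`. This is impossible for four directions: they form more than four pairs. -/
theorem eq_tangentLine_of_arc (g : IsQuadraticGraph φ ξ o Λ B c) (h : VectorConfig φ c Pl)
    {l : Submodule K V} (hl : Module.finrank K l = 2) (hlφ : ∀ v ∈ l, φ v = 0)
    (hlξ : ∀ v ∈ l, ξ v = 0 → v = 0)
    (harc : ∀ v₁ ∈ c, ∀ v₂ ∈ c, ∀ v₃ ∈ c, v₁ ≠ v₂ → v₁ ≠ v₃ → v₂ - v₁ ∈ l → v₃ - v₁ ∈ l → v₂ = v₃) :
    ∃ a, l = tangentLine Λ B a := by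
  have := h.moduleFinite
  have := g.moduleFinite
  have h2 := h.two_ne_zero
  have hinj : Function.Injective (ξ.domRestrict l) := by
    rw [injective_iff_map_eq_zero]
    intro v hv
    exact Subtype.ext (hlξ v v.2 hv)
  have hsurj := (LinearMap.injective_iff_surjective_of_finrank_eq_finrank
    (hl.trans g.finrank_eq.symm)).mp hinj
  let e : l ≃ₗ[K] U := LinearEquiv.ofBijective (ξ.domRestrict l) ⟨hinj, hsurj⟩
  have he : ∀ u, ξ (e.symm u) = u := fun u => e.apply_symm_apply u
  let L : U →ₗ[K] V := l.subtype.comp e.symm.toLinearMap - Λ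
  have hL : ∀ u, Λ u + L u = e.symm u := fun u => by simp [L]
  have hLl : ∀ u, Λ u + L u ∈ l := fun u => by rw [hL]; exact (e.symm u).2
  have hLN : ∀ u, L u ∈ axisLine φ ξ := fun u => by
    refine mem_axisLine.mpr ⟨?_, ?_⟩
    · simp [L, hlφ _ (e.symm u).2, g.map_section]
    · simp [L, he, g.proj_section]
  have hex : ∀ u, ∃ a, u ≠ 0 → (2 : K) • B a u = L u := by
    intro u
    by_cases hu : u = 0
    · exact ⟨0, fun hh => absurd hu hh⟩
    · obtain ⟨a, ha⟩ := g.exists_bilin_eq h hu (hLN u)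
      exact ⟨a, fun _ => ha⟩
  choose r hr using hex
  by_contra hcon
  push Not at hcon
  let I : U → U → Prop := fun u v => ∀ s t : K, s • u + t • v = 0 → s = 0 ∧ t = 0
  have hI0 : ∀ u v, I u v → u ≠ 0 := by
    rintro u v huv rfl
    exact one_ne_zero (huv 1 0 (by simp)).1
  have hIs : ∀ u v, I u v → I v u := fun u v huv s t hst => by
    have := huv t s (by rw [add_comm]; exact hst)
    exact ⟨this.2, this.1⟩
  have hIspan : ∀ u v, I u v → ∀ w : U, ∃ s t : K, w = s • u + t • v := by
    intro u v huv w
    refine exists_eq_add_smul_of_finrank_two (l := (⊤ : Submodule K U))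
      (by rw [finrank_top]; exact g.finrank_eq) (Submodule.mem_top (x := u))
      (Submodule.mem_top (x := v)) (hI0 u v huv) ?_ w Submodule.mem_top
    intro k hk
    have := (huv k (-1) (by rw [hk]; module)).2
    exact one_ne_zero (neg_eq_zero.mp this)
  have hrne : ∀ u v, I u v → r u ≠ r v := by
    intro u v huv huv'
    refine hcon (r u) (Submodule.eq_of_le_of_finrank_eq ?_
      (hl.trans (g.finrank_tangentLine _).symm))
    intro w hw
    have hw' : w = Λ (ξ w) + L (ξ w) := by
      rw [hL]
      exact congrArg Subtype.val (e.symm_apply_apply ⟨w, hw⟩).symm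
    obtain ⟨s, t, hst⟩ := hIspan u v huv (ξ w)
    refine mem_tangentLine.mpr ⟨ξ w, ?_⟩
    rw [hw']
    have e1 := hr u (hI0 u v huv)
    have e2 := hr v (hI0 v u (hIs u v huv))
    rw [← huv'] at e2
    have e3 : ξ (Λ (ξ w) + L (ξ w)) = ξ w := by rw [← hw']
    rw [e3, hst]
    simp only [map_add, map_smul]
    rw [← e1, ← e2]
    module
  -- If `α` and `β` below were nonzero, then the coset of `l` through the point with parameter
  -- `r u - α • u` would contain three points of `c`.
  have hedge : ∀ u v, I u v → (∃ k : K, r u - r v = k • v) ∨ ∃ k : K, r v - r u = k • u := by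
    intro u v huv
    obtain ⟨α, β, hαβ⟩ := hIspan u v huv (r u - r v)
    by_cases hα : α = 0
    · left; exact ⟨β, by rw [hαβ, hα]; simp⟩
    by_cases hβ : β = 0
    · right; exact ⟨-α, by rw [← neg_sub, hαβ, hβ]; simp⟩
    exfalso
    have hu := hr u (hI0 u v huv)
    have hv := hr v (hI0 v u (hIs u v huv))
    set a := r u - α • u with ha
    have ha' : a = r v + β • v := by rw [ha, eq_add_of_sub_eq hαβ]; module
    have key : ∀ (w : U) (k : K), (2 : K) • B (r w) w = L w → a = r w - k • w →
        graphPoint o Λ B (a + (2 * k) • w) - graphPoint o Λ B a ∈ l := by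
      intro w k hw hak
      have e1 : graphPoint o Λ B (a + (2 * k) • w) - graphPoint o Λ B a =
          (2 * k) • (Λ w + L w) := by
        rw [g.graphPoint_add_smul, ← hw, hak]
        simp only [map_sub, map_smul, LinearMap.sub_apply, LinearMap.smul_apply]
        module
      rw [e1]
      exact l.smul_mem _ (hLl w)
    have k1 := key u α hu ha
    have k2 := key v (-β) hv (by rw [ha']; module)
    have hαu : (2 * α) • u ≠ 0 := by
      intro h0
      have := (huv (2 * α) 0 (by rw [h0]; simp)).1
      exact (mul_ne_zero h2 hα) this
    have hβv : (2 * -β) • v ≠ 0 := by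
      intro h0
      have := (huv 0 (2 * -β) (by rw [h0]; simp)).2
      exact (mul_ne_zero h2 (neg_ne_zero.mpr hβ)) this
    have h3 := harc _ (g.graphPoint_mem a) _ (g.graphPoint_mem _) _ (g.graphPoint_mem _)
      (fun he => hαu (by simpa using g.graphPoint_injective he))
      (fun he => hβv (by simpa using g.graphPoint_injective he)) k1 k2
    have h4 := add_left_cancel (g.graphPoint_injective h3)
    have h5 := (huv (2 * α) (-(2 * -β)) (by rw [h4]; module)).1
    exact (mul_ne_zero h2 hα) h5
  have hin : ∀ u v w, I u v → I u w → I v w → (∃ k : K, r u - r w = k • w) →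
      ¬ ∃ k : K, r v - r w = k • w := by
    rintro u v w huv huw hvw ⟨k, hk⟩ ⟨m, hm⟩
    obtain ⟨α, β, hαβ⟩ := hIspan u w huw v
    have eu := hr u (hI0 u v huv)
    have ev := hr v (hI0 v w hvw)
    have ew := hr w (hI0 w v (hIs v w hvw))
    rw [eq_add_of_sub_eq hk] at eu
    rw [eq_add_of_sub_eq hm] at ev
    have h3 : (2 : K) • B w (m • v - (α * k) • u) = 0 := by
      have h4 : L v = α • L u + β • L w := by rw [hαβ]; simp
      rw [← ev, ← eu, ← ew] at h4
      have h5 : B (r w) v = α • B (r w) u + β • B (r w) w := by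
        conv_lhs => rw [hαβ]
        simp
      simp only [map_sub, map_add, map_smul, LinearMap.add_apply, LinearMap.smul_apply] at h4 ⊢
      rw [h5] at h4
      linear_combination (norm := module) h4
    have h4 := (g.bilin_eq_zero h ((smul_eq_zero.mp h3).resolve_left h2)).resolve_left
      (hI0 w v (hIs v w hvw))
    have h5 := (huv (-(α * k)) m (by linear_combination (norm := module) h4)).2
    rw [h5, zero_smul, sub_eq_zero] at hm
    exact hrne v w hvw hm
  -- Four pairwise independent directions.
  obtain ⟨u, v, huv⟩ : ∃ u v, I u v := by
    let b := Module.finBasisOfFinrankEq K U g.finrank_eq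
    refine ⟨b 0, b 1, fun s t hst => ?_⟩
    have := Fintype.linearIndependent_iff.mp b.linearIndependent ![s, t]
      (by simpa [Fin.sum_univ_two] using hst)
    exact ⟨this 0, this 1⟩
  have h13 : I u (u + v) := fun s t hst => by
    have := huv (s + t) t (by linear_combination (norm := module) hst)
    exact ⟨by linear_combination this.1 - this.2, this.2⟩
  have h14 : I u (u - v) := fun s t hst => by
    have := huv (s + t) (-t) (by linear_combination (norm := module) hst)
    exact ⟨by linear_combination this.1 + this.2, by linear_combination -this.2⟩
  have h23 : I v (u + v) := fun s t hst => by
    have := huv t (s + t) (by linear_combination (norm := module) hst)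
    exact ⟨by linear_combination this.2 - this.1, this.1⟩
  have h24 : I v (u - v) := fun s t hst => by
    have := huv t (s - t) (by linear_combination (norm := module) hst)
    exact ⟨by linear_combination this.1 + this.2, this.1⟩
  have h34 : I (u + v) (u - v) := fun s t hst => by
    have := huv (s + t) (s - t) (by linear_combination (norm := module) hst)
    exact ⟨(mul_eq_zero.mp (by linear_combination this.1 + this.2 : 2 * s = 0)).resolve_left h2,
      (mul_eq_zero.mp (by linear_combination this.1 - this.2 : 2 * t = 0)).resolve_left h2⟩
  have n1 := hin v (u + v) u h23 (hIs _ _ huv) (hIs _ _ h13)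
  have n2 := hin v (u - v) u h24 (hIs _ _ huv) (hIs _ _ h14)
  have n3 := hin (u + v) (u - v) u h34 (hIs _ _ h13) (hIs _ _ h14)
  have n4 := hin u (u + v) v h13 huv (hIs _ _ h23)
  have n7 := hin u v (u + v) huv h13 h23
  have n8 := hin u (u - v) (u + v) h14 h13 (hIs _ _ h34)
  have n9 := hin v (u - v) (u + v) h24 h23 (hIs _ _ h34)
  have n11 := hin u (u + v) (u - v) h13 h14 h34
  have e1 := hedge _ _ huv
  have e2 := hedge _ _ h13
  have e3 := hedge _ _ h14
  have e4 := hedge _ _ h23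
  have e5 := hedge _ _ h34
  exact false_of_five_edges (fun x y => ∃ k : K, r x - r y = k • y) e1 e2 e3 e4 e5 n1 n2 n3 n4 n7 n8
    n9 n11

/-- If the cosets of the members of a partition `T` of the space at infinity into lines meet `c` in
at most two points, but `tangentLine a` is not in `T`, then it is met by each member of `T` that
meets the axis line. The members of `T` through the points of `tangentLine a` meet the axis line,
in distinct points, and both lines have the same number of points. -/
theorem exists_mem_of_tangentLine_notMem (g : IsQuadraticGraph φ ξ o Λ B c)
    (h : VectorConfig φ c Pl) {T : Set (Submodule K V)} (hT : ∀ l ∈ T, Module.finrank K l = 2)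
    (hTφ : ∀ l ∈ T, ∀ v ∈ l, φ v = 0) (hcov : ∀ v, φ v = 0 → v ≠ 0 → ∃ l ∈ T, v ∈ l)
    (huniq : ∀ l ∈ T, ∀ l' ∈ T, ∀ v, v ≠ 0 → v ∈ l → v ∈ l' → l = l')
    (harc : ∀ l ∈ T, ∀ v₁ ∈ c, ∀ v₂ ∈ c, ∀ v₃ ∈ c, v₁ ≠ v₂ → v₁ ≠ v₃ → v₂ - v₁ ∈ l →
      v₃ - v₁ ∈ l → v₂ = v₃) {a : U} (ha : tangentLine Λ B a ∉ T) {l : Submodule K V} (hl : l ∈ T)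
    {n : V} (hn0 : n ≠ 0) (hn : n ∈ axisLine φ ξ) (hnl : n ∈ l) :
    ∃ u, u ≠ 0 ∧ Λ u + (2 : K) • B a u ∈ l := by
  have := h.finite
  have := h.moduleFinite
  have := g.moduleFinite
  have : Finite U := Module.finite_of_finite K
  have := h.finiteV
  have hne : ∀ u, u ≠ 0 → Λ u + (2 : K) • B a u ≠ 0 := fun u hu hu0 => hu (by
    have := congrArg ξ hu0
    simpa [g.proj_section, g.proj_bilin] using this)
  have hex : ∀ X : ℙ K U, ∃ m, m ∈ T ∧ Λ X.rep + (2 : K) • B a X.rep ∈ m ∧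
      ∃ w : axisLine φ ξ, w ≠ 0 ∧ (w : V) ∈ m := by
    intro X
    obtain ⟨m, hm, hXm⟩ := hcov (Λ X.rep + (2 : K) • B a X.rep)
      (by simp [g.map_section, g.map_bilin]) (hne _ X.rep_nonzero)
    refine ⟨m, hm, hXm, ?_⟩
    by_contra hno
    push Not at hno
    obtain ⟨a', rfl⟩ := g.eq_tangentLine_of_arc h (hT m hm) (hTφ m hm) (fun v hv hv0 => by
      by_contra hvne
      exact hno ⟨v, hTφ m hm v hv, hv0⟩ (fun h0 => hvne (congrArg Subtype.val h0)) hv) (harc m hm)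
    rw [← g.eq_of_mem_tangentLine h (hne _ X.rep_nonzero) (mem_tangentLine.mpr ⟨_, rfl⟩) hXm] at hm
    exact ha hm
  choose m hm hXm w hw0 hwm using hex
  have hinj : Function.Injective fun X : ℙ K U => Projectivization.mk K (w X) (hw0 X) := by
    intro X Y hXY
    by_contra hXYne
    obtain ⟨k, hk⟩ := (Projectivization.mk_eq_mk_iff' K _ _ _ _).mp hXY
    have hmm : m X = m Y := by
      refine huniq _ (hm X) _ (hm Y) (w X) (fun h0 => hw0 X (Subtype.ext h0)) (hwm X) ?_
      rw [← hk]
      exact (m Y).smul_mem _ (hwm Y)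
    have hli : ∀ k : K, Y.rep ≠ k • X.rep := by
      intro k hk
      apply hXYne
      rw [← X.mk_rep, ← Y.mk_rep]
      exact ((Projectivization.mk_eq_mk_iff' K _ _ _ _).mpr ⟨k, hk.symm⟩).symm
    apply ha
    have : tangentLine Λ B a = m X := by
      refine Submodule.eq_of_le_of_finrank_eq ?_
        ((g.finrank_tangentLine a).trans (hT _ (hm X)).symm)
      rintro v ⟨u, rfl⟩
      obtain ⟨s, t, rfl⟩ := exists_eq_add_smul_of_finrank_two (l := (⊤ : Submodule K U))
        (by rw [finrank_top]; exact g.finrank_eq) (Submodule.mem_top (x := X.rep))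
        (Submodule.mem_top (x := Y.rep)) X.rep_nonzero hli u Submodule.mem_top
      rw [map_add, map_smul, map_smul]
      refine (m X).add_mem ((m X).smul_mem _ (hXm X)) ((m X).smul_mem _ ?_)
      rw [hmm]
      exact hXm Y
    rw [this]
    exact hm X
  have hsurj := (Function.Injective.bijective_of_nat_card_le hinj (by
    rw [Projectivization.card_of_finrank_two K _ (g.finrank_axisLine h),
      Projectivization.card_of_finrank_two K _ g.finrank_eq])).2
  obtain ⟨X, hX⟩ := hsurj (Projectivization.mk K (⟨n, hn⟩ : axisLine φ ξ)
    (fun h0 => hn0 (congrArg Subtype.val h0)))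
  obtain ⟨k, hk⟩ := (Projectivization.mk_eq_mk_iff' K _ _ _ _).mp hX
  have hmm : m X = l := by
    refine huniq _ (hm X) _ hl (w X) (fun h0 => hw0 X (Subtype.ext h0)) (hwm X) ?_
    rw [← hk]
    exact l.smul_mem _ hnl
  exact ⟨X.rep, X.rep_nonzero, hmm ▸ hXm X⟩

/-- The only partition of the space at infinity into lines the cosets of which meet `c` in at most
two points consists of the tangent lines and the axis line. If the axis line is not in the partition,
then each line of the partition through a point of the axis line meets two tangent lines with
parameters `a` and `a + w`; for the point `B w w` this line is then the line at infinity of a plane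
of the configuration. -/
theorem eq_of_partition (g : IsQuadraticGraph φ ξ o Λ B c)
    (h : VectorConfig φ c Pl) {T : Set (Submodule K V)} (hT : ∀ l ∈ T, Module.finrank K l = 2)
    (hTφ : ∀ l ∈ T, ∀ v ∈ l, φ v = 0) (hcov : ∀ v, φ v = 0 → v ≠ 0 → ∃ l ∈ T, v ∈ l)
    (huniq : ∀ l ∈ T, ∀ l' ∈ T, ∀ v, v ≠ 0 → v ∈ l → v ∈ l' → l = l')
    (harc : ∀ l ∈ T, ∀ v₁ ∈ c, ∀ v₂ ∈ c, ∀ v₃ ∈ c, v₁ ≠ v₂ → v₁ ≠ v₃ → v₂ - v₁ ∈ l →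
      v₃ - v₁ ∈ l → v₂ = v₃) : T = insert (axisLine φ ξ) (Set.range (tangentLine Λ B)) := by
  have := h.moduleFinite
  have := g.moduleFinite
  have h2 := h.two_ne_zero
  obtain ⟨e, he⟩ : ∃ e : U, e ≠ 0 := by
    have : Nontrivial U := Module.nontrivial_of_finrank_pos (R := K) (by rw [g.finrank_eq]; norm_num)
    exact exists_ne 0
  have haxis : axisLine φ ξ ∈ T := by
    by_contra hN
    obtain ⟨l, hl, hel⟩ := hcov (B e e) (g.map_bilin _ _) (g.bilin_self_ne_zero h he)
    obtain ⟨d, hd, hdξ⟩ : ∃ d ∈ l, ξ d ≠ 0 := by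
      by_contra hno
      push Not at hno
      apply hN
      rw [← Submodule.eq_of_le_of_finrank_eq (fun v hv => ⟨hTφ l hl v hv, hno v hv⟩ :
        l ≤ axisLine φ ξ) ((hT l hl).trans (g.finrank_axisLine h).symm)]
      exact hl
    have hnot : ∀ a, (∃ v ∈ l, ξ v ≠ 0 ∧ v ∈ tangentLine Λ B a) → tangentLine Λ B a ∉ T := by
      rintro a ⟨v, hv, hvξ, hva⟩ haT
      have := huniq l hl _ haT v (by rintro rfl; exact hvξ (map_zero ξ)) hv hva
      rw [this] at hel
      exact g.bilin_self_ne_zero h he (g.eq_zero_of_mem_tangentLine hel (g.proj_bilin _ _))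
    obtain ⟨a, ha⟩ := g.exists_mem_tangentLine h (hTφ l hl d hd) hdξ
    obtain ⟨a', ha'⟩ := g.exists_mem_tangentLine h (v := d + B e e)
      (by rw [map_add, hTφ l hl d hd, g.map_bilin, add_zero])
      (by rwa [map_add, g.proj_bilin, add_zero])
    have haT := hnot a ⟨d, hd, hdξ, ha⟩
    have haT' := hnot a' ⟨_, l.add_mem hd hel, by rwa [map_add, g.proj_bilin, add_zero], ha'⟩
    have hne : a' - a ≠ 0 := by
      intro h0
      rw [sub_eq_zero.mp h0] at ha'
      have h3 := (tangentLine Λ B a).sub_mem ha' ha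
      rw [add_sub_cancel_left] at h3
      exact g.bilin_self_ne_zero h he (g.eq_zero_of_mem_tangentLine h3 (g.proj_bilin _ _))
    obtain ⟨w, hw⟩ : ∃ w, w = a' - a := ⟨_, rfl⟩
    rw [← hw] at hne
    have hQ := g.bilin_self_ne_zero h hne
    obtain ⟨l', hl', hwl'⟩ := hcov (B w w) (g.map_bilin _ _) hQ
    obtain ⟨u, hu0, hu⟩ := g.exists_mem_of_tangentLine_notMem h hT hTφ hcov huniq harc haT hl' hQ
      (g.bilin_mem_axisLine w w) hwl'
    obtain ⟨u', hu0', hu'⟩ := g.exists_mem_of_tangentLine_notMem h hT hTφ hcov huniq harc haT' hl' hQ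
      (g.bilin_mem_axisLine w w) hwl'
    obtain ⟨α, β, hαβ⟩ := exists_eq_add_smul_of_finrank_two (hT l' hl') hwl' hu hQ
      (g.tangent_ne_smul hu0 _ (g.proj_bilin _ _)) _ hu'
    have h3 := congrArg ξ hαβ
    simp only [map_add, map_smul, g.proj_section, g.proj_bilin, smul_zero, add_zero,
      zero_add] at h3
    have hβ : β ≠ 0 := by
      rintro rfl
      exact hu0' (by rw [h3, zero_smul])
    have h4 : B w ((2 * β) • u - α • w) = 0 := by
      have : a' = a + w := by rw [hw]; abel
      rw [this, h3] at hαβ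
      simp only [map_sub, map_add, map_smul, LinearMap.add_apply] at hαβ ⊢
      linear_combination (norm := module) hαβ
    have h5 := (g.bilin_eq_zero h h4).resolve_left hne
    have h6 : Λ w + (2 : K) • B a w ∈ l' := by
      have h7 : (2 * β) • (Λ u + (2 : K) • B a u) = α • (Λ w + (2 : K) • B a w) := by
        have h8 := congrArg (fun x => Λ x + (2 : K) • B a x) (sub_eq_zero.mp h5)
        simp only [map_smul] at h8
        linear_combination (norm := module) h8
      have hα : α ≠ 0 := by
        rintro rfl
        rw [zero_smul, sub_zero, smul_eq_zero] at h5
        exact h5.elim (mul_ne_zero h2 hβ) hu0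
      have h9 : α • (Λ w + (2 : K) • B a w) ∈ l' := by
        rw [← h7]; exact l'.smul_mem _ hu
      exact (l'.smul_mem_iff hα).mp h9
    have h7 : ∀ t : K, graphPoint o Λ B (a + t • w) - graphPoint o Λ B a ∈ l' := by
      intro t
      rw [g.graphPoint_add_smul, add_assoc, add_sub_cancel_left]
      exact l'.add_mem (l'.smul_mem _ h6) (l'.smul_mem _ hwl')
    have hinj : ∀ s t : K, graphPoint o Λ B (a + s • w) = graphPoint o Λ B (a + t • w) → s = t :=
      fun s t hst => smul_left_injective K hne (add_left_cancel (g.graphPoint_injective hst))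
    have h8 : ∀ t : K, t ≠ 0 → graphPoint o Λ B a ≠ graphPoint o Λ B (a + t • w) := by
      intro t ht he
      exact ht (hinj t 0 (by rw [← he, zero_smul, add_zero]))
    have h9 := harc l' hl' _ (g.graphPoint_mem a) _ (g.graphPoint_mem (a + (1 : K) • w)) _
      (g.graphPoint_mem (a + (-1 : K) • w)) (h8 1 one_ne_zero)
      (h8 (-1) (neg_ne_zero.mpr one_ne_zero)) (h7 1) (h7 (-1))
    exact h2 (by linear_combination hinj _ _ h9)
  have hother : ∀ l ∈ T, l ≠ axisLine φ ξ → ∃ a, l = tangentLine Λ B a := by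
    intro l hl hne
    refine g.eq_tangentLine_of_arc h (hT l hl) (hTφ l hl) (fun v hv hv0 => ?_) (harc l hl)
    by_contra hvne
    exact hne (huniq l hl _ haxis v hvne hv ⟨hTφ l hl v hv, hv0⟩)
  refine Set.Subset.antisymm ?_ ?_
  · intro l hl
    by_cases hlN : l = axisLine φ ξ
    · exact Or.inl hlN
    · obtain ⟨a, rfl⟩ := hother l hl hlN
      exact Or.inr ⟨a, rfl⟩
  · rintro l (rfl | ⟨a, rfl⟩)
    · exact haxis
    · have hv : Λ e + (2 : K) • B a e ∈ tangentLine Λ B a := mem_tangentLine.mpr ⟨e, rfl⟩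
      have hξ : ξ (Λ e + (2 : K) • B a e) = e := by simp [g.proj_section, g.proj_bilin]
      have hv0 : Λ e + (2 : K) • B a e ≠ 0 := by
        intro h0
        rw [h0, map_zero] at hξ
        exact he hξ.symm
      obtain ⟨l, hl, hvl⟩ := hcov _ (g.tangentLine_le_ker a hv) hv0
      obtain ⟨a', rfl⟩ := hother l hl (by
        rintro rfl
        exact he (hξ.symm.trans hvl.2))
      rw [g.eq_of_mem_tangentLine h hv0 hv hvl]
      exact hl

end IsQuadraticGraph
end VectorModel

/-! ### From projective points to vectors -/

section Projective

variable {K V : Type*} [Field K] [AddCommGroup V] [Module K V]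

theorem mk_mem_points {v : V} {hv : v ≠ 0} {W : Submodule K V} :
    Projectivization.mk K v hv ∈ points W ↔ v ∈ W := by
  simp [points, Projectivization.submodule_mk]

theorem points_injective : Function.Injective (points : Submodule K V → Set (ℙ K V)) := by
  intro W W' hWW
  ext v
  by_cases hv : v = 0
  · simp [hv]
  rw [← mk_mem_points (hv := hv), ← mk_mem_points (hv := hv), hWW]

/-- The vectors on which `φ` takes the value `1` and which represent the affine points of `D`. -/
def affineVectors (φ : V →ₗ[K] K) (D : Set (ℙ K V)) : Set V :=
  {v | φ v = 1 ∧ ∃ hv : v ≠ 0, Projectivization.mk K v hv ∈ D}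

theorem ne_zero_of_map_eq_one {φ : V →ₗ[K] K} {v : V} (hv : φ v = 1) : v ≠ 0 := by
  rintro rfl
  simp at hv

theorem mem_affineVectors {φ : V →ₗ[K] K} {D : Set (ℙ K V)} {v : V} (h1 : φ v = 1) (hv : v ≠ 0) :
    v ∈ affineVectors φ D ↔ Projectivization.mk K v hv ∈ D :=
  ⟨fun h => h.2.2, fun h => ⟨h1, hv, h⟩⟩

theorem exists_eq_mk_of_notMem_points {φ : V →ₗ[K] K} {X : ℙ K V}
    (hX : X ∉ points (LinearMap.ker φ)) :
    ∃ (v : V) (hv : v ≠ 0), φ v = 1 ∧ X = Projectivization.mk K v hv := by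
  induction X using Projectivization.ind with | h v hv => ?_
  rw [mk_mem_points, LinearMap.mem_ker] at hX
  have h1 : (φ v)⁻¹ • v ≠ 0 := smul_ne_zero (inv_ne_zero hX) hv
  refine ⟨(φ v)⁻¹ • v, h1, by simp [hX], ?_⟩
  rw [Projectivization.mk_eq_mk_iff']
  exact ⟨φ v, by rw [smul_smul, mul_inv_cancel₀ hX, one_smul]⟩

theorem eq_of_mk_eq_mk {φ : V →ₗ[K] K} {v w : V} {hv : v ≠ 0} {hw : w ≠ 0} (h1 : φ v = 1)
    (h2 : φ w = 1) (h : Projectivization.mk K v hv = Projectivization.mk K w hw) : v = w := by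
  obtain ⟨a, ha⟩ := (Projectivization.mk_eq_mk_iff' K _ _ _ _).mp h
  have := congrArg φ ha
  rw [map_smul, h1, h2, smul_eq_mul, mul_one] at this
  rw [← ha, this, one_smul]

theorem ncard_affineVectors {φ : V →ₗ[K] K} {D : Set (ℙ K V)}
    (hD : ∀ X ∈ D, X ∉ points (LinearMap.ker φ)) : (affineVectors φ D).ncard = D.ncard := by
  refine Set.ncard_congr (fun v hv => Projectivization.mk K v hv.2.1) (fun v hv => hv.2.2)
    (fun v w hv hw h => eq_of_mk_eq_mk hv.1 hw.1 h) (fun X hX => ?_)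
  obtain ⟨v, hv, h1, rfl⟩ := exists_eq_mk_of_notMem_points (hD X hX)
  exact ⟨v, ⟨h1, hv, hX⟩, rfl⟩

theorem affineVectors_inter_points {φ : V →ₗ[K] K} (D : Set (ℙ K V)) (W : Submodule K V) :
    affineVectors φ (D ∩ points W) = affineVectors φ D ∩ W := by
  ext v
  constructor
  · rintro ⟨h1, hv, hD, hW⟩
    exact ⟨⟨h1, hv, hD⟩, mk_mem_points.mp hW⟩
  · rintro ⟨⟨h1, hv, hD⟩, hW⟩
    exact ⟨h1, hv, hD, mk_mem_points.mpr hW⟩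

theorem exists_map_eq_one {φ : V →ₗ[K] K} {W : Submodule K V} (h : ¬ W ≤ LinearMap.ker φ) :
    ∃ v ∈ W, φ v = 1 := by
  obtain ⟨w, hw, hw0⟩ := SetLike.not_le_iff_exists.mp h
  rw [LinearMap.mem_ker] at hw0
  exact ⟨(φ w)⁻¹ • w, W.smul_mem _ hw, by simp [hw0]⟩

/-- A configuration with hyperplane at infinity `ker φ`, in vector form. -/
theorem BruckBose.IsConfiguration.vectorConfig [Finite K] {φ : V →ₗ[K] K} {C : Set (ℙ K V)}
    {Pl : Set (Submodule K V)} (hV : Module.finrank K V = 5) (hodd : Odd (Nat.card K))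
    (h7 : 7 ≤ Nat.card K) (hC : IsConfiguration (Nat.card K) (LinearMap.ker φ) C Pl) :
    VectorConfig φ (affineVectors φ C) Pl where
  finite := inferInstance
  finrank_eq := hV
  odd := hodd
  seven_le := h7
  affine v hv := hv.1
  ncard_eq := by rw [ncard_affineVectors hC.affine_points, hC.card_points]
  finrank_plane W hW := (hC.affine_planes W hW).1
  exists_affine W hW := exists_map_eq_one (hC.affine_planes W hW).2
  ncard_plane W hW := by
    rw [← affineVectors_inter_points, ncard_affineVectors fun X hX => hC.affine_points X hX.1,
      (hC.plane_arc W hW).1]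
  arc a ha b hb d hd hab k hk := by
    by_contra hcon
    push Not at hcon
    have ha1 := ha.1
    have hb1 := hb.1
    obtain ⟨-, ha0, haC⟩ := ha
    obtain ⟨-, hb0, hbC⟩ := hb
    obtain ⟨hd1, hd0, hdC⟩ := hd
    have hne : ∀ {v w : V} {hv : v ≠ 0} {hw : w ≠ 0}, φ v = 1 → φ w = 1 → v ≠ w →
        Projectivization.mk K v hv ≠ Projectivization.mk K w hw :=
      fun h1 h2 hvw h => hvw (eq_of_mk_eq_mk h1 h2 h)
    obtain ⟨W, ⟨hW, haW, hbW⟩, -⟩ := hC.pair_plane _ haC _ hbC (hne ha1 hb1 hab)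
    rw [mk_mem_points] at haW hbW
    have hdW : d ∈ W := by
      rw [eq_add_of_sub_eq hk]
      exact W.add_mem (W.smul_mem _ (W.sub_mem hbW haW)) haW
    refine (hC.plane_arc W hW).2 _ ⟨haC, mk_mem_points.mpr haW⟩ _ ⟨hbC, mk_mem_points.mpr hbW⟩ _
      ⟨hdC, mk_mem_points.mpr hdW⟩ (hne ha1 hb1 hab) (hne ha1 hd1 hcon.1.symm)
      (hne hb1 hd1 hcon.2.symm) ⟨Submodule.span K {a, b}, finrank_span_pair_eq_two ha0 ?_⟩
      ⟨?_, ?_, ?_⟩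
    · intro r hr
      have := congrArg φ hr
      rw [map_smul, hb1, ha1, smul_eq_mul, mul_one] at this
      exact hab (by rw [hr, ← this, one_smul])
    · exact mk_mem_points.mpr (Submodule.subset_span (by simp))
    · exact mk_mem_points.mpr (Submodule.subset_span (by simp))
    · refine mk_mem_points.mpr (Submodule.mem_span_pair.mpr ⟨1 - k, k, ?_⟩)
      rw [eq_add_of_sub_eq hk]
      module
  mem_of_four_lt W hW h4 := by
    refine hC.plane_of_four_lt W hW ?_
    rwa [← affineVectors_inter_points, ncard_affineVectors fun X hX => hC.affine_points X hX.1]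
      at h4
  exists_plane a ha b hb hab := by
    obtain ⟨W, ⟨hW, haW, hbW⟩, -⟩ := hC.pair_plane _ ha.2.2 _ hb.2.2
      (fun h => hab (eq_of_mk_eq_mk ha.1 hb.1 h))
    exact ⟨W, hW, mk_mem_points.mp haW, mk_mem_points.mp hbW⟩
  plane_unique a ha b hb hab W hW W' hW' h₁ h₂ h₃ h₄ :=
    (hC.pair_plane _ ha.2.2 _ hb.2.2 (fun h => hab (eq_of_mk_eq_mk ha.1 hb.1 h))).unique
      ⟨hW, mk_mem_points.mpr h₁, mk_mem_points.mpr h₂⟩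
      ⟨hW', mk_mem_points.mpr h₃, mk_mem_points.mpr h₄⟩
  two_planes v hv hvc W hW hvW := by
    have hv0 := ne_zero_of_map_eq_one hv
    have hmem : ∀ {W : Submodule K V}, Projectivization.mk K v hv0 ∈ points W ↔ v ∈ W :=
      mk_mem_points
    rcases hC.three_types (Projectivization.mk K v hv0)
      (by rw [hmem, LinearMap.mem_ker, hv]; exact one_ne_zero) with h | h | h
    · exact absurd ((mem_affineVectors hv hv0).mpr h) hvc
    · exact absurd (hmem.mpr hvW) (h W hW)
    · obtain ⟨W₁, W₂, hne, hs⟩ := Set.ncard_eq_two.mp h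
      simp only [hmem] at hs
      have hs' : ∀ W', W' ∈ Pl ∧ v ∈ W' ↔ W' = W₁ ∨ W' = W₂ := fun W' =>
        (Set.ext_iff.mp hs W')
      have h1 := (hs' W₁).mpr (Or.inl rfl)
      have h2 := (hs' W₂).mpr (Or.inr rfl)
      rcases (hs' W).mp ⟨hW, hvW⟩ with rfl | rfl
      · exact ⟨W₂, h2.1, hne.symm, h2.2, fun W'' h h' => (hs' W'').mp ⟨h, h'⟩⟩
      · exact ⟨W₁, h1.1, hne, h1.2, fun W'' h h' => ((hs' W'').mp ⟨h, h'⟩).symm⟩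

end Projective

/-! ### The points at infinity of the conics -/

section Conics

variable {K V U : Type*} [Field K] [AddCommGroup V] [Module K V] [AddCommGroup U] [Module K U]

/-- Whether a point lies on the conic of `Q` can be read off from any vector representing it. -/
theorem mk_mem_zeros_iff {W : Submodule K V} (Q : QuadraticForm K W) {v : V} (hv : v ≠ 0) :
    Projectivization.mk K v hv ∈ {X : ℙ K V | ∃ (w : W) (hw : (w : V) ≠ 0),
      X = Projectivization.mk K (w : V) hw ∧ Q w = 0} ↔ ∃ hW : v ∈ W, Q ⟨v, hW⟩ = 0 := by
  constructor
  · rintro ⟨w, hw, he, hQ⟩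
    obtain ⟨k, hk⟩ := (Projectivization.mk_eq_mk_iff' K _ _ _ _).mp he
    have hvW : v ∈ W := hk ▸ W.smul_mem k w.2
    refine ⟨hvW, ?_⟩
    have : (⟨v, hvW⟩ : W) = k • w := Subtype.ext hk.symm
    rw [this, QuadraticMap.map_smul, hQ, smul_zero]
  · rintro ⟨hW, hQ⟩
    exact ⟨⟨v, hW⟩, hv, rfl, hQ⟩

/-- The form `y ^ 2 - x * z` in the coordinates `x, y, z` given by three generators of a plane. -/
theorem exists_nondegenerate_form (h2 : (2 : K) ≠ 0) {W : Submodule K V}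
    (hW : Module.finrank K W = 3) {f₀ f₁ f₂ : V} (h₀ : f₀ ∈ W) (h₁ : f₁ ∈ W) (h₂ : f₂ ∈ W)
    (hspan : ∀ w ∈ W, ∃ x y z : K, w = x • f₀ + y • f₁ + z • f₂) :
    ∃ Q : QuadraticForm K W, (QuadraticMap.polarBilin Q).Nondegenerate ∧
      ∀ (x y z : K) (w : W), (w : V) = x • f₀ + y • f₁ + z • f₂ → Q w = y * y - x * z := by
  have hsp : ⊤ ≤ Submodule.span K (Set.range ![(⟨f₀, h₀⟩ : W), ⟨f₁, h₁⟩, ⟨f₂, h₂⟩]) := by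
    rintro w -
    obtain ⟨x, y, z, hw⟩ := hspan w w.2
    have : w = x • (⟨f₀, h₀⟩ : W) + y • ⟨f₁, h₁⟩ + z • ⟨f₂, h₂⟩ := Subtype.ext hw
    rw [this]
    refine Submodule.add_mem _ (Submodule.add_mem _ ?_ ?_) ?_ <;>
      refine Submodule.smul_mem _ _ (Submodule.subset_span ?_)
    · exact ⟨0, rfl⟩
    · exact ⟨1, rfl⟩
    · exact ⟨2, rfl⟩
  let e : Module.Basis (Fin 3) K W :=
    basisOfTopLeSpanOfCardEqFinrank ![(⟨f₀, h₀⟩ : W), ⟨f₁, h₁⟩, ⟨f₂, h₂⟩] hsp (by simp [hW])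
  have he : ⇑e = ![(⟨f₀, h₀⟩ : W), ⟨f₁, h₁⟩, ⟨f₂, h₂⟩] :=
    coe_basisOfTopLeSpanOfCardEqFinrank _ _ _
  have he₀ : e 0 = ⟨f₀, h₀⟩ := by rw [he]; rfl
  have he₁ : e 1 = ⟨f₁, h₁⟩ := by rw [he]; rfl
  have he₂ : e 2 = ⟨f₂, h₂⟩ := by rw [he]; rfl
  let Q : QuadraticForm K W := QuadraticMap.linMulLin (e.coord 1) (e.coord 1) -
    QuadraticMap.linMulLin (e.coord 0) (e.coord 2)
  have hQ : ∀ w, Q w = e.coord 1 w * e.coord 1 w - e.coord 0 w * e.coord 2 w := fun w => by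
    simp [Q, QuadraticMap.linMulLin_apply]
  have hpol : ∀ v w, QuadraticMap.polarBilin Q v w = 2 * (e.coord 1 v * e.coord 1 w) -
      e.coord 0 v * e.coord 2 w - e.coord 2 v * e.coord 0 w := fun v w => by
    rw [QuadraticMap.polarBilin_apply_apply, QuadraticMap.polar, hQ, hQ, hQ]
    simp only [map_add]
    ring
  have hsep : ∀ v, (∀ w, QuadraticMap.polarBilin Q v w = 0) → v = 0 := by
    intro v hv
    have c₀ := hv (e 0)
    have c₁ := hv (e 1)
    have c₂ := hv (e 2)
    simp [hpol, h2] at c₀ c₁ c₂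
    refine e.ext_elem fun i => ?_
    fin_cases i <;> simp [c₀, c₁, c₂]
  refine ⟨Q, ⟨hsep, fun v hv => hsep v fun w => ?_⟩, ?_⟩
  · rw [← hv w, QuadraticMap.polarBilin_apply_apply, QuadraticMap.polarBilin_apply_apply,
      QuadraticMap.polar_comm]
  · intro x y z w hw
    have : w = x • e 0 + y • e 1 + z • e 2 := by
      rw [he₀, he₁, he₂]
      exact Subtype.ext hw
    rw [hQ, this]
    simp

namespace IsQuadraticGraph

variable {φ : V →ₗ[K] K} {ξ : V →ₗ[K] U} {o : V} {Λ : U →ₗ[K] V} {B : U →ₗ[K] U →ₗ[K] V}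
  {C : Set (ℙ K V)} {Pl : Set (Submodule K V)}

theorem graphPoint_ne_zero (g : IsQuadraticGraph φ ξ o Λ B (affineVectors φ C)) (a : U) :
    graphPoint o Λ B a ≠ 0 :=
  ne_zero_of_map_eq_one (g.map_graphPoint a)

theorem mk_graphPoint_mem (g : IsQuadraticGraph φ ξ o Λ B (affineVectors φ C)) (a : U) :
    Projectivization.mk K (graphPoint o Λ B a) (g.graphPoint_ne_zero a) ∈ C :=
  (g.graphPoint_mem a).2.2

theorem exists_eq_mk_graphPoint (g : IsQuadraticGraph φ ξ o Λ B (affineVectors φ C))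
    (hC : ∀ X ∈ C, X ∉ points (LinearMap.ker φ)) {X : ℙ K V} (hX : X ∈ C) :
    ∃ a, X = Projectivization.mk K (graphPoint o Λ B a) (g.graphPoint_ne_zero a) := by
  obtain ⟨v, hv, h1, rfl⟩ := exists_eq_mk_of_notMem_points (hC X hX)
  obtain ⟨a, rfl⟩ := (g.mem_iff v).mp ((mem_affineVectors h1 hv).mpr hX)
  exact ⟨a, rfl⟩

/-- The points of `C` in a plane of the configuration, together with the common point at infinity of
the axes, are the points of a conic. -/
theorem isConic (g : IsQuadraticGraph φ ξ o Λ B (affineVectors φ C))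
    (h : VectorConfig φ (affineVectors φ C) Pl) (hC : ∀ X ∈ C, X ∉ points (LinearMap.ker φ))
    (a : U) {b : U} (hb : b ≠ 0) :
    IsConic (conicPlane o Λ B a b) ((C ∩ points (conicPlane o Λ B a b)) ∪
      {Projectivization.mk K (B b b) (g.bilin_self_ne_zero h hb)}) := by
  obtain ⟨Q, hQ, hQ'⟩ := exists_nondegenerate_form h.two_ne_zero (g.finrank_conicPlane h a hb)
    (graphPoint_mem_conicPlane a b) (tangent_mem_conicPlane a b) (bilin_mem_conicPlane a b)
    (fun w hw => ⟨φ w, g.mem_conicPlane hw⟩)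
  refine ⟨Q, hQ, ?_⟩
  ext X
  induction X using Projectivization.ind with | h v hv => ?_
  rw [mk_mem_zeros_iff]
  constructor
  · rintro (⟨hvC, hvW⟩ | hvB)
    · obtain ⟨a', ha'⟩ := g.exists_eq_mk_graphPoint hC hvC
      rw [ha'] at hvW
      obtain ⟨t, rfl⟩ := g.exists_of_mem_conicPlane (mk_mem_points.mp hvW)
      rw [← mk_mem_zeros_iff Q hv, ha', mk_mem_zeros_iff]
      refine ⟨mk_mem_points.mp hvW, ?_⟩
      rw [hQ' 1 t (t ^ 2) _ ((g.graphPoint_add_smul a b t).trans (by rw [one_smul]))]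
      ring
    · rw [Set.mem_singleton_iff] at hvB
      rw [← mk_mem_zeros_iff Q hv, hvB, mk_mem_zeros_iff]
      refine ⟨bilin_mem_conicPlane a b, ?_⟩
      rw [hQ' 0 0 1 _ (by simp)]
      ring
  · rintro ⟨hvW, hv0⟩
    obtain ⟨s, t, hst⟩ := g.mem_conicPlane hvW
    rw [hQ' _ s t _ hst] at hv0
    by_cases hφ : φ v = 0
    · right
      have hs : s = 0 := by
        rw [hφ, zero_mul, sub_zero] at hv0
        exact mul_self_eq_zero.mp hv0
      rw [Set.mem_singleton_iff, Projectivization.mk_eq_mk_iff']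
      exact ⟨t, by rw [hst, hφ, hs]; simp⟩
    · left
      have he : v = φ v • graphPoint o Λ B (a + (s / φ v) • b) := by
        rw [g.graphPoint_add_smul, smul_add, smul_add, smul_smul, smul_smul]
        have h1 : φ v * (s / φ v) = s := by field_simp
        have h2 : φ v * (s / φ v) ^ 2 = t := by
          field_simp
          linear_combination hv0
        rw [h1, h2]
        exact hst
      refine ⟨?_, mk_mem_points.mpr hvW⟩
      have : Projectivization.mk K v hv = Projectivization.mk K _
          (g.graphPoint_ne_zero (a + (s / φ v) • b)) :=
        (Projectivization.mk_eq_mk_iff' K _ _ _ _).mpr ⟨φ v, he.symm⟩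
      rw [this]
      exact g.mk_graphPoint_mem _

/-- A conic through the points `graphPoint (a + t • b)` contains the point `B b b` at infinity,
since the values of its equation in these points are those of a polynomial in `t` of degree four,
with the value in `B b b` as leading coefficient. -/
theorem isInftyPoint_iff (g : IsQuadraticGraph φ ξ o Λ B (affineVectors φ C))
    (h : VectorConfig φ (affineVectors φ C) Pl) (hC : ∀ X ∈ C, X ∉ points (LinearMap.ker φ))
    (a : U) {b : U} (hb : b ≠ 0) (Y : ℙ K V) :
    IsInftyPoint C (conicPlane o Λ B a b) Y ↔
      Y = Projectivization.mk K (B b b) (g.bilin_self_ne_zero h hb) := by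
  constructor
  · rintro ⟨Q, -, hD⟩
    have := h.finite
    let f₀ : conicPlane o Λ B a b := ⟨_, graphPoint_mem_conicPlane a b⟩
    let f₁ : conicPlane o Λ B a b := ⟨_, tangent_mem_conicPlane a b⟩
    let f₂ : conicPlane o Λ B a b := ⟨_, bilin_mem_conicPlane a b⟩
    have hx : ∀ t : K, Q (f₀ + (t • f₁ + t ^ 2 • f₂)) = 0 := by
      intro t
      have hmem : Projectivization.mk K _ (g.graphPoint_ne_zero (a + t • b)) ∈
          (C ∩ points (conicPlane o Λ B a b)) ∪ {Y} :=
        Or.inl ⟨g.mk_graphPoint_mem _, mk_mem_points.mpr (g.graphPoint_add_smul_mem a b t)⟩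
      rw [hD, mk_mem_zeros_iff] at hmem
      obtain ⟨hW, hQ⟩ := hmem
      rw [← hQ]
      congr 1
      refine Subtype.ext ?_
      rw [← add_assoc]
      exact (g.graphPoint_add_smul a b t).symm
    simp only [QuadraticMap.map_add Q, QuadraticMap.map_smul, QuadraticMap.polar_add_right,
      QuadraticMap.polar_smul_left, QuadraticMap.polar_smul_right, smul_eq_mul] at hx
    have hB : Q f₂ = 0 :=
      (coeff_eq_zero_of_forall_quartic (K := K) (v₀ := Q f₀) (v₁ := QuadraticMap.polar Q f₀ f₁)
        (v₂ := Q f₁ + QuadraticMap.polar Q f₀ f₂) (v₃ := QuadraticMap.polar Q f₁ f₂)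
        (by have := h.seven_le; omega) (fun t => by
          simp only [smul_eq_mul]
          linear_combination hx t)).2.2.2.2
    have hmem := (mk_mem_zeros_iff Q (g.bilin_self_ne_zero h hb)).mpr ⟨_, hB⟩
    rw [← hD] at hmem
    rcases hmem with hmem | hmem
    · exact absurd (mk_mem_points.mpr (LinearMap.mem_ker.mpr (g.map_bilin b b))) (hC _ hmem.1)
    · exact hmem.symm
  · rintro rfl
    exact g.isConic h hC a hb

end IsQuadraticGraph
end Conics

/-! ### The spread -/

section Spread

variable {K V U : Type*} [Field K] [AddCommGroup V] [Module K V] [AddCommGroup U] [Module K U]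

namespace IsQuadraticGraph

variable {φ : V →ₗ[K] K} {ξ : V →ₗ[K] U} {o : V} {Λ : U →ₗ[K] V} {B : U →ₗ[K] U →ₗ[K] V}
  {C : Set (ℙ K V)} {Pl : Set (Submodule K V)}

theorem map_tangent (g : IsQuadraticGraph φ ξ o Λ B (affineVectors φ C)) (a u : U) :
    φ (Λ u + (2 : K) • B a u) = 0 := by
  simp [g.map_section, g.map_bilin]

theorem proj_tangent (g : IsQuadraticGraph φ ξ o Λ B (affineVectors φ C)) (a u : U) :
    ξ (Λ u + (2 : K) • B a u) = u := by
  simp [g.proj_section, g.proj_bilin]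

/-- The tangent in `graphPoint a` to the conic `t ↦ graphPoint (a + t • b)`. -/
theorem isTangentAt (g : IsQuadraticGraph φ ξ o Λ B (affineVectors φ C))
    (h : VectorConfig φ (affineVectors φ C) Pl) (hC : ∀ X ∈ C, X ∉ points (LinearMap.ker φ))
    (a : U) {b : U} (hb : b ≠ 0) :
    IsTangentAt (conicPlane o Λ B a b) ((C ∩ points (conicPlane o Λ B a b)) ∪
      {Projectivization.mk K (B b b) (g.bilin_self_ne_zero h hb)})
      (Projectivization.mk K _ (g.graphPoint_ne_zero a))
      (Submodule.span K {graphPoint o Λ B a, Λ b + (2 : K) • B a b}) := by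
  have hl : ∀ w ∈ Submodule.span K {graphPoint o Λ B a, Λ b + (2 : K) • B a b}, ∃ y : K,
      w = φ w • graphPoint o Λ B a + y • (Λ b + (2 : K) • B a b) := by
    intro w hw
    obtain ⟨x, y, hxy⟩ := Submodule.mem_span_pair.mp hw
    refine ⟨y, ?_⟩
    rw [← hxy, map_add, map_smul, map_smul, g.map_graphPoint, g.map_tangent]
    simp
  refine ⟨finrank_span_pair_eq_two (g.graphPoint_ne_zero a) ?_, ?_, ?_⟩
  · intro k hk
    have h1 := congrArg φ hk
    rw [g.map_tangent, map_smul, g.map_graphPoint, smul_eq_mul, mul_one] at h1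
    rw [← h1, zero_smul] at hk
    have h2 := g.proj_tangent a b
    rw [hk, map_zero] at h2
    exact hb h2.symm
  · rw [Submodule.span_le]
    rintro x (rfl | rfl)
    · exact graphPoint_mem_conicPlane a b
    · exact tangent_mem_conicPlane a b
  · refine Set.Subset.antisymm ?_ ?_
    · rintro X ⟨⟨hXC, hXW⟩ | hX, hXl⟩
      · obtain ⟨a', rfl⟩ := g.exists_eq_mk_graphPoint hC hXC
        obtain ⟨t, rfl⟩ := g.exists_of_mem_conicPlane (mk_mem_points.mp hXW)
        obtain ⟨y, hy⟩ := hl _ (mk_mem_points.mp hXl)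
        rw [g.map_graphPoint, one_smul] at hy
        have h1 := congrArg ξ hy
        rw [map_add, map_smul, g.proj_graphPoint, g.proj_graphPoint, g.proj_tangent,
          add_right_inj] at h1
        have h2 : y = t := smul_left_injective K hb h1.symm
        rw [h2, g.graphPoint_add_smul, add_eq_left, smul_eq_zero] at hy
        have ht : t = 0 := eq_zero_of_pow_eq_zero
          (hy.resolve_right (g.bilin_self_ne_zero h hb))
        subst ht
        simp
      · rw [Set.mem_singleton_iff] at hX
        subst hX
        obtain ⟨y, hy⟩ := hl _ (mk_mem_points.mp hXl)
        rw [g.map_bilin, zero_smul, zero_add] at hy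
        have h1 := congrArg ξ hy
        rw [map_smul, g.proj_tangent, g.proj_bilin, eq_comm, smul_eq_zero] at h1
        rw [h1.resolve_right hb, zero_smul] at hy
        exact absurd hy (g.bilin_self_ne_zero h hb)
    · rintro _ rfl
      exact ⟨Or.inl ⟨g.mk_graphPoint_mem a, mk_mem_points.mpr (graphPoint_mem_conicPlane a b)⟩,
        mk_mem_points.mpr (Submodule.subset_span (by simp))⟩

/-- The tangents in a point of `C` meet the hyperplane at infinity in the points of a line. -/
theorem tPoint_eq (g : IsQuadraticGraph φ ξ o Λ B (affineVectors φ C))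
    (h : VectorConfig φ (affineVectors φ C) Pl) (hC : ∀ X ∈ C, X ∉ points (LinearMap.ker φ))
    (a : U) : tPoint (LinearMap.ker φ) C Pl (Projectivization.mk K _ (g.graphPoint_ne_zero a)) =
      points (tangentLine Λ B a) := by
  ext X
  induction X using Projectivization.ind with | h v hv => ?_
  rw [mk_mem_points]
  constructor
  · rintro ⟨hvφ, W, hW, haW, Y, hY, l, ⟨-, hlW, hl⟩, hvl⟩
    rw [mk_mem_points] at haW hvφ hvl
    rw [LinearMap.mem_ker] at hvφ
    obtain ⟨b, hb, rfl⟩ := g.exists_eq_conicPlane h hW haW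
    rw [g.isInftyPoint_iff h hC a hb] at hY
    subst hY
    have hal : graphPoint o Λ B a ∈ l :=
      mk_mem_points.mp (hl.symm ▸ Set.mem_singleton _ : _ ∈ _ ∩ points l).2
    obtain ⟨s, t, hst⟩ := g.mem_conicPlane (hlW hvl)
    rw [hvφ, zero_smul, zero_add] at hst
    have hs : s ≠ 0 := by
      rintro rfl
      rw [zero_smul, zero_add] at hst
      have ht : t ≠ 0 := by
        rintro rfl
        exact hv (by rw [hst, zero_smul])
      have hBl : B b b ∈ l := by
        rw [hst] at hvl
        exact (l.smul_mem_iff ht).mp hvl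
      have hmem : Projectivization.mk K (B b b) (g.bilin_self_ne_zero h hb) ∈
          ({Projectivization.mk K _ (g.graphPoint_ne_zero a)} : Set (ℙ K V)) := by
        rw [← hl]
        exact ⟨Or.inr rfl, mk_mem_points.mpr hBl⟩
      obtain ⟨k, hk⟩ := (Projectivization.mk_eq_mk_iff' K _ _ _ _).mp (Set.mem_singleton_iff.mp hmem)
      have h1 := congrArg φ hk
      rw [map_smul, g.map_graphPoint, g.map_bilin, smul_eq_mul, mul_one] at h1
      rw [h1, zero_smul] at hk
      exact g.bilin_self_ne_zero h hb hk.symm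
    -- the line through `graphPoint a` and `v` meets the conic in `graphPoint (a + (t / s) • b)`
    have hmem : graphPoint o Λ B (a + (t / s) • b) ∈ l := by
      have : graphPoint o Λ B (a + (t / s) • b) = graphPoint o Λ B a + (t / s ^ 2) • v := by
        have h1 : t / s ^ 2 * s = t / s := by field_simp
        have h2 : t / s ^ 2 * t = (t / s) ^ 2 := by field_simp
        rw [g.graphPoint_add_smul, hst, ← h2, ← h1]
        module
      rw [this]
      exact l.add_mem hal (l.smul_mem _ hvl)
    have hmem' : Projectivization.mk K _ (g.graphPoint_ne_zero (a + (t / s) • b)) ∈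
        ({Projectivization.mk K _ (g.graphPoint_ne_zero a)} : Set (ℙ K V)) := by
      rw [← hl]
      exact ⟨Or.inl ⟨g.mk_graphPoint_mem _, mk_mem_points.mpr (g.graphPoint_add_smul_mem a b _)⟩,
        mk_mem_points.mpr hmem⟩
    have h3 := g.graphPoint_injective (eq_of_mk_eq_mk (g.map_graphPoint _) (g.map_graphPoint _)
      (Set.mem_singleton_iff.mp hmem'))
    rw [add_eq_left, smul_eq_zero, or_iff_left hb, div_eq_zero_iff, or_iff_left hs] at h3
    rw [h3, zero_smul, add_zero] at hst
    rw [hst]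
    exact Submodule.smul_mem _ _ (mem_tangentLine.mpr ⟨b, rfl⟩)
  · intro hva
    obtain ⟨u, rfl⟩ := mem_tangentLine.mp hva
    have hu : u ≠ 0 := by
      rintro rfl
      simp at hv
    exact ⟨mk_mem_points.mpr (g.tangentLine_le_ker a hva), conicPlane o Λ B a u,
      g.conicPlane_mem h a hu, mk_mem_points.mpr (graphPoint_mem_conicPlane a u), _,
      g.isConic h hC a hu, _, g.isTangentAt h hC a hu,
      mk_mem_points.mpr (Submodule.subset_span (by simp))⟩

/-- The `∞`-points lie on the axis line, and a point at infinity off the axis line is on a tangent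
line, hence in a plane of the configuration. A point of the axis line that lies in a plane of the
configuration is the `∞`-point of that plane. -/
theorem tInfty_eq (g : IsQuadraticGraph φ ξ o Λ B (affineVectors φ C))
    (h : VectorConfig φ (affineVectors φ C) Pl) (hC : ∀ X ∈ C, X ∉ points (LinearMap.ker φ)) :
    tInfty (LinearMap.ker φ) C Pl = points (axisLine φ ξ) := by
  ext X
  constructor
  · rintro (⟨W, hW, hX⟩ | ⟨hXφ, hX⟩)
    · obtain ⟨a, ha⟩ := g.exists_graphPoint_mem h hW
      obtain ⟨b, hb, rfl⟩ := g.exists_eq_conicPlane h hW ha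
      rw [g.isInftyPoint_iff h hC a hb] at hX
      subst hX
      exact mk_mem_points.mpr (g.bilin_mem_axisLine b b)
    · induction X using Projectivization.ind with | h v hv => ?_
      rw [mk_mem_points, LinearMap.mem_ker] at hXφ
      rw [mk_mem_points, mem_axisLine]
      refine ⟨hXφ, ?_⟩
      by_contra hξ
      obtain ⟨a, ha⟩ := g.exists_mem_tangentLine h hXφ hξ
      obtain ⟨u, rfl⟩ := mem_tangentLine.mp ha
      have hu : u ≠ 0 := by
        rintro rfl
        simp at hv
      exact hX _ (g.conicPlane_mem h a hu)
        (mk_mem_points.mpr ⟨tangent_mem_conicPlane a u, LinearMap.mem_ker.mpr hXφ⟩)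
  · induction X using Projectivization.ind with | h v hv => ?_
    rw [mk_mem_points, mem_axisLine]
    rintro ⟨hvφ, hvξ⟩
    by_cases hz : IsZeroPoint (LinearMap.ker φ) Pl (Projectivization.mk K v hv)
    · exact Or.inr hz
    · left
      obtain ⟨W, hW, hvW⟩ : ∃ W ∈ Pl, v ∈ W := by
        by_contra hcon
        push Not at hcon
        exact hz ⟨mk_mem_points.mpr hvφ, fun W hW hvW => hcon W hW (mk_mem_points.mp hvW).1⟩
      obtain ⟨a, ha⟩ := g.exists_graphPoint_mem h hW
      obtain ⟨b, hb, rfl⟩ := g.exists_eq_conicPlane h hW ha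
      refine ⟨_, hW, (g.isInftyPoint_iff h hC a hb _).mpr ?_⟩
      obtain ⟨s, t, hst⟩ := g.mem_conicPlane hvW
      rw [hvφ, zero_smul, zero_add] at hst
      have h1 := congrArg ξ hst
      rw [hvξ, map_add, map_smul, map_smul, g.proj_tangent, g.proj_bilin, smul_zero, add_zero,
        eq_comm, smul_eq_zero] at h1
      rw [h1.resolve_right hb, zero_smul, zero_add] at hst
      exact (Projectivization.mk_eq_mk_iff' K _ _ _ _).mpr ⟨t, hst.symm⟩

theorem tSpread_eq (g : IsQuadraticGraph φ ξ o Λ B (affineVectors φ C))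
    (h : VectorConfig φ (affineVectors φ C) Pl) (hC : ∀ X ∈ C, X ∉ points (LinearMap.ker φ)) :
    tSpread (LinearMap.ker φ) C Pl =
      points '' insert (axisLine φ ξ) (Set.range (tangentLine Λ B)) := by
  rw [Set.image_insert_eq, ← Set.range_comp, Set.insert_eq, Set.union_comm, tSpread,
    g.tInfty_eq h hC]
  congr 1
  ext s
  constructor
  · rintro ⟨A, hA, rfl⟩
    obtain ⟨a, rfl⟩ := g.exists_eq_mk_graphPoint hC hA
    exact ⟨a, (g.tPoint_eq h hC a).symm⟩
  · rintro ⟨a, rfl⟩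
    exact ⟨_, g.mk_graphPoint_mem a, (g.tPoint_eq h hC a).symm⟩

theorem isSpread (g : IsQuadraticGraph φ ξ o Λ B (affineVectors φ C))
    (h : VectorConfig φ (affineVectors φ C) Pl) : IsSpread (LinearMap.ker φ)
      (points '' insert (axisLine φ ξ) (Set.range (tangentLine Λ B))) := by
  refine ⟨?_, fun X hX => ?_⟩
  · rintro _ ⟨l, rfl | ⟨a, rfl⟩, rfl⟩
    · exact ⟨_, g.finrank_axisLine h, fun v hv => hv.1, rfl⟩
    · exact ⟨_, g.finrank_tangentLine a, g.tangentLine_le_ker a, rfl⟩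
  · induction X using Projectivization.ind with | h v hv => ?_
    rw [mk_mem_points, LinearMap.mem_ker] at hX
    by_cases hξ : ξ v = 0
    · refine ⟨_, ⟨⟨_, Or.inl rfl, rfl⟩, mk_mem_points.mpr ⟨hX, hξ⟩⟩, ?_⟩
      rintro _ ⟨⟨l, rfl | ⟨a, rfl⟩, rfl⟩, hl⟩
      · rfl
      · exact absurd (g.eq_zero_of_mem_tangentLine (mk_mem_points.mp hl) hξ) hv
    · obtain ⟨a, ha⟩ := g.exists_mem_tangentLine h hX hξ
      refine ⟨_, ⟨⟨_, Or.inr ⟨a, rfl⟩, rfl⟩, mk_mem_points.mpr ha⟩, ?_⟩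
      rintro _ ⟨⟨l, rfl | ⟨a', rfl⟩, rfl⟩, hl⟩
      · exact absurd (mk_mem_points.mp hl).2 hξ
      · rw [g.eq_of_mem_tangentLine h hv (mk_mem_points.mp hl) ha]

theorem isArc (g : IsQuadraticGraph φ ξ o Λ B (affineVectors φ C))
    (h : VectorConfig φ (affineVectors φ C) Pl) : IsArc planeIncident
      (planeSet (LinearMap.ker φ)
        (points '' insert (axisLine φ ξ) (Set.range (tangentLine Λ B))) C) := by
  rintro _ ⟨X₁, hX₁, hC₁, rfl⟩ _ ⟨X₂, hX₂, hC₂, rfl⟩ _ ⟨X₃, hX₃, hC₃, rfl⟩ h₁₂ h₁₃ h₂₃ m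
    ⟨hm₁, hm₂, hm₃⟩
  cases m with
  | atInfinity => exact hm₁
  | ofPlane W hW hS =>
    obtain ⟨v₁, hv₁, e₁, rfl⟩ := exists_eq_mk_of_notMem_points hX₁
    obtain ⟨v₂, hv₂, e₂, rfl⟩ := exists_eq_mk_of_notMem_points hX₂
    obtain ⟨v₃, hv₃, e₃, rfl⟩ := exists_eq_mk_of_notMem_points hX₃
    have c₁ := (mem_affineVectors e₁ hv₁).mpr hC₁
    have c₂ := (mem_affineVectors e₂ hv₂).mpr hC₂
    have c₃ := (mem_affineVectors e₃ hv₃).mpr hC₃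
    have n₁₂ : v₁ ≠ v₂ := by rintro rfl; exact h₁₂ rfl
    have n₁₃ : v₁ ≠ v₃ := by rintro rfl; exact h₁₃ rfl
    have n₂₃ : v₂ ≠ v₃ := by rintro rfl; exact h₂₃ rfl
    have w₁ : v₁ ∈ W := mk_mem_points.mp hm₁
    have w₂ : v₂ ∈ W := mk_mem_points.mp hm₂
    have w₃ : v₃ ∈ W := mk_mem_points.mp hm₃
    have d₂ : v₂ - v₁ ∈ W ⊓ LinearMap.ker φ := ⟨W.sub_mem w₂ w₁, by simp [e₁, e₂]⟩
    have d₃ : v₃ - v₁ ∈ W ⊓ LinearMap.ker φ := ⟨W.sub_mem w₃ w₁, by simp [e₁, e₃]⟩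
    obtain ⟨l, hl, hlW⟩ := hS
    rw [← points_injective hlW] at d₂ d₃
    rcases hl with rfl | ⟨a, rfl⟩
    · exact n₁₂ (g.axisLine_arc c₁ c₂ d₂)
    · exact n₂₃ (g.tangentLine_arc h c₁ c₂ c₃ n₁₂ n₁₃ d₂ d₃)

/-- The spread is recovered from the arc property, which says that two chords of `C` with a common
end do not have directions in one spread line. -/
theorem eq_of_isArc (g : IsQuadraticGraph φ ξ o Λ B (affineVectors φ C))
    (h : VectorConfig φ (affineVectors φ C) Pl) {S : Set (Set (ℙ K V))}
    (hS : IsSpread (LinearMap.ker φ) S)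
    (harc : IsArc planeIncident (planeSet (LinearMap.ker φ) S C)) :
    S = points '' insert (axisLine φ ξ) (Set.range (tangentLine Λ B)) := by
  have := h.moduleFinite
  have hS' : S = points '' {l : Submodule K V | Module.finrank K l = 2 ∧ l ≤ LinearMap.ker φ ∧
      points l ∈ S} := by
    ext s
    constructor
    · intro hs
      obtain ⟨l, h2, hl, rfl⟩ := hS.1 s hs
      exact ⟨l, ⟨h2, hl, hs⟩, rfl⟩
    · rintro ⟨l, ⟨-, -, hl⟩, rfl⟩
      exact hl
  rw [hS']
  congr 1
  refine g.eq_of_partition h (fun l hl => hl.1) (fun l hl v hv => hl.2.1 hv) ?_ ?_ ?_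
  · intro v hvφ hv
    obtain ⟨s, ⟨hs, hvs⟩, -⟩ := hS.2 (Projectivization.mk K v hv) (mk_mem_points.mpr hvφ)
    obtain ⟨l, h2, hl, rfl⟩ := hS.1 s hs
    exact ⟨l, ⟨h2, hl, hs⟩, mk_mem_points.mp hvs⟩
  · intro l hl l' hl' v hv hvl hvl'
    exact points_injective ((hS.2 (Projectivization.mk K v hv)
      (mk_mem_points.mpr (hl.2.1 hvl))).unique ⟨hl.2.2, mk_mem_points.mpr hvl⟩
      ⟨hl'.2.2, mk_mem_points.mpr hvl'⟩)
  · intro l hl v₁ c₁ v₂ c₂ v₃ c₃ n₁₂ n₁₃ d₂ d₃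
    by_contra n₂₃
    have e₁ := c₁.1
    have w₁ : v₁ ∈ Submodule.span K {v₁} ⊔ l :=
      Submodule.mem_sup_left (Submodule.mem_span_singleton_self v₁)
    have w : ∀ v, v - v₁ ∈ l → v ∈ Submodule.span K {v₁} ⊔ l := by
      intro v hv
      rw [← add_sub_cancel v₁ v]
      exact Submodule.add_mem _ w₁ (Submodule.mem_sup_right hv)
    have hinf : (Submodule.span K {v₁} ⊔ l) ⊓ LinearMap.ker φ = l := by
      refine le_antisymm ?_ (le_inf le_sup_right hl.2.1)
      rintro x ⟨hx, hxφ⟩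
      obtain ⟨y, hy, z, hz, rfl⟩ := Submodule.mem_sup.mp hx
      obtain ⟨k, rfl⟩ := Submodule.mem_span_singleton.mp hy
      have hz0 : φ z = 0 := hl.2.1 hz
      have hk : k = 0 := by simpa [e₁, hz0] using hxφ
      simpa [hk] using hz
    have hrank := finrank_inf_ker_add_one w₁ e₁
    rw [hinf, hl.1] at hrank
    have haff : ∀ {v : V} (hv : v ∈ affineVectors φ C),
        Projectivization.mk K v hv.2.1 ∉ points (LinearMap.ker φ) := by
      intro v hv hmem
      rw [mk_mem_points, LinearMap.mem_ker, hv.1] at hmem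
      exact one_ne_zero hmem
    have hne : ∀ {v v' : V} (hv : v ∈ affineVectors φ C) (hv' : v' ∈ affineVectors φ C), v ≠ v' →
        (PlanePoint.affine _ (haff hv) : PlanePoint (LinearMap.ker φ) S) ≠
          PlanePoint.affine _ (haff hv') := by
      intro v v' hv hv' hvv he
      exact hvv (eq_of_mk_eq_mk hv.1 hv'.1 (PlanePoint.affine.inj he))
    refine harc _ ⟨_, haff c₁, c₁.2.2, rfl⟩ _ ⟨_, haff c₂, c₂.2.2, rfl⟩ _ ⟨_, haff c₃, c₃.2.2, rfl⟩
      (hne c₁ c₂ n₁₂) (hne c₁ c₃ n₁₃) (hne c₂ c₃ n₂₃)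
      (PlaneLine.ofPlane (Submodule.span K {v₁} ⊔ l) ⟨hrank.symm, fun hle => ?_⟩
        (by rw [hinf]; exact hl.2.2))
      ⟨mk_mem_points.mpr w₁, mk_mem_points.mpr (w _ d₂), mk_mem_points.mpr (w _ d₃)⟩
    have := hle w₁
    rw [LinearMap.mem_ker, e₁] at this
    exact one_ne_zero this

end IsQuadraticGraph

theorem ncard_planeSet {H : Submodule K V} {C : Set (ℙ K V)} (hC : ∀ X ∈ C, X ∉ points H)
    (S : Set (Set (ℙ K V))) : (planeSet H S C).ncard = C.ncard := by
  refine (Set.ncard_congr (fun X hX => PlanePoint.affine X (hC X hX)) ?_ ?_ ?_).symm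
  · exact fun X hX => ⟨X, hC X hX, hX, rfl⟩
  · exact fun X Y hX hY h => PlanePoint.affine.inj h
  · rintro _ ⟨X, hX, hXC, rfl⟩
    exact ⟨X, hXC, rfl⟩

theorem exists_ker_eq_of_finrank {H : Submodule K V} [Module.Finite K V]
    (hH : Module.finrank K H + 1 = Module.finrank K V) :
    ∃ φ : V →ₗ[K] K, LinearMap.ker φ = H := by
  have hlt : H < ⊤ := by
    refine lt_top_iff_ne_top.mpr ?_
    rintro rfl
    rw [finrank_top] at hH
    omega
  obtain ⟨φ, hφ, hle⟩ := Submodule.exists_le_ker_of_lt_top H hlt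
  refine ⟨φ, (Submodule.eq_of_le_of_finrank_le hle ?_).symm⟩
  have : Module.finrank K (LinearMap.ker φ) < Module.finrank K V :=
    Submodule.finrank_lt (fun h => hφ (LinearMap.ker_eq_top.mp h))
  omega

end Spread

theorem mainTheorem7 {K V : Type*} [Field K] [Finite K] [AddCommGroup V] [Module K V]
    (hV : Module.finrank K V = 5) (q : ℕ) (hq : Nat.card K = q) (hodd : Odd q) (hq7 : 7 ≤ q)
    (H : Submodule K V) (hH : Module.finrank K H = 4)
    (C : Set (ℙ K V)) (Pl : Set (Submodule K V)) (hC : IsConfiguration q H C Pl) :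
    IsSpread H (tSpread H C Pl) ∧
    (∀ S' : Set (Set (ℙ K V)), IsSpread H S' → S' ≠ tSpread H C Pl →
      ¬ IsArc planeIncident (planeSet H S' C)) ∧
    (∃! S : Set (Set (ℙ K V)), IsSpread H S ∧
      IsKArc planeIncident (q ^ 2) (planeSet H S C)) := by
  subst hq
  have : Module.Finite K V := Module.finite_of_finrank_pos (by omega)
  obtain ⟨φ, rfl⟩ := exists_ker_eq_of_finrank (H := H) (by omega)
  have h := hC.vectorConfig hV hodd hq7
  obtain ⟨ξ, o, Λ, B, g⟩ := h.exists_isQuadraticGraph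
  rw [g.tSpread_eq h hC.affine_points]
  refine ⟨g.isSpread h, fun S hS hne harc => hne (g.eq_of_isArc h hS harc), _,
    ⟨g.isSpread h, ?_, g.isArc h⟩, fun S hS => g.eq_of_isArc h hS.1 hS.2.2⟩
  rw [ncard_planeSet hC.affine_points, hC.card_points]
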